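/- Let $\Omega\subset\mathbb R^3$ be a bounded domain with smooth boundary and outward unit normal $\nu$. Let $(N,J,h)$ be a Kähler manifold which is a closed (for instance compact) embedded submanifold of $\mathbb R^K$ with the induced metric $h$. For $y\in N$ let $P(y)$ be the orthogonal projection of $\mathbb R^K$ onto $T_yN$, and let $A(y)(X,Y)=-(D_XP)(y)\,Y$ be the second fundamental form, with the sign for which the Levi-Civita connection is $\nabla_XY=D_XY+A(X,Y)$. Let $k\in\mathbb N=\{0,1,2,\dots\}$ and $u_0\in W^{2k+2,2}(\Omega,N)=\{u\in W^{2k+2,2}(\Omega,\mathbb R^K): u(x)\in N \text{ for a.e. } x\in\Omega\}$. For $0\le j\le k$ let $V_j=\partial_t^ju|_{t=0}$ and $v_j(0)=\nabla_t^ju|_{t=0}$ be the initial time derivatives and covariant time derivatives that the Schrödinger flow $$\partial_tu=J(u)\,\tau(u),\qquad \tau(u)=\Delta u+\sum_{a=1}^3A(u)(\partial_au,\partial_au),\qquad u|_{t=0}=u_0,$$ determines formally from $u_0$. That is, $V_0=u_0$, and $V_{j+1}$ is $\partial_t^j\big(J(u)\tau(u)\big)$ at $t=0$, computed from the Taylor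 polynomials $\sum_{i\le j}\frac{t^i}{i!}V_i$, $\sum_{i\le j}\frac{t^i}{i!}\partial_aV_i$, $\sum_{i\le j}\frac{t^i}{i!}\Delta V_i$ of $u,\partial_au,\Delta u$ (with weak derivatives in $x$); similarly $v_0=u$, $v_1=\partial_tu$, $v_{l+1}=\nabla_tv_l=P(u)\,\partial_tv_l$, and $v_j(0)$ is computed from $\sum_{i\le j}\frac{t^i}{i!}V_i$. Here $J$, $A$, $P$ are extended smoothly from $N$ to $\mathbb R^K$ near $u_0(x)$; the results do not depend on the extensions. Then $V_j$ and $v_j(0)$ belong to $W^{2(k-j)+2,2}(\Omega,\mathbb R^K)$ for $0\le j\le k$, and the following are equivalent: 1. $u_0$ satisfies the compatibility condition of order $k$: $\dfrac{\partial V_j}{\partial\nu}\Big|_{\partial\Omega}=0$ for all $j\in\{0,1,\dots,k\}$; 2. $\nabla_\nu v_j(0)|_{\partial\Omega}=0$ for all $j\in\{0,1,\dots,k\}$, where $\nabla_a v=P(u_0)\,\partial_av$ is the pull-back connection along $u_0$ (for $v=u_0$ this is $\partial_au_0$). Here $\partial_\nu V=\sum_a\nu_a\,\partial_aV|_{\partial\Omega}$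 and $\nabla_\nu v=\sum_a\nu_a\,\nabla_av|_{\partial\Omega}$ are formed with the traces on $\partial\Omega$ of $\partial_aV,\nabla_av\in W^{1,2}(\Omega)$, and vanishing means almost everywhere for the surface measure of $\partial\Omega$. -/

import Mathlib

open MeasureTheory Filter Topology
open scoped ContDiff

noncomputable section

namespace SchrodingerFlow

/-- The Euclidean space `ℝⁿ`. -/
abbrev Euc (n : ℕ) : Type := EuclideanSpace ℝ (Fin n)

/-! ### Bounded smooth domains of `ℝ³`, outward normal, surface measure -/

/-- `ρ` is a smooth defining function of `Ω` near the boundary point `x`. -/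
def IsLocalDefiningFunction (Ω : Set (Euc 3)) (x : Euc 3) (ρ : Euc 3 → ℝ) : Prop :=
  ContDiff ℝ ∞ ρ ∧ gradient ρ x ≠ 0 ∧ ∀ᶠ z in 𝓝 x, (z ∈ Ω ↔ ρ z < 0)

/-- `Ω` is a bounded domain of `ℝ³` with smooth boundary. -/
structure IsBoundedSmoothDomain (Ω : Set (Euc 3)) : Prop where
  isOpen : IsOpen Ω
  isConnected : IsConnected Ω
  isBounded : Bornology.IsBounded Ω
  smooth_boundary : ∀ x ∈ frontier Ω, ∃ ρ, IsLocalDefiningFunction Ω x ρ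

open Classical in
/-- The outward unit normal `ν = ∇ρ / |∇ρ|` at the boundary points of `Ω`
(it does not depend on the local defining function `ρ`). -/
def outwardNormal (Ω : Set (Euc 3)) (x : Euc 3) : Euc 3 :=
  if h : ∃ ρ, IsLocalDefiningFunction Ω x ρ then
    ‖gradient h.choose x‖⁻¹ • gradient h.choose x
  else 0

/-- The surface measure of `∂Ω`: the two-dimensional Hausdorff measure on `∂Ω`. -/
def surfaceMeasure (Ω : Set (Euc 3)) : Measure (Euc 3) :=
  (Measure.euclideanHausdorffMeasure 2).restrict (frontier Ω)

/-! ### Weak derivatives, Sobolev spaces, traces -/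

variable {K : ℕ}

/-- The `a`-th standard basis vector of `ℝ³`. -/
def basisVec (a : Fin 3) : Euc 3 := EuclideanSpace.single a (1 : ℝ)

/-- `g = ∂ₐ f` weakly in `Ω`. -/
def IsWeakPartial (Ω : Set (Euc 3)) (a : Fin 3) (f g : Euc 3 → Euc K) : Prop :=
  LocallyIntegrableOn f Ω ∧ LocallyIntegrableOn g Ω ∧
    ∀ φ : Euc 3 → ℝ, ContDiff ℝ ∞ φ → HasCompactSupport φ → tsupport φ ⊆ Ω →
      ∫ x in Ω, (fderiv ℝ φ x (basisVec a)) • f x = - ∫ x in Ω, φ x • g x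

open Classical in
/-- The weak partial derivative `∂ₐ f` in `Ω` (unique up to null sets; zero if there is none). -/
def weakPartial (Ω : Set (Euc 3)) (a : Fin 3) (f : Euc 3 → Euc K) : Euc 3 → Euc K :=
  if h : ∃ g, IsWeakPartial Ω a f g then h.choose else 0

/-- The weak Laplacian `Δ f = ∑ₐ ∂ₐ ∂ₐ f`. -/
def weakLaplacian (Ω : Set (Euc 3)) (f : Euc 3 → Euc K) (x : Euc 3) : Euc K :=
  ∑ a : Fin 3, weakPartial Ω a (weakPartial Ω a f) x

/-- `f ∈ W^{n,2}(Ω, ℝᴷ)`. -/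
def MemSobolev (Ω : Set (Euc 3)) : ℕ → (Euc 3 → Euc K) → Prop
  | 0, f => MemLp f 2 (volume.restrict Ω)
  | n + 1, f => MemLp f 2 (volume.restrict Ω) ∧
      ∀ a : Fin 3, ∃ g, IsWeakPartial Ω a f g ∧ MemSobolev Ω n g

/-- `u ∈ W^{n,2}(Ω, N)`. -/
def MemSobolevInto (Ω : Set (Euc 3)) (N : Set (Euc K)) (n : ℕ) (u : Euc 3 → Euc K) : Prop :=
  MemSobolev Ω n u ∧ ∀ᵐ x ∂(volume.restrict Ω), u x ∈ N

/-- `g ∈ L²(∂Ω)` is the boundary trace of `f ∈ W^{1,2}(Ω)`: there are functions, smooth up to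
the boundary, that converge to `f` in `W^{1,2}(Ω)` and whose restrictions to `∂Ω` converge to `g`
in `L²(∂Ω)`. -/
def HasTrace (Ω : Set (Euc 3)) (f g : Euc 3 → Euc K) : Prop :=
  MemSobolev Ω 1 f ∧ MemLp g 2 (surfaceMeasure Ω) ∧
    ∃ φ : ℕ → Euc 3 → Euc K, (∀ n, ContDiff ℝ ∞ (φ n)) ∧
      Tendsto (fun n => eLpNorm (φ n - f) 2 (volume.restrict Ω)) atTop (𝓝 0) ∧
      (∀ a : Fin 3, Tendsto (fun n => eLpNorm
        ((fun x => fderiv ℝ (φ n) x (basisVec a)) - weakPartial Ω a f) 2 (volume.restrict Ω))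
        atTop (𝓝 0)) ∧
      Tendsto (fun n => eLpNorm (φ n - g) 2 (surfaceMeasure Ω)) atTop (𝓝 0)

/-- For a gradient-like triple `G = (G₁, G₂, G₃)` on `Ω`, the normal component
`∑ₐ νₐ Gₐ|_{∂Ω}` (in the sense of traces) exists and vanishes almost everywhere on `∂Ω`. -/
def NormalComponentVanishes (Ω : Set (Euc 3)) (G : Fin 3 → Euc 3 → Euc K) : Prop :=
  ∃ g : Fin 3 → Euc 3 → Euc K, (∀ a, HasTrace Ω (G a) (g a)) ∧
    ∀ᵐ x ∂(surfaceMeasure Ω), ∑ a : Fin 3, outwardNormal Ω x a • g a x = 0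

/-! ### Embedded Kähler manifolds in `ℝᴷ` -/

/-- `N` is an embedded smooth submanifold of `ℝᴷ` of dimension `d`: around each of its points,
a smooth diffeomorphism between open sets of `ℝᴷ` straightens `N` to a `d`-dimensional linear
subspace. -/
def IsEmbeddedSubmanifold (N : Set (Euc K)) (d : ℕ) : Prop :=
  ∀ y ∈ N, ∃ (Φ : OpenPartialHomeomorph (Euc K) (Euc K)) (W : Submodule ℝ (Euc K)),
    y ∈ Φ.source ∧ ContDiffOn ℝ ∞ Φ Φ.source ∧ ContDiffOn ℝ ∞ Φ.symm Φ.target ∧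
      Module.finrank ℝ W = d ∧ ∀ z ∈ Φ.source, (z ∈ N ↔ Φ z ∈ W)

/-- The tangent space `T_y N ⊆ ℝᴷ` of a submanifold. -/
def tangentSpace (N : Set (Euc K)) (y : Euc K) : Submodule ℝ (Euc K) :=
  Submodule.span ℝ (tangentConeAt ℝ N y)

/-- The orthogonal projection `P(y) : ℝᴷ → T_y N ⊆ ℝᴷ`. -/
def tangentProj (N : Set (Euc K)) (y : Euc K) : Euc K →L[ℝ] Euc K :=
  (tangentSpace N y).starProjection

/-- The second fundamental form `A(y)(X, Y) = -(D_X P)(y) Y` for `X, Y ∈ T_y N`, extended to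
`ℝᴷ × ℝᴷ` by first projecting the arguments to `T_y N`. The sign is such that the Levi-Civita
connection of `N` is `∇_X Y = D_X Y + A(X, Y)`; for the unit sphere `A(y)(X, Y) = ⟨X, Y⟩ y`. -/
def secondFF (N : Set (Euc K)) (y : Euc K) : Euc K →L[ℝ] Euc K →L[ℝ] Euc K :=
  - (((ContinuousLinearMap.compL ℝ (Euc K) (Euc K) (Euc K)).flip (tangentProj N y)).comp
      ((fderivWithin ℝ (tangentProj N) N y).comp (tangentProj N y)))

theorem secondFF_apply (N : Set (Euc K)) (y X Y : Euc K) :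
    secondFF N y X Y
      = - (fderivWithin ℝ (tangentProj N) N y (tangentProj N y X)) (tangentProj N y Y) := rfl

/-- `J` is a Kähler structure on the submanifold `N` with the metric `h` induced by `ℝᴷ`: a smooth
field of orthogonal complex structures on the tangent spaces which is parallel for the
Levi-Civita connection, `∇ J = 0`. The endomorphism `J(y)` of `T_y N` is encoded as an
endomorphism of `ℝᴷ` that vanishes on the normal space. -/
structure IsKahlerStructure (N : Set (Euc K)) (J : Euc K → Euc K →L[ℝ] Euc K) : Prop where
  smooth : ContDiffOn ℝ ∞ J N
  map_tangent : ∀ y ∈ N, ∀ X, J y X ∈ tangentSpace N y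
  normal_eq_zero : ∀ y ∈ N, ∀ X, J y X = J y (tangentProj N y X)
  sq : ∀ y ∈ N, ∀ X ∈ tangentSpace N y, J y (J y X) = -X
  isometry : ∀ y ∈ N, ∀ X ∈ tangentSpace N y, ∀ Y ∈ tangentSpace N y,
    inner ℝ (J y X) (J y Y) = inner ℝ X Y
  parallel : ∀ y ∈ N, ∀ X ∈ tangentSpace N y, ∀ Y ∈ tangentSpace N y,
    tangentProj N y (fderivWithin ℝ J N y X Y) = 0

open Classical in
/-- A smooth map on `ℝᴷ` that agrees with the smooth map `S` on `N` near the point `y ∈ N`. It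
serves to differentiate `S` along curves that lie in `N` only up to a certain order at `t = 0`;
the result does not depend on the extension. -/
def extendAt {X : Type*} [NormedAddCommGroup X] [NormedSpace ℝ X]
    (N : Set (Euc K)) (S : Euc K → X) (y : Euc K) : Euc K → X :=
  if h : ∃ S' : Euc K → X, ContDiff ℝ ∞ S' ∧ ∀ᶠ z in 𝓝[N] y, S' z = S z then h.choose else S

/-! ### The initial time derivatives of the Schrödinger flow -/

/-- The time derivatives `V_j = ∂_t^j u|_{t=0}`, as determined by `u₀` through the equation
`∂_t u = J(u) τ(u)` with `τ(u) = Δ u + ∑ₐ A(u)(∂ₐ u, ∂ₐ u)`: `V_0 = u₀`, and `V_{j+1}` is the value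
at `t = 0` of `∂_t^j (J(u) τ(u))`, computed from the Taylor polynomials
`∑_{i ≤ j} (t^i / i!) V_i` of `u`, and likewise of `∂ₐ u` and `Δ u`. -/
def timeDeriv (Ω : Set (Euc 3)) (N : Set (Euc K)) (J : Euc K → Euc K →L[ℝ] Euc K)
    (u₀ : Euc 3 → Euc K) : ℕ → Euc 3 → Euc K
  | 0 => u₀
  | j + 1 => fun x =>
      let J' := extendAt N J (u₀ x)
      let A' := extendAt N (secondFF N) (u₀ x)
      let U : ℝ → Euc K := fun t =>
        ∑ i : Fin (j + 1), (t ^ (i : ℕ) / (Nat.factorial i : ℝ)) • timeDeriv Ω N J u₀ i x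
      let DU : Fin 3 → ℝ → Euc K := fun a t =>
        ∑ i : Fin (j + 1),
          (t ^ (i : ℕ) / (Nat.factorial i : ℝ)) • weakPartial Ω a (timeDeriv Ω N J u₀ i) x
      let LU : ℝ → Euc K := fun t =>
        ∑ i : Fin (j + 1),
          (t ^ (i : ℕ) / (Nat.factorial i : ℝ)) • weakLaplacian Ω (timeDeriv Ω N J u₀ i) x
      iteratedDeriv j
        (fun t => J' (U t) (LU t + ∑ a : Fin 3, A' (U t) (DU a t) (DU a t))) 0
  termination_by j => j
  decreasing_by all_goals exact i.isLt

/-- The initial values `v_j(0) = ∇_t^j u|_{t=0}` of the covariant time derivatives, where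
`v_0 = u`, `v_1 = ∂_t u` and `v_{l+1} = ∇_t v_l = P(u) ∂_t v_l`, computed from the Taylor polynomial
`∑_{i ≤ j} (t^i / i!) V_i` of `u`. -/
def covTimeDeriv (Ω : Set (Euc 3)) (N : Set (Euc K)) (J : Euc K → Euc K →L[ℝ] Euc K)
    (u₀ : Euc 3 → Euc K) (j : ℕ) (x : Euc 3) : Euc K :=
  let P' := extendAt N (tangentProj N) (u₀ x)
  let U : ℝ → Euc K := fun t =>
    ∑ i ∈ Finset.range (j + 1), (t ^ i / (Nat.factorial i : ℝ)) • timeDeriv Ω N J u₀ i x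
  ((fun (w : ℝ → Euc K) (t : ℝ) => P' (U t) (deriv w t))^[j] U) 0

/-- The pull-back connection of `N` along `u₀`: `∇ₐ v = P(u₀) ∂ₐ v`. For `v = u₀` it is the
differential `∂ₐ u₀`, which is tangent to `N`. -/
def covPartial (Ω : Set (Euc 3)) (N : Set (Euc K)) (u₀ : Euc 3 → Euc K) (a : Fin 3)
    (v : Euc 3 → Euc K) (x : Euc 3) : Euc K :=
  tangentProj N (u₀ x) (weakPartial Ω a v x)

/-- The compatibility condition of order `k`: `∂_ν V_j = 0` on `∂Ω` for `j ≤ k`. -/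
def CompatibilityCondition (Ω : Set (Euc 3)) (N : Set (Euc K))
    (J : Euc K → Euc K →L[ℝ] Euc K) (u₀ : Euc 3 → Euc K) (k : ℕ) : Prop :=
  ∀ j ≤ k, NormalComponentVanishes Ω fun a => weakPartial Ω a (timeDeriv Ω N J u₀ j)

/-- The intrinsic compatibility condition of order `k`: `∇_ν v_j(0) = 0` on `∂Ω` for `j ≤ k`. -/
def IntrinsicCompatibilityCondition (Ω : Set (Euc 3)) (N : Set (Euc K))
    (J : Euc K → Euc K →L[ℝ] Euc K) (u₀ : Euc 3 → Euc K) (k : ℕ) : Prop :=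
  ∀ j ≤ k, NormalComponentVanishes Ω fun a => covPartial Ω N u₀ a (covTimeDeriv Ω N J u₀ j)

end SchrodingerFlow

end

/-! Both conditions are compared order by order. The link is an identity v_j(0) = V_j - R_j(V_0,
..., V_{j-1}) with R_j smooth and independent of x (`exists_covTimeDeriv_eq`).

It is an identity between jets at t = 0. The Taylor curve c of u at x leaves N, but c - r(c) =
O(t^{j+1}) for a local smooth retraction r onto N (`flowJet_retraction`), because the speed J(u)τ(u)
is tangent. Hence every smooth expression that vanishes on N is O(t^{j+1}) along c, which makes the
chosen extensions of J, A and P irrelevant. Moreover c' = P(c)c' + O(t^j); differentiating this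
shows that the normal part of each higher derivative of c is a smooth function of lower derivatives,
so iterating P(c)∂_t gives c^{(j)} plus lower order terms.

Regularity: V_{j+1} is a smooth function of the (V_i, ∂V_i, ΔV_i), i ≤ j, and W^{m+2,2} is stable
under smooth maps in dimension three (`Sob.comp`). This rests on density of functions smooth up to
the boundary (`exists_smoothApprox`) and on the embeddings of W^{1,2} in L⁴ and of W^{1,4} in L^∞,
proved for such functions by integrating along cones contained in Ω.

Equivalence at order j, given ∂_ν V_i = 0 for i < j: the chain rule gives ∂_a v_j = ∂_a V_j - ∑_i
D_iR_j(V)(∂_a V_i), and the sum has vanishing normal component. Applying P(u_0) yields ∇_ν v_j = 0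
from ∂_ν V_j = 0. Conversely, for j ≥ 1 differentiating P(u_0)v_j = v_j gives ∂_a v_j = P(u_0)∂_a
v_j + DP(u_0)(∂_a u_0)v_j, whose last term has vanishing normal component by the condition of order
0. For j = 0 both conditions agree because ∂_a u_0 is tangent to N almost everywhere.

On the boundary, the coefficients P(u_0), DR_j(V), ... lie in W^{1,4}. Their approximations converge
uniformly up to ∂Ω, so they may multiply L² traces (`NormalComponentVanishes.mul`). The vanishing
condition itself supplies the traces of the first derivatives, so no general trace theorem for
W^{1,2} is needed. -/

open scoped Convolution

noncomputable section

namespace SchrodingerFlow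

/-! ### Curves and their jets at `0` -/

section Jets

universe u

variable {X Y Z W : Type u} [NormedAddCommGroup X] [NormedSpace ℝ X]
  [NormedAddCommGroup Y] [NormedSpace ℝ Y] [NormedAddCommGroup Z] [NormedSpace ℝ Z]
  [NormedAddCommGroup W] [NormedSpace ℝ W]

/-- The curve `f` vanishes to order `n` at `0`: `f = O(tⁿ)`. -/
def VanishesToOrder (n : ℕ) (f : ℝ → X) : Prop := ∀ i < n, iteratedDeriv i f 0 = 0

theorem vanishesToOrder_zero (f : ℝ → X) : VanishesToOrder 0 f := fun i hi => by omega

theorem vanishesToOrder_succ {n : ℕ} {f : ℝ → X} :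
    VanishesToOrder (n + 1) f ↔ f 0 = 0 ∧ VanishesToOrder n (deriv f) := by
  constructor
  · intro h
    refine ⟨by simpa using h 0 (by omega), fun i hi => ?_⟩
    have := h (i + 1) (by omega)
    rwa [iteratedDeriv_succ'] at this
  · rintro ⟨h0, h⟩ i hi
    rcases i with _ | i
    · simpa using h0
    · rw [iteratedDeriv_succ']
      exact h i (by omega)

theorem VanishesToOrder.mono {m n : ℕ} {f : ℝ → X} (h : VanishesToOrder n f) (hmn : m ≤ n) :
    VanishesToOrder m f := fun i hi => h i (by omega)

theorem VanishesToOrder.derivative {n : ℕ} {f : ℝ → X} (h : VanishesToOrder (n + 1) f) :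
    VanishesToOrder n (deriv f) := (vanishesToOrder_succ.1 h).2

theorem VanishesToOrder.congr {n : ℕ} {f g : ℝ → X} (h : VanishesToOrder n f)
    (hfg : f =ᶠ[𝓝 0] g) : VanishesToOrder n g := fun i hi => by
  rw [← hfg.iteratedDeriv_eq i]; exact h i hi

theorem vanishesToOrder_of_eventually {n : ℕ} {f : ℝ → X} (h : ∀ᶠ t in 𝓝 0, f t = 0) :
    VanishesToOrder n f := by
  have h0 : VanishesToOrder n (fun _ : ℝ => (0 : X)) := fun i _ => by
    simp
  exact h0.congr (h.mono fun t ht => ht.symm)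

theorem contDiff_deriv_curve {f : ℝ → X} (hf : ContDiff ℝ ∞ f) : ContDiff ℝ ∞ (deriv f) :=
  (contDiff_infty_iff_deriv.1 hf).2

theorem contDiff_iteratedDeriv_curve {f : ℝ → X} (hf : ContDiff ℝ ∞ f) (n : ℕ) :
    ContDiff ℝ ∞ (iteratedDeriv n f) := by
  induction n with
  | zero => simpa using hf
  | succ n ih => rw [iteratedDeriv_succ]; exact contDiff_deriv_curve ih

theorem VanishesToOrder.add {n : ℕ} {f g : ℝ → X} (hf : ContDiff ℝ ∞ f) (hg : ContDiff ℝ ∞ g)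
    (h : VanishesToOrder n f) (h' : VanishesToOrder n g) :
    VanishesToOrder n (fun t => f t + g t) := fun i hi => by
  have := iteratedDeriv_add (n := i) (x := (0 : ℝ)) (f := f) (g := g)
    ((hf.of_le (mod_cast le_top)).contDiffAt) ((hg.of_le (mod_cast le_top)).contDiffAt)
  change iteratedDeriv i (f + g) 0 = 0
  rw [this, h i hi, h' i hi, add_zero]

theorem iteratedDeriv_sub_curve {f g : ℝ → X} (hf : ContDiff ℝ ∞ f) (hg : ContDiff ℝ ∞ g)
    (i : ℕ) (t : ℝ) :
    iteratedDeriv i (fun t => f t - g t) t = iteratedDeriv i f t - iteratedDeriv i g t :=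
  iteratedDeriv_sub (n := i) (x := t) (f := f) (g := g)
    ((hf.of_le (mod_cast le_top)).contDiffAt) ((hg.of_le (mod_cast le_top)).contDiffAt)

theorem VanishesToOrder.sub {n : ℕ} {f g : ℝ → X} (hf : ContDiff ℝ ∞ f) (hg : ContDiff ℝ ∞ g)
    (h : VanishesToOrder n f) (h' : VanishesToOrder n g) :
    VanishesToOrder n (fun t => f t - g t) := fun i hi => by
  rw [iteratedDeriv_sub_curve hf hg, h i hi, h' i hi, sub_zero]

theorem VanishesToOrder.iteratedDeriv_eq {n : ℕ} {f g : ℝ → X} (hf : ContDiff ℝ ∞ f)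
    (hg : ContDiff ℝ ∞ g) (h : VanishesToOrder n (fun t => f t - g t)) {i : ℕ} (hi : i < n) :
    iteratedDeriv i f 0 = iteratedDeriv i g 0 := by
  have := h i hi
  rw [iteratedDeriv_sub_curve hf hg] at this
  exact sub_eq_zero.1 this

/-- Induction on n by the product rule: in B(f, g') the factor f still vanishes to order n, and in
B(f', g) the factor f' does. -/
theorem VanishesToOrder.bilinear_left (B : X →L[ℝ] Y →L[ℝ] Z) {n : ℕ} :
    ∀ {f : ℝ → X} {g : ℝ → Y}, ContDiff ℝ ∞ f → ContDiff ℝ ∞ g → VanishesToOrder n f →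
      VanishesToOrder n (fun t => B (f t) (g t)) := by
  induction n with
  | zero => intros; exact vanishesToOrder_zero _
  | succ n ih =>
    intro f g hf hg h
    rw [vanishesToOrder_succ]
    refine ⟨by simp [(vanishesToOrder_succ.1 h).1], ?_⟩
    have hd : deriv (fun t => B (f t) (g t)) = fun t => B (f t) (deriv g t) + B (deriv f t) (g t) := by
      funext t
      exact (B.hasDerivAt_of_bilinear
        (fun _ => ((hf.differentiable (by simp)).differentiableAt.hasDerivAt))
        (fun _ => ((hg.differentiable (by simp)).differentiableAt.hasDerivAt))).deriv
    rw [hd]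
    have hf' := contDiff_deriv_curve hf
    have hg' := contDiff_deriv_curve hg
    exact VanishesToOrder.add ((B.contDiff.comp hf).clm_apply hg')
      ((B.contDiff.comp hf').clm_apply hg) (ih hf hg' (h.mono (by omega))) (ih hf' hg h.derivative)

theorem VanishesToOrder.clm_apply_left {n : ℕ} {f : ℝ → X →L[ℝ] Y} {g : ℝ → X}
    (hf : ContDiff ℝ ∞ f) (hg : ContDiff ℝ ∞ g) (h : VanishesToOrder n f) :
    VanishesToOrder n (fun t => f t (g t)) :=
  VanishesToOrder.bilinear_left (ContinuousLinearMap.id ℝ (X →L[ℝ] Y)) hf hg h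

theorem VanishesToOrder.clm_apply_right {n : ℕ} {f : ℝ → X →L[ℝ] Y} {g : ℝ → X}
    (hf : ContDiff ℝ ∞ f) (hg : ContDiff ℝ ∞ g) (h : VanishesToOrder n g) :
    VanishesToOrder n (fun t => f t (g t)) :=
  VanishesToOrder.bilinear_left (ContinuousLinearMap.id ℝ (X →L[ℝ] Y)).flip hg hf h

theorem deriv_comp_curve {G : X → Y} {c : ℝ → X} (hG : ContDiff ℝ ∞ G) (hc : ContDiff ℝ ∞ c)
    (t : ℝ) : deriv (fun t => G (c t)) t = fderiv ℝ G (c t) (deriv c t) :=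
  (((hG.differentiable (by simp)).differentiableAt.hasFDerivAt).comp_hasDerivAt t
    (hc.differentiable (by simp)).differentiableAt.hasDerivAt).deriv

theorem contDiff_fderiv_infty {G : X → Y} (hG : ContDiff ℝ ∞ G) : ContDiff ℝ ∞ (fderiv ℝ G) :=
  hG.fderiv_right (by simp)

/-- The jet of G ∘ c depends only on the jet of c. The derivative of G(c) - G(c') splits into (DG(c)
- DG(c'))ċ and DG(c')(ċ - ċ'). The first part calls the induction hypothesis for DG, so the target
space is quantified inside the induction; a common universe keeps X →L[ℝ] Y admissible as a target.
-/
theorem VanishesToOrder.comp_sub {n : ℕ} :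
    ∀ {Y : Type u} [NormedAddCommGroup Y] [NormedSpace ℝ Y] {G : X → Y} {c c' : ℝ → X},
      ContDiff ℝ ∞ G → ContDiff ℝ ∞ c → ContDiff ℝ ∞ c' → VanishesToOrder n (fun t => c t - c' t) →
      VanishesToOrder n (fun t => G (c t) - G (c' t)) := by
  induction n with
  | zero => intros; exact vanishesToOrder_zero _
  | succ n ih =>
    intro Y _ _ G c c' hG hc hc' h
    rw [vanishesToOrder_succ]
    have h0 : c 0 = c' 0 := sub_eq_zero.1 (vanishesToOrder_succ.1 h).1
    refine ⟨by simp [h0], ?_⟩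
    have hdc := contDiff_deriv_curve hc
    have hdc' := contDiff_deriv_curve hc'
    have hG' := contDiff_fderiv_infty hG
    have hdiff : ∀ {f : ℝ → X}, ContDiff ℝ ∞ f → Differentiable ℝ f := fun hf =>
      hf.differentiable (by simp)
    have hd : deriv (fun t => G (c t) - G (c' t)) = fun t =>
        (fderiv ℝ G (c t) - fderiv ℝ G (c' t)) (deriv c t)
          + fderiv ℝ G (c' t) (deriv c t - deriv c' t) := by
      funext t
      have h1 : DifferentiableAt ℝ (fun t => G (c t)) t :=
        (hG.comp hc).differentiable (by simp) t
      have h2 : DifferentiableAt ℝ (fun t => G (c' t)) t :=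
        (hG.comp hc').differentiable (by simp) t
      rw [deriv_fun_sub h1 h2, deriv_comp_curve hG hc, deriv_comp_curve hG hc']
      simp
    rw [hd]
    have hs : (fun t => deriv c t - deriv c' t) = deriv (fun t => c t - c' t) := by
      funext t
      rw [deriv_fun_sub (hdiff hc t) (hdiff hc' t)]
    have hv : VanishesToOrder n (fun t => deriv c t - deriv c' t) := by
      rw [hs]; exact h.derivative
    have a1 : ContDiff ℝ ∞ (fun t => fderiv ℝ G (c t)) := hG'.comp hc
    have a2 : ContDiff ℝ ∞ (fun t => fderiv ℝ G (c' t)) := hG'.comp hc'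
    exact VanishesToOrder.add ((a1.sub a2).clm_apply hdc) (a2.clm_apply (hdc.sub hdc'))
      (VanishesToOrder.clm_apply_left (a1.sub a2) hdc (ih hG' hc hc' (h.mono (by omega))))
      (VanishesToOrder.clm_apply_right a2 (hdc.sub hdc') hv)

/-- The operator `T` on curves is a smooth function of the derivatives of order `< l`. -/
def IsJetFunction (l : ℕ) (T : (ℝ → Z) → ℝ → X) : Prop :=
  ∃ F : (Fin l → Z) → X, ContDiff ℝ ∞ F ∧
    ∀ c, ContDiff ℝ ∞ c → ∀ t, T c t = F (fun i => iteratedDeriv i c t)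

theorem contDiff_jet {l : ℕ} {c : ℝ → Z} (hc : ContDiff ℝ ∞ c) :
    ContDiff ℝ ∞ (fun t => fun i : Fin l => iteratedDeriv i c t) :=
  contDiff_pi.2 fun i => contDiff_iteratedDeriv_curve hc i

theorem IsJetFunction.contDiff {l : ℕ} {T : (ℝ → Z) → ℝ → X} (h : IsJetFunction l T) {c : ℝ → Z}
    (hc : ContDiff ℝ ∞ c) : ContDiff ℝ ∞ (T c) := by
  obtain ⟨F, hF, h⟩ := h
  rw [show T c = fun t => F (fun i => iteratedDeriv i c t) from funext (h c hc)]
  exact hF.comp (contDiff_jet hc)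

theorem IsJetFunction.mono {l m : ℕ} {T : (ℝ → Z) → ℝ → X} (h : IsJetFunction l T) (hlm : l ≤ m) :
    IsJetFunction m T := by
  obtain ⟨F, hF, h⟩ := h
  refine ⟨fun z => F (fun i => z (Fin.castLE hlm i)), hF.comp ?_, fun c hc t => h c hc t⟩
  fun_prop

theorem IsJetFunction.derivative {l : ℕ} {T : (ℝ → Z) → ℝ → X} (h : IsJetFunction l T) :
    IsJetFunction (l + 1) (fun c => deriv (T c)) := by
  obtain ⟨F, hF, h⟩ := h
  refine ⟨fun z => fderiv ℝ F (fun i => z i.castSucc) (fun i => z i.succ), ?_, fun c hc t => ?_⟩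
  · have : ContDiff ℝ ∞ (fun z : Fin (l + 1) → Z => fderiv ℝ F (fun i => z i.castSucc)) :=
      (contDiff_fderiv_infty hF).comp (by fun_prop)
    exact this.clm_apply (by fun_prop)
  · change deriv (T c) t = _
    rw [show T c = fun t => F (fun i => iteratedDeriv i c t) from funext (h c hc)]
    rw [deriv_comp_curve hF (contDiff_jet hc)]
    congr 1
    rw [deriv_pi]
    · funext i
      simp [iteratedDeriv_succ]
    · intro i
      exact (contDiff_iteratedDeriv_curve hc i).differentiable (by simp) t

theorem IsJetFunction.iterated_derivative {l : ℕ} {T : (ℝ → Z) → ℝ → X} (h : IsJetFunction l T) (j : ℕ) :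
    IsJetFunction (l + j) (fun c => iteratedDeriv j (T c)) := by
  induction j with
  | zero => simpa using h
  | succ j ih => rw [← add_assoc]; simpa only [iteratedDeriv_succ] using ih.derivative

theorem isJetFunction_iteratedDeriv (j : ℕ) :
    IsJetFunction (j + 1) (fun c : ℝ → Z => iteratedDeriv j c) :=
  ⟨fun z => z (Fin.last j), by fun_prop, fun c _ t => by simp⟩

theorem IsJetFunction.comp₂ {l : ℕ} {T : (ℝ → Z) → ℝ → X} {T' : (ℝ → Z) → ℝ → Y} {G : X × Y → W}
    (hG : ContDiff ℝ ∞ G) (h : IsJetFunction l T) (h' : IsJetFunction l T') :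
    IsJetFunction l (fun c t => G (T c t, T' c t)) := by
  obtain ⟨F, hF, h⟩ := h
  obtain ⟨F', hF', h'⟩ := h'
  exact ⟨fun z => G (F z, F' z), hG.comp (hF.prodMk hF'), fun c hc t => by simp only [h c hc, h' c hc]⟩

/-- The Taylor polynomial `∑_{i ≤ j} (tⁱ / i!) Vᵢ`. -/
def taylorCurve (j : ℕ) (V : ℕ → Z) (t : ℝ) : Z :=
  ∑ i ∈ Finset.range (j + 1), (t ^ i / (Nat.factorial i : ℝ)) • V i

theorem contDiff_taylorCurve (j : ℕ) (V : ℕ → Z) : ContDiff ℝ ∞ (taylorCurve j V) := by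
  unfold taylorCurve
  fun_prop

theorem deriv_taylorCurve_succ (j : ℕ) (V : ℕ → Z) :
    deriv (taylorCurve (j + 1) V) = taylorCurve j (fun i => V (i + 1)) := by
  funext t
  have hs : taylorCurve (j + 1) V = fun t =>
      (∑ i ∈ Finset.range (j + 1), (t ^ (i + 1) / (Nat.factorial (i + 1) : ℝ)) • V (i + 1)) + V 0 := by
    funext t
    simp [taylorCurve, Finset.sum_range_succ' _ (j + 1)]
  rw [hs]
  refine HasDerivAt.deriv ?_
  refine HasDerivAt.add_const _ (HasDerivAt.fun_sum fun i _ => ?_)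
  have h1 : HasDerivAt (fun t : ℝ => t ^ (i + 1) / (Nat.factorial (i + 1) : ℝ))
      (t ^ i / (Nat.factorial i : ℝ)) t := by
    have := (hasDerivAt_pow (i + 1) t).div_const (Nat.factorial (i + 1) : ℝ)
    refine this.congr_deriv ?_
    have : (Nat.factorial i : ℝ) ≠ 0 := by positivity
    rw [Nat.factorial_succ]
    push_cast
    field_simp
  exact h1.smul_const _

theorem iteratedDeriv_taylorCurve {i j : ℕ} (hij : i ≤ j) (V : ℕ → Z) :
    iteratedDeriv i (taylorCurve j V) 0 = V i := by
  induction i generalizing j V with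
  | zero => simp [taylorCurve, Finset.sum_range_succ' _ j]
  | succ i ih =>
    obtain ⟨j, rfl⟩ : ∃ j', j = j' + 1 := ⟨j - 1, by omega⟩
    rw [iteratedDeriv_succ', deriv_taylorCurve_succ, ih (by omega)]

theorem vanishesToOrder_taylorCurve_sub {i j n : ℕ} (hi : n ≤ i + 1) (hj : n ≤ j + 1) (V : ℕ → Z) :
    VanishesToOrder n (fun t => taylorCurve i V t - taylorCurve j V t) := fun m hm => by
  rw [iteratedDeriv_sub_curve (contDiff_taylorCurve _ _) (contDiff_taylorCurve _ _),
    iteratedDeriv_taylorCurve (by omega), iteratedDeriv_taylorCurve (by omega), sub_self]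

end Jets

/-! ### Smooth extensions, retractions and projections of an embedded submanifold -/

/-- Multiply by a bump function that is 1 near y and supported in a ball inside O. -/
theorem exists_contDiff_eventuallyEq {E X : Type*} [NormedAddCommGroup E] [InnerProductSpace ℝ E]
    [FiniteDimensional ℝ E] [NormedAddCommGroup X] [NormedSpace ℝ X] {f : E → X} {O : Set E}
    (hO : IsOpen O) (hf : ContDiffOn ℝ ∞ f O) {y : E} (hy : y ∈ O) :
    ∃ g : E → X, ContDiff ℝ ∞ g ∧ g =ᶠ[𝓝 y] f := by
  obtain ⟨ε, hε, hball⟩ := Metric.isOpen_iff.1 hO y hy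
  let χ : ContDiffBump y := ⟨ε / 4, ε / 2, by positivity, by linarith⟩
  refine ⟨fun z => χ z • f z, contDiff_iff_contDiffAt.2 fun z => ?_, ?_⟩
  · by_cases hz : z ∈ O
    · exact (χ.contDiff (n := (⊤ : ℕ∞))).contDiffAt.smul (hf.contDiffAt (hO.mem_nhds hz))
    · have hz' : z ∉ tsupport χ := fun h => hz (hball (by
        rw [χ.tsupport_eq] at h
        exact Metric.closedBall_subset_ball (by change ε / 2 < ε; linarith) h))
      have : (fun z => χ z • f z) =ᶠ[𝓝 z] fun _ => 0 := by
        filter_upwards [(notMem_tsupport_iff_eventuallyEq.1 hz')] with w hw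
        simp [hw]
      exact contDiffAt_const.congr_of_eventuallyEq this
  · filter_upwards [χ.eventuallyEq_one] with z hz
    simp [hz]

/-- Partition of unity: prescribing the value on N and nothing elsewhere is a convex condition. Off
the closed set N the zero function is a local solution. -/
theorem exists_contDiff_eqOn_of_local {E X : Type*} [NormedAddCommGroup E] [InnerProductSpace ℝ E]
    [FiniteDimensional ℝ E] [NormedAddCommGroup X] [NormedSpace ℝ X] {N : Set E}
    (hN : IsClosed N) {S : E → X}
    (hS : ∀ y ∈ N, ∃ S' : E → X, ContDiff ℝ ∞ S' ∧ ∀ᶠ z in 𝓝[N] y, S' z = S z) :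
    ∃ S' : E → X, ContDiff ℝ ∞ S' ∧ ∀ z ∈ N, S' z = S z := by
  obtain ⟨g, hg⟩ := exists_contMDiffMap_forall_mem_convex_of_local (n := (⊤ : ℕ∞)) (modelWithCornersSelf ℝ E)
    (t := fun z => {v : X | z ∈ N → v = S z}) (fun z => by
      by_cases hz : z ∈ N
      · simp [hz, convex_singleton]
      · simp [hz, convex_univ]) (fun z => by
      by_cases hz : z ∈ N
      · obtain ⟨S', h1, h2⟩ := hS z hz
        exact ⟨_, eventually_nhdsWithin_iff.1 h2, S', h1.contMDiff.contMDiffOn, fun y hy => hy⟩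
      · exact ⟨Nᶜ, hN.isOpen_compl.mem_nhds hz, fun _ => 0, contMDiffOn_const,
          fun y hy h => absurd h hy⟩)
  exact ⟨g, g.contMDiff.contDiff, fun z hz => hg z hz⟩

variable {K d : ℕ} {N : Set (Euc K)}

/-- `r` is a smooth retraction onto `N` near `y`. -/
def IsRetractionNear (N : Set (Euc K)) (y : Euc K) (r : Euc K → Euc K) : Prop :=
  ContDiff ℝ ∞ r ∧ ∀ᶠ z in 𝓝 y, r z ∈ N ∧ (z ∈ N → r z = z)

/-- In a straightening chart, project orthogonally to the linear subspace and map back. The set `O`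
is where the projected point is still in the range of the chart. -/
theorem IsEmbeddedSubmanifold.exists_retraction (hN : IsEmbeddedSubmanifold N d) {y : Euc K}
    (hy : y ∈ N) : ∃ r, IsRetractionNear N y r := by
  obtain ⟨Φ, W, hyΦ, hΦ, hΦ', -, hNW⟩ := hN y hy
  let π : Euc K →L[ℝ] Euc K := W.starProjection
  have hfix : ∀ v ∈ W, π v = v := fun v hv => W.starProjection_eq_self_iff.2 hv
  have hmem : ∀ v, π v ∈ W := fun v => W.starProjection_apply_mem v
  let O : Set (Euc K) := Φ.source ∩ Φ ⁻¹' (π ⁻¹' Φ.target)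
  have hO : IsOpen O :=
    Φ.continuousOn.isOpen_inter_preimage Φ.open_source (Φ.open_target.preimage π.continuous)
  have hyO : y ∈ O := by
    refine ⟨hyΦ, ?_⟩
    change π (Φ y) ∈ Φ.target
    rw [hfix _ ((hNW y hyΦ).1 hy)]
    exact Φ.map_source hyΦ
  have hr : ContDiffOn ℝ ∞ (fun z => Φ.symm (π (Φ z))) O := by
    refine hΦ'.comp (π.contDiff.comp_contDiffOn (hΦ.mono fun z hz => hz.1)) fun z hz => hz.2
  obtain ⟨r, hr, hrO⟩ := exists_contDiff_eventuallyEq hO hr hyO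
  refine ⟨r, hr, ?_⟩
  filter_upwards [hrO, hO.mem_nhds hyO] with z hz hzO
  rw [hz]
  constructor
  · rw [hNW _ (Φ.map_target hzO.2), Φ.right_inv hzO.2]
    exact hmem _
  · intro hzN
    rw [hfix _ ((hNW z hzO.1).1 hzN), Φ.left_inv hzO.1]

theorem IsRetractionNear.eventually {y : Euc K} {r : Euc K → Euc K} (h : IsRetractionNear N y r) :
    ∀ᶠ z in 𝓝 y, IsRetractionNear N z r :=
  (eventually_eventually_nhds.2 h.2).mono fun _ hz => ⟨h.1, hz⟩

/-- On N near y the map r is the identity, and two derivatives within N agree on the tangent cone,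
hence on its span. With `IsRetractionNear.fderiv_mem` this says that Dr(y) is a projection onto
T_yN, in general not an orthogonal one. -/
theorem IsRetractionNear.fderiv_apply {y : Euc K} {r : Euc K → Euc K}
    (h : IsRetractionNear N y r) (hy : y ∈ N) {X : Euc K} (hX : X ∈ tangentSpace N y) :
    fderiv ℝ r y X = X := by
  have h1 : HasFDerivWithinAt r (fderiv ℝ r y) N y :=
    ((h.1.differentiable (by simp)) y).hasFDerivAt.hasFDerivWithinAt
  have h2 : HasFDerivWithinAt r (ContinuousLinearMap.id ℝ (Euc K)) N y := by
    refine (hasFDerivWithinAt_id y N).congr_of_eventuallyEq ?_ (h.2.self_of_nhds.2 hy)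
    exact eventually_nhdsWithin_iff.2 (h.2.mono fun z hz hzN => hz.2 hzN)
  have h3 := h1.unique_on h2
  have : tangentSpace N y ≤ LinearMap.eqLocus (fderiv ℝ r y).toLinearMap LinearMap.id :=
    Submodule.span_le.2 fun v hv => h3 hv
  exact this hX

/-- The map r sends a whole neighbourhood of y into N, so Dr(y) maps every vector into the tangent
cone of N. -/
theorem IsRetractionNear.fderiv_mem {y : Euc K} {r : Euc K → Euc K}
    (h : IsRetractionNear N y r) (hy : y ∈ N) (X : Euc K) :
    fderiv ℝ r y X ∈ tangentSpace N y := by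
  obtain ⟨s, hs, hsN⟩ := h.2.exists_mem
  have h1 : HasFDerivWithinAt r (fderiv ℝ r y) s y :=
    ((h.1.differentiable (by simp)) y).hasFDerivAt.hasFDerivWithinAt
  have h2 := h1.mapsTo_tangent_cone (show X ∈ tangentConeAt ℝ s y by rw [tangentConeAt_of_mem_nhds hs]; trivial)
  rw [h.2.self_of_nhds.2 hy] at h2
  exact Submodule.subset_span (tangentConeAt_mono (by rintro z ⟨w, hw, rfl⟩; exact (hsN w hw).1) h2)

theorem tangentProj_apply_eq_self {y X : Euc K} (hX : X ∈ tangentSpace N y) :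
    tangentProj N y X = X := (tangentSpace N y).starProjection_eq_self_iff.2 hX

theorem tangentProj_mem (y X : Euc K) : tangentProj N y X ∈ tangentSpace N y :=
  (tangentSpace N y).starProjection_apply_mem X

/-- If Qv + Q*v = v, applying Q gives QQ*v = 0, hence Q*v = 0, and applying Q* gives Qv = 0 in the
same way. So the kernel is trivial, which suffices in finite dimension. -/
theorem isUnit_add_adjoint_sub_one {E : Type*} [NormedAddCommGroup E] [InnerProductSpace ℝ E]
    [FiniteDimensional ℝ E] {Q : E →L[ℝ] E} (hQ : Q * Q = Q) :
    IsUnit (Q + ContinuousLinearMap.adjoint Q - 1) := by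
  have hQ' : ContinuousLinearMap.adjoint Q * (ContinuousLinearMap.adjoint Q) = ContinuousLinearMap.adjoint Q := by
    have := congrArg ContinuousLinearMap.adjoint hQ
    rwa [ContinuousLinearMap.mul_def, ContinuousLinearMap.adjoint_comp] at this
  have hinj : Function.Injective ⇑(Q + ContinuousLinearMap.adjoint Q - 1) := by
    rw [injective_iff_map_eq_zero]
    intro v hv
    have hv' : Q v + ContinuousLinearMap.adjoint Q v = v := by
      simpa [sub_eq_zero] using hv
    have e1 : Q (Q v) = Q v := congrArg (fun T : E →L[ℝ] E => T v) hQ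
    have e2 : ContinuousLinearMap.adjoint Q (ContinuousLinearMap.adjoint Q v) = ContinuousLinearMap.adjoint Q v := congrArg (fun T : E →L[ℝ] E => T v) hQ'
    have a1 : Q (ContinuousLinearMap.adjoint Q v) = 0 := by
      have := congrArg Q hv'
      rwa [map_add, e1, add_eq_left] at this
    have a2 : ContinuousLinearMap.adjoint Q (Q v) = 0 := by
      have := congrArg (ContinuousLinearMap.adjoint Q) hv'
      rwa [map_add, e2, add_eq_right] at this
    have b1 : ContinuousLinearMap.adjoint Q v = 0 := by
      have : inner ℝ (ContinuousLinearMap.adjoint Q v) (ContinuousLinearMap.adjoint Q v) = 0 := by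
        rw [ContinuousLinearMap.adjoint_inner_left, a1, inner_zero_right]
      exact inner_self_eq_zero.1 this
    have b2 : Q v = 0 := by
      have : inner ℝ (Q v) (Q v) = 0 := by
        rw [← ContinuousLinearMap.adjoint_inner_right, a2, inner_zero_right]
      exact inner_self_eq_zero.1 this
    rw [← hv', b1, b2, add_zero]
  exact (ContinuousLinearMap.isUnit_iff_bijective).2
    ⟨hinj, LinearMap.surjective_of_injective (f := (Q + ContinuousLinearMap.adjoint Q - 1).toLinearMap) hinj⟩

/-- Let P be the orthogonal projection onto the range T of Q. Then PQ = Q, and the adjoint of QP = P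
is PQ* = P, so P(Q + Q* - 1) = Q. The formula makes P depend smoothly on Q. -/
theorem starProjection_eq_mul_inverse {E : Type*} [NormedAddCommGroup E] [InnerProductSpace ℝ E]
    [FiniteDimensional ℝ E] {Q : E →L[ℝ] E} {T : Submodule ℝ E} (hfix : ∀ v ∈ T, Q v = v)
    (hmem : ∀ v, Q v ∈ T) : T.starProjection = Q * Ring.inverse (Q + ContinuousLinearMap.adjoint Q - 1) := by
  have hQ : Q * Q = Q := by ext1 v; exact hfix _ (hmem v)
  have hPQ : T.starProjection * Q = Q := by
    ext1 v; exact T.starProjection_eq_self_iff.2 (hmem v)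
  have hQP : Q * T.starProjection = T.starProjection := by
    ext1 v; exact hfix _ (T.starProjection_apply_mem v)
  have hPQ' : T.starProjection * (ContinuousLinearMap.adjoint Q) = T.starProjection := by
    have h := congrArg ContinuousLinearMap.adjoint hQP
    have hP : ContinuousLinearMap.adjoint T.starProjection = T.starProjection :=
      ContinuousLinearMap.isSelfAdjoint_iff'.1 (isSelfAdjoint_starProjection T)
    rw [ContinuousLinearMap.mul_def, ContinuousLinearMap.adjoint_comp, hP] at h
    exact h
  have h : T.starProjection * (Q + ContinuousLinearMap.adjoint Q - 1) = Q := by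
    rw [mul_sub, mul_add, hPQ, hPQ', mul_one, add_sub_cancel_right]
  exact (Ring.eq_mul_inverse_iff_mul_eq _ _ _ (isUnit_add_adjoint_sub_one hQ)).2 h

/-- Take Q = Dr(z) in `starProjection_eq_mul_inverse`: the resulting expression is defined and
smooth on a full neighbourhood of y in ℝᴷ, not only on N. -/
theorem IsEmbeddedSubmanifold.exists_local_extension_tangentProj (hN : IsEmbeddedSubmanifold N d)
    {y : Euc K} (hy : y ∈ N) : ∃ S' : Euc K → Euc K →L[ℝ] Euc K, ContDiff ℝ ∞ S' ∧
      ∀ᶠ z in 𝓝[N] y, S' z = tangentProj N z := by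
  obtain ⟨r, hr⟩ := hN.exists_retraction hy
  have key : ∀ z ∈ N, IsRetractionNear N z r → tangentProj N z =
      fderiv ℝ r z * Ring.inverse (fderiv ℝ r z + ContinuousLinearMap.adjoint (fderiv ℝ r z) - 1) := fun z hz h =>
    starProjection_eq_mul_inverse (fun v hv => h.fderiv_apply hz hv) fun v => h.fderiv_mem hz v
  have hM : ContDiff ℝ ∞ (fun z => fderiv ℝ r z + ContinuousLinearMap.adjoint (fderiv ℝ r z) - 1) := by
    have h1 := contDiff_fderiv_infty hr.1
    have h2 : ContDiff ℝ ∞ (fun z => ContinuousLinearMap.adjoint (fderiv ℝ r z)) :=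
      (ContinuousLinearMap.adjoint (𝕜 := ℝ) (E := Euc K)
        (F := Euc K)).toContinuousLinearEquiv.contDiff.comp h1
    exact (h1.add h2).sub contDiff_const
  let O : Set (Euc K) := {z | IsUnit (fderiv ℝ r z + ContinuousLinearMap.adjoint (fderiv ℝ r z) - 1)}
  have hO : IsOpen O := Units.isOpen.preimage hM.continuous
  have hyO : y ∈ O := isUnit_add_adjoint_sub_one (by
    ext1 v
    exact hr.fderiv_apply hy (hr.fderiv_mem hy v))
  have hS : ContDiffOn ℝ ∞ (fun z => fderiv ℝ r z *
      Ring.inverse (fderiv ℝ r z + ContinuousLinearMap.adjoint (fderiv ℝ r z) - 1)) O := by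
    intro z hz
    obtain ⟨u, hu⟩ := (show IsUnit _ from hz)
    have h1 : ContDiffAt ℝ ∞ (fun z => Ring.inverse (fderiv ℝ r z + ContinuousLinearMap.adjoint (fderiv ℝ r z) - 1)) z :=
      ContDiffAt.comp z (g := Ring.inverse) (hu ▸ contDiffAt_ringInverse ℝ u) hM.contDiffAt
    exact ((contDiff_fderiv_infty hr.1).contDiffAt.mul h1).contDiffWithinAt
  obtain ⟨S', hS', hSO⟩ := exists_contDiff_eventuallyEq hO hS hyO
  refine ⟨S', hS', eventually_nhdsWithin_iff.2 ?_⟩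
  filter_upwards [hSO, hr.eventually] with z hz hrz hzN
  rw [hz, key z hzN hrz]

theorem IsEmbeddedSubmanifold.exists_extension_tangentProj (hN : IsEmbeddedSubmanifold N d)
    (hNc : IsClosed N) : ∃ S' : Euc K → Euc K →L[ℝ] Euc K, ContDiff ℝ ∞ S' ∧
      ∀ z ∈ N, S' z = tangentProj N z :=
  exists_contDiff_eqOn_of_local hNc fun _ hy => hN.exists_local_extension_tangentProj hy

/-- Locally S ∘ r is a smooth extension of S. -/
theorem IsEmbeddedSubmanifold.exists_extension_of_contDiffOn (hN : IsEmbeddedSubmanifold N d)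
    (hNc : IsClosed N) {X : Type*} [NormedAddCommGroup X] [NormedSpace ℝ X] {S : Euc K → X}
    (hS : ContDiffOn ℝ ∞ S N) : ∃ S' : Euc K → X, ContDiff ℝ ∞ S' ∧ ∀ z ∈ N, S' z = S z := by
  refine exists_contDiff_eqOn_of_local hNc fun y hy => ?_
  obtain ⟨r, hr⟩ := hN.exists_retraction hy
  obtain ⟨O, hON, hO, hyO⟩ := eventually_nhds_iff.1 hr.2
  obtain ⟨S', hS', hSO⟩ := exists_contDiff_eventuallyEq hO
    (hS.comp hr.1.contDiffOn fun z hz => (hON z hz).1) hyO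
  refine ⟨S', hS', eventually_nhdsWithin_iff.2 ?_⟩
  filter_upwards [hSO, hO.mem_nhds hyO] with z hz hzO hzN
  rw [hz, Function.comp_apply, (hON z hzO).2 hzN]

/-- The derivative within N is determined only along T_yN; there any smooth extension computes it.
`secondFF` evaluates it only on projected vectors. -/
theorem fderivWithin_apply_eq_of_eqOn {X : Type*} [NormedAddCommGroup X] [NormedSpace ℝ X]
    {S S' : Euc K → X} (hS' : ContDiff ℝ ∞ S') (h : ∀ z ∈ N, S' z = S z) {y : Euc K} (hy : y ∈ N)
    {v : Euc K} (hv : v ∈ tangentSpace N y) : fderivWithin ℝ S N y v = fderiv ℝ S' y v := by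
  have h1 : HasFDerivWithinAt S (fderiv ℝ S' y) N y :=
    ((hS'.differentiable (by simp)) y).hasFDerivAt.hasFDerivWithinAt.congr
      (fun z hz => (h z hz).symm) (h y hy).symm
  have h3 := h1.differentiableWithinAt.hasFDerivWithinAt.unique_on h1
  have : tangentSpace N y ≤ LinearMap.eqLocus (fderivWithin ℝ S N y).toLinearMap
      (fderiv ℝ S' y).toLinearMap := Submodule.span_le.2 fun v hv => h3 hv
  exact this hv

theorem IsEmbeddedSubmanifold.exists_extension_secondFF (hN : IsEmbeddedSubmanifold N d)
    (hNc : IsClosed N) : ∃ S' : Euc K → Euc K →L[ℝ] Euc K →L[ℝ] Euc K, ContDiff ℝ ∞ S' ∧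
      ∀ z ∈ N, S' z = secondFF N z := by
  obtain ⟨P, hP, hPN⟩ := hN.exists_extension_tangentProj hNc
  refine ⟨fun z => - (((ContinuousLinearMap.compL ℝ (Euc K) (Euc K) (Euc K)).flip (P z)).comp
      ((fderiv ℝ P z).comp (P z))), ?_, fun z hz => ?_⟩
  · have h1 : ContDiff ℝ ∞ (fun z => (ContinuousLinearMap.compL ℝ (Euc K) (Euc K) (Euc K)).flip (P z)) :=
      (ContinuousLinearMap.contDiff _).comp hP
    exact (h1.clm_comp ((contDiff_fderiv_infty hP).clm_comp hP)).neg
  · ext1 X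
    ext1 Y
    rw [secondFF_apply, fderivWithin_apply_eq_of_eqOn hP hPN hz (tangentProj_mem z X)]
    simp [hPN z hz]

/-- The extension picked by choice may vary wildly with y and is controlled only on N. Each later
use therefore compares it with the fixed global extension `S'` along curves that lie in N to
sufficiently high order. -/
theorem extendAt_spec {X : Type*} [NormedAddCommGroup X] [NormedSpace ℝ X] {S S' : Euc K → X}
    (hS' : ContDiff ℝ ∞ S') (h : ∀ z ∈ N, S' z = S z) (y : Euc K) :
    ContDiff ℝ ∞ (extendAt N S y) ∧ ∀ᶠ z in 𝓝 y, z ∈ N → extendAt N S y z = S' z := by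
  have hex : ∃ S' : Euc K → X, ContDiff ℝ ∞ S' ∧ ∀ᶠ z in 𝓝[N] y, S' z = S z :=
    ⟨S', hS', eventually_nhdsWithin_of_forall h⟩
  have heq : extendAt N S y = hex.choose := by
    unfold extendAt
    rw [dif_pos hex]
  rw [heq]
  refine ⟨hex.choose_spec.1, ?_⟩
  filter_upwards [eventually_nhdsWithin_iff.1 hex.choose_spec.2] with z hz hzN
  rw [hz hzN, h z hzN]

/-! ### Jets of the Schrödinger flow at a point -/

section

universe u

variable {X Y Z : Type u} [NormedAddCommGroup X] [NormedSpace ℝ X]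
  [NormedAddCommGroup Y] [NormedSpace ℝ Y] [NormedAddCommGroup Z] [NormedSpace ℝ Z]

theorem VanishesToOrder.clm_comp {n : ℕ} {f : ℝ → X} (L : X →L[ℝ] Y) (hf : ContDiff ℝ ∞ f)
    (h : VanishesToOrder n f) : VanishesToOrder n (fun t => L (f t)) :=
  VanishesToOrder.clm_apply_right (f := fun _ => L) contDiff_const hf h

theorem VanishesToOrder.iterated_derivative {n l : ℕ} {f : ℝ → X} (h : VanishesToOrder (n + l) f) :
    VanishesToOrder n (iteratedDeriv l f) := by
  induction l generalizing n with
  | zero => simpa using h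
  | succ l ih =>
    rw [iteratedDeriv_succ]
    exact (ih (n := n + 1) (by rwa [add_right_comm])).derivative

theorem clm_taylorCurve (L : X →L[ℝ] Y) (j : ℕ) (V : ℕ → X) (t : ℝ) :
    L (taylorCurve j V t) = taylorCurve j (fun i => L (V i)) t := by
  simp [taylorCurve, map_sum]

theorem taylorCurve_apply_zero (j : ℕ) (V : ℕ → X) : taylorCurve j V 0 = V 0 := by
  simpa using iteratedDeriv_taylorCurve (i := 0) (Nat.zero_le j) V

end

/-! ### Curves that lie in the target manifold up to a given order -/

section

variable {K d : ℕ} {N : Set (Euc K)}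

/-- Since r(c) lies in N, H(r(c), w) = 0 near t = 0, while H(c, w) - H(r(c), w) is as small as c -
r(c). The free argument w carries the values of ∂u and Δu. -/
theorem IsRetractionNear.vanishesToOrder {X Y : Type} [NormedAddCommGroup X] [NormedSpace ℝ X]
    [NormedAddCommGroup Y] [NormedSpace ℝ Y] {y : Euc K} {r : Euc K → Euc K}
    (hr : IsRetractionNear N y r) (hy : y ∈ N) {H : Euc K × Y → X} (hH : ContDiff ℝ ∞ H)
    (h0 : ∀ᶠ z in 𝓝 y, z ∈ N → ∀ w, H (z, w) = 0) {c : ℝ → Euc K} (hc : ContDiff ℝ ∞ c)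
    (hcy : c 0 = y) {w : ℝ → Y} (hw : ContDiff ℝ ∞ w) {n : ℕ}
    (hn : VanishesToOrder n (fun t => c t - r (c t))) :
    VanishesToOrder n (fun t => H (c t, w t)) := by
  have hrc : ContDiff ℝ ∞ (fun t => r (c t)) := hr.1.comp hc
  have h1 : VanishesToOrder n (fun t => H (c t, w t) - H (r (c t), w t)) := by
    refine VanishesToOrder.comp_sub (c := fun t => (c t, w t)) (c' := fun t => (r (c t), w t)) hH
      (hc.prodMk hw) (hrc.prodMk hw) ?_
    have := hn.clm_comp (ContinuousLinearMap.inl ℝ (Euc K) Y) (hc.sub hrc)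
    convert this using 2 with t
    simp
  have hry : r y = y := hr.2.self_of_nhds.2 hy
  have h2 : ∀ᶠ t in 𝓝 (0 : ℝ), H (r (c t), w t) = 0 := by
    have e1 : Tendsto c (𝓝 0) (𝓝 y) := hcy ▸ hc.continuous.continuousAt
    have e2 : Tendsto (fun t => r (c t)) (𝓝 0) (𝓝 y) := by
      have := hrc.continuous.continuousAt (x := 0)
      rwa [ContinuousAt, hcy, hry] at this
    filter_upwards [e1.eventually hr.2, e2.eventually h0] with t h1 h2
    exact h2 h1.1 _
  have h3 := VanishesToOrder.add (((hH.comp (hc.prodMk hw)).sub (hH.comp (hrc.prodMk hw))))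
    (hH.comp (hrc.prodMk hw)) h1 (vanishesToOrder_of_eventually h2)
  convert h3 using 2 with t
  simp

/-- The space of the values of `(u, ∂u, Δu)`. -/
abbrev FlowJet (K : ℕ) : Type := Euc K × (Fin 3 → Euc K) × Euc K

/-- The right-hand side `J(u) (Δ u + ∑ₐ A(u)(∂ₐ u, ∂ₐ u))` of the flow as a function of
`(u, ∂u, Δu)`. -/
def flowSpeed (J : Euc K → Euc K →L[ℝ] Euc K) (A : Euc K → Euc K →L[ℝ] Euc K →L[ℝ] Euc K)
    (z : FlowJet K) : Euc K :=
  J z.1 (z.2.2 + ∑ a : Fin 3, A z.1 (z.2.1 a) (z.2.1 a))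

theorem contDiff_flowSpeed {J : Euc K → Euc K →L[ℝ] Euc K}
    {A : Euc K → Euc K →L[ℝ] Euc K →L[ℝ] Euc K} (hJ : ContDiff ℝ ∞ J) (hA : ContDiff ℝ ∞ A) :
    ContDiff ℝ ∞ (flowSpeed J A) := by
  unfold flowSpeed
  have hJ' : ContDiff ℝ ∞ (fun z : FlowJet K => J z.1) := hJ.comp contDiff_fst
  have hA' : ContDiff ℝ ∞ (fun z : FlowJet K => A z.1) := hA.comp contDiff_fst
  have hD : ∀ a, ContDiff ℝ ∞ (fun z : FlowJet K => z.2.1 a) := fun a => by fun_prop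
  refine hJ'.clm_apply (ContDiff.add (by fun_prop) (ContDiff.sum fun a _ => ?_))
  exact (hA'.clm_apply (hD a)).clm_apply (hD a)

theorem contDiff_fst_taylorCurve (j : ℕ) (ζ : ℕ → FlowJet K) :
    (fun t => (taylorCurve j ζ t).1) = taylorCurve j (fun i => (ζ i).1) :=
  funext fun t => clm_taylorCurve (ContinuousLinearMap.fst ℝ (Euc K) _) j ζ t

/-- The Taylor polynomial of a flow with tangent speed stays in N up to its order. Its derivative is
the speed up to a small error, and the defect v - Dr(z)v of a tangent speed v at z ∈ N is zero, so
one order in j is gained from the previous Taylor polynomial. -/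
theorem IsRetractionNear.vanishesToOrder_taylorCurve {y : Euc K} {r : Euc K → Euc K}
    (hr : IsRetractionNear N y r) (hy : y ∈ N) {J : Euc K → Euc K →L[ℝ] Euc K}
    {A : Euc K → Euc K →L[ℝ] Euc K →L[ℝ] Euc K} (hJ : ContDiff ℝ ∞ J) (hA : ContDiff ℝ ∞ A)
    (hJN : ∀ᶠ z in 𝓝 y, z ∈ N → ∀ X, J z X ∈ tangentSpace N z) {ζ : ℕ → FlowJet K}
    (hζ0 : (ζ 0).1 = y)
    (hζ : ∀ j, (ζ (j + 1)).1 = iteratedDeriv j (fun t => flowSpeed J A (taylorCurve j ζ t)) 0)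
    (j : ℕ) : VanishesToOrder (j + 1) (fun t => taylorCurve j (fun i => (ζ i).1) t
      - r (taylorCurve j (fun i => (ζ i).1) t)) := by
  have hry : r y = y := hr.2.self_of_nhds.2 hy
  have hS := contDiff_flowSpeed hJ hA
  induction j with
  | zero =>
    rw [vanishesToOrder_succ]
    exact ⟨by simp [taylorCurve_apply_zero, hζ0, hry], vanishesToOrder_zero _⟩
  | succ j ih =>
    set V : ℕ → Euc K := fun i => (ζ i).1 with hV
    set c : ℝ → Euc K := taylorCurve (j + 1) V with hc_def
    have hc : ContDiff ℝ ∞ c := contDiff_taylorCurve _ _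
    have hc' := contDiff_deriv_curve hc
    have hcj : ContDiff ℝ ∞ (taylorCurve j V) := contDiff_taylorCurve _ _
    have hcurve : ContDiff ℝ ∞ (taylorCurve j ζ) := contDiff_taylorCurve _ _
    set x : ℝ → Euc K := fun t => flowSpeed J A (taylorCurve j ζ t) with hx_def
    have hx : ContDiff ℝ ∞ x := hS.comp hcurve
    -- The coefficient of index i + 1 was computed from the Taylor polynomial of degree i. Raising
    -- the degree to j changes only derivatives of order greater than i.
    have hcx : VanishesToOrder (j + 1) (fun t => deriv c t - x t) := by
      intro i hi
      rw [iteratedDeriv_sub_curve hc' hx, sub_eq_zero, hc_def, deriv_taylorCurve_succ,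
        iteratedDeriv_taylorCurve (by omega), hV]
      change (ζ (i + 1)).1 = _
      rw [hζ]
      exact (VanishesToOrder.comp_sub hS (contDiff_taylorCurve _ _) hcurve
        (vanishesToOrder_taylorCurve_sub (n := i + 1) le_rfl (by omega) ζ)).iteratedDeriv_eq
        (hS.comp (contDiff_taylorCurve _ _)) hx (by omega)
    have hr' := contDiff_fderiv_infty hr.1
    have hrc : ContDiff ℝ ∞ (fun t => r (c t)) := hr.1.comp hc
    have hdr : ContDiff ℝ ∞ (fun t => fderiv ℝ r (c t)) := hr'.comp hc
    have hdrj : ContDiff ℝ ∞ (fun t => fderiv ℝ r (taylorCurve j V t)) := hr'.comp hcj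
    rw [vanishesToOrder_succ]
    refine ⟨by simp [hc_def, taylorCurve_apply_zero, hζ0, hry, hV], ?_⟩
    -- Three errors: replacing the derivative of c by the speed x, replacing c by the Taylor
    -- polynomial of degree j inside Dr, and the normal defect of x itself, which the induction
    -- hypothesis controls.
    have hd : deriv (fun t => c t - r (c t)) = fun t =>
        (((deriv c t - x t) - fderiv ℝ r (c t) (deriv c t - x t))
          + (fderiv ℝ r (taylorCurve j V t) - fderiv ℝ r (c t)) (x t))
          + (x t - fderiv ℝ r (taylorCurve j V t) (x t)) := by
      funext t
      rw [deriv_fun_sub (hc.differentiable (by simp) t) (hrc.differentiable (by simp) t),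
        deriv_comp_curve hr.1 hc]
      simp only [map_sub, sub_apply]
      abel
    rw [hd]
    have hdcx := hc'.sub hx
    have v1 : VanishesToOrder (j + 1) (fun t => fderiv ℝ r (c t) (deriv c t - x t)) :=
      VanishesToOrder.clm_apply_right hdr hdcx hcx
    have v2 : VanishesToOrder (j + 1)
        (fun t => (fderiv ℝ r (taylorCurve j V t) - fderiv ℝ r (c t)) (x t)) :=
      VanishesToOrder.clm_apply_left (hdrj.sub hdr) hx (VanishesToOrder.comp_sub hr' hcj hc
        (vanishesToOrder_taylorCurve_sub (n := j + 1) le_rfl (by omega) V))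
    have v3 : VanishesToOrder (j + 1) (fun t => x t - fderiv ℝ r (taylorCurve j V t) (x t)) := by
      have hH : ContDiff ℝ ∞ (fun z : FlowJet K => flowSpeed J A z
          - fderiv ℝ r z.1 (flowSpeed J A z)) :=
        hS.sub ((hr'.comp contDiff_fst).clm_apply hS)
      have := hr.vanishesToOrder hy hH ?_ hcj (by rw [taylorCurve_apply_zero]; exact hζ0)
        (w := fun t => (taylorCurve j ζ t).2) (contDiff_snd.comp hcurve) ih
      · have e : ∀ t, taylorCurve j ζ t = (taylorCurve j V t, (taylorCurve j ζ t).2) := fun t =>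
          Prod.ext (congrFun (contDiff_fst_taylorCurve j ζ) t) rfl
        simpa only [hx_def, ← e] using this
      · filter_upwards [hJN, hr.eventually] with z hz hrz hzN w
        simp only [flowSpeed]
        rw [hrz.fderiv_apply hzN (hz hzN _), sub_self]
    exact VanishesToOrder.add (((hdcx.sub (hdr.clm_apply hdcx))).add ((hdrj.sub hdr).clm_apply hx))
      (hx.sub (hdrj.clm_apply hx)) (VanishesToOrder.add (hdcx.sub (hdr.clm_apply hdcx))
        ((hdrj.sub hdr).clm_apply hx) (VanishesToOrder.sub hdcx (hdr.clm_apply hdcx) hcx v1) v2) v3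

/-- The values at `x` of `(V_j, ∂V_j, ΔV_j)`. -/
def flowJet (Ω : Set (Euc 3)) (N : Set (Euc K)) (J : Euc K → Euc K →L[ℝ] Euc K)
    (u₀ : Euc 3 → Euc K) (x : Euc 3) (j : ℕ) : FlowJet K :=
  (timeDeriv Ω N J u₀ j x, fun a => weakPartial Ω a (timeDeriv Ω N J u₀ j) x,
    weakLaplacian Ω (timeDeriv Ω N J u₀ j) x)

theorem timeDeriv_zero (Ω : Set (Euc 3)) (N : Set (Euc K)) (J : Euc K → Euc K →L[ℝ] Euc K)
    (u₀ : Euc 3 → Euc K) : timeDeriv Ω N J u₀ 0 = u₀ := by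
  rw [timeDeriv]

theorem timeDeriv_succ (Ω : Set (Euc 3)) (N : Set (Euc K)) (J : Euc K → Euc K →L[ℝ] Euc K)
    (u₀ : Euc 3 → Euc K) (j : ℕ) (x : Euc 3) :
    timeDeriv Ω N J u₀ (j + 1) x = iteratedDeriv j (fun t =>
      flowSpeed (extendAt N J (u₀ x)) (extendAt N (secondFF N) (u₀ x))
        (taylorCurve j (flowJet Ω N J u₀ x) t)) 0 := by
  rw [timeDeriv]
  have e1 : ∀ t, (taylorCurve j (flowJet Ω N J u₀ x) t).1 =
      ∑ i : Fin (j + 1), (t ^ (i : ℕ) / (Nat.factorial i : ℝ)) • timeDeriv Ω N J u₀ i x := fun t => by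
    rw [Fin.sum_univ_eq_sum_range
      (fun i => (t ^ i / (Nat.factorial i : ℝ)) • timeDeriv Ω N J u₀ i x) (j + 1)]
    exact clm_taylorCurve (ContinuousLinearMap.fst ℝ (Euc K) ((Fin 3 → Euc K) × Euc K)) j
      (flowJet Ω N J u₀ x) t
  have e2 : ∀ t a, (taylorCurve j (flowJet Ω N J u₀ x) t).2.1 a =
      ∑ i : Fin (j + 1),
        (t ^ (i : ℕ) / (Nat.factorial i : ℝ)) • weakPartial Ω a (timeDeriv Ω N J u₀ i) x :=
      fun t a => by
    rw [Fin.sum_univ_eq_sum_range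
      (fun i => (t ^ i / (Nat.factorial i : ℝ)) • weakPartial Ω a (timeDeriv Ω N J u₀ i) x) (j + 1)]
    exact clm_taylorCurve ((ContinuousLinearMap.proj (R := ℝ) (φ := fun _ : Fin 3 => Euc K) a).comp
      ((ContinuousLinearMap.fst ℝ (Fin 3 → Euc K) (Euc K)).comp
        (ContinuousLinearMap.snd ℝ (Euc K) ((Fin 3 → Euc K) × Euc K)))) j (flowJet Ω N J u₀ x) t
  have e3 : ∀ t, (taylorCurve j (flowJet Ω N J u₀ x) t).2.2 =
      ∑ i : Fin (j + 1),
        (t ^ (i : ℕ) / (Nat.factorial i : ℝ)) • weakLaplacian Ω (timeDeriv Ω N J u₀ i) x :=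
      fun t => by
    rw [Fin.sum_univ_eq_sum_range
      (fun i => (t ^ i / (Nat.factorial i : ℝ)) • weakLaplacian Ω (timeDeriv Ω N J u₀ i) x) (j + 1)]
    exact clm_taylorCurve ((ContinuousLinearMap.snd ℝ (Fin 3 → Euc K) (Euc K)).comp
        (ContinuousLinearMap.snd ℝ (Euc K) ((Fin 3 → Euc K) × Euc K))) j (flowJet Ω N J u₀ x) t
  simp only [flowSpeed, e1, e2, e3]

end

/-! ### Time derivatives and covariant time derivatives as universal smooth functions -/

section

variable {K d : ℕ} {N : Set (Euc K)} {J : Euc K → Euc K →L[ℝ] Euc K}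

theorem flowJet_retraction (hN : IsEmbeddedSubmanifold N d) (hNc : IsClosed N)
    (hJ : IsKahlerStructure N J) (Ω : Set (Euc 3)) (u₀ : Euc 3 → Euc K) {x : Euc 3}
    (hx : u₀ x ∈ N) : ∃ r, IsRetractionNear N (u₀ x) r ∧ ∀ j, VanishesToOrder (j + 1) (fun t =>
      taylorCurve j (fun i => timeDeriv Ω N J u₀ i x) t
        - r (taylorCurve j (fun i => timeDeriv Ω N J u₀ i x) t)) := by
  obtain ⟨J', hJ', hJN⟩ := hN.exists_extension_of_contDiffOn hNc hJ.smooth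
  obtain ⟨A', hA', hAN⟩ := hN.exists_extension_secondFF hNc
  obtain ⟨r, hr⟩ := hN.exists_retraction hx
  obtain ⟨hJe, hJe'⟩ := extendAt_spec hJ' hJN (u₀ x)
  obtain ⟨hAe, hAe'⟩ := extendAt_spec hA' hAN (u₀ x)
  refine ⟨r, hr, fun j => ?_⟩
  refine hr.vanishesToOrder_taylorCurve hx hJe hAe ?_ (ζ := flowJet Ω N J u₀ x) ?_ ?_ j
  · filter_upwards [hJe'] with z hz hzN X
    rw [hz hzN, hJN z hzN]
    exact hJ.map_tangent z hzN X
  · simp [flowJet, timeDeriv_zero]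
  · intro j
    exact timeDeriv_succ Ω N J u₀ j x

/-- `V_{j+1}` is a smooth function, which does not depend on `x`, of the values of
`(V_i, ∂V_i, ΔV_i)`, `i ≤ j`. -/
theorem exists_timeDeriv_succ_eq (hN : IsEmbeddedSubmanifold N d) (hNc : IsClosed N)
    (hJ : IsKahlerStructure N J) (j : ℕ) : ∃ F : (Fin (j + 1) → FlowJet K) → Euc K,
      ContDiff ℝ ∞ F ∧ ∀ (Ω : Set (Euc 3)) (u₀ : Euc 3 → Euc K) (x : Euc 3), u₀ x ∈ N →
        timeDeriv Ω N J u₀ (j + 1) x = F (fun i => flowJet Ω N J u₀ x i) := by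
  obtain ⟨J', hJ', hJN⟩ := hN.exists_extension_of_contDiffOn hNc hJ.smooth
  obtain ⟨A', hA', hAN⟩ := hN.exists_extension_secondFF hNc
  have hS := contDiff_flowSpeed hJ' hA'
  have h1 : IsJetFunction 1 (fun (c : ℝ → FlowJet K) t => flowSpeed J' A' (c t)) :=
    ⟨fun z => flowSpeed J' A' (z 0), hS.comp (by fun_prop), fun c _ t => by simp⟩
  -- The function `F` is built from the global extensions `J'` and `A'`; this is why it does not
  -- depend on x.
  obtain ⟨F, hF, hFc⟩ : IsJetFunction (j + 1) _ := (h1.iterated_derivative j).mono (by omega)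
  refine ⟨F, hF, fun Ω u₀ x hx => ?_⟩
  obtain ⟨r, hr, hrV⟩ := flowJet_retraction hN hNc hJ Ω u₀ hx
  obtain ⟨hJe, hJe'⟩ := extendAt_spec hJ' hJN (u₀ x)
  obtain ⟨hAe, hAe'⟩ := extendAt_spec hA' hAN (u₀ x)
  have hSe := contDiff_flowSpeed hJe hAe
  have hcurve := contDiff_taylorCurve j (flowJet Ω N J u₀ x)
  have hfst := contDiff_fst_taylorCurve j (flowJet Ω N J u₀ x)
  -- The speeds formed with the extensions chosen at u₀(x) and with the global ones agree on N,
  -- hence to order j + 1 along the Taylor curve. This covers the j-th derivative.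
  have hv := hr.vanishesToOrder hx (hSe.sub hS) (by
      filter_upwards [hJe', hAe'] with z h1 h2 hzN w
      simp [flowSpeed, h1 hzN, h2 hzN])
    (contDiff_taylorCurve j (fun i => timeDeriv Ω N J u₀ i x))
    (by simp [taylorCurve_apply_zero, timeDeriv_zero]) (contDiff_snd.comp hcurve) (hrV j)
  have e : ∀ t, (taylorCurve j (fun i => timeDeriv Ω N J u₀ i x) t,
      (Prod.snd ∘ taylorCurve j (flowJet Ω N J u₀ x)) t) = taylorCurve j (flowJet Ω N J u₀ x) t :=
    fun t => Prod.ext (congrFun hfst t).symm rfl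
  simp only [e] at hv
  rw [timeDeriv_succ]
  refine (hv.iteratedDeriv_eq (hSe.comp hcurve) (hS.comp hcurve) (Nat.lt_succ_self j)).trans ?_
  refine (hFc _ hcurve 0).trans ?_
  congr 1
  funext i
  exact iteratedDeriv_taylorCurve (by omega) _

/-- Leibniz' rule: `∂_t^l (P(c) c') = P(c) c^{(l+1)}` up to derivatives of `c` of order at
most `l`. -/
theorem exists_iteratedDeriv_apply_deriv {X : Type} [NormedAddCommGroup X] [NormedSpace ℝ X]
    {P : X → X →L[ℝ] X} (hP : ContDiff ℝ ∞ P) (l : ℕ) :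
    ∃ T : (ℝ → X) → ℝ → X, IsJetFunction (l + 1) T ∧ ∀ c, ContDiff ℝ ∞ c →
      iteratedDeriv l (fun t => P (c t) (deriv c t)) =
        fun t => P (c t) (iteratedDeriv (l + 1) c t) + T c t := by
  induction l with
  | zero =>
    exact ⟨fun _ _ => 0, ⟨fun _ => 0, contDiff_const, fun _ _ _ => rfl⟩, fun c _ => by simp⟩
  | succ l ih =>
    obtain ⟨T, hT, h⟩ := ih
    have hid : IsJetFunction (l + 2) (fun (c : ℝ → X) => c) := by
      have := isJetFunction_iteratedDeriv (Z := X) 0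
      simp only [iteratedDeriv_zero] at this
      exact this.mono (by omega)
    have hP' := contDiff_fderiv_infty hP
    refine ⟨fun c t => fderiv ℝ P (c t) (deriv c t) (iteratedDeriv (l + 1) c t) + deriv (T c) t,
      ?_, fun c hc => ?_⟩
    · have a1 : IsJetFunction (l + 2) (fun (c : ℝ → X) => deriv c) := by
        have := isJetFunction_iteratedDeriv (Z := X) 1
        simp only [iteratedDeriv_one] at this
        exact this.mono (by omega)
      have a2 : IsJetFunction (l + 2) (fun (c : ℝ → X) => iteratedDeriv (l + 1) c) :=
        isJetFunction_iteratedDeriv (l + 1)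
      have a3 := IsJetFunction.comp₂ (G := fun z : X × X => fderiv ℝ P z.1 z.2)
        ((hP'.comp contDiff_fst).clm_apply contDiff_snd) hid a1
      have a4 := IsJetFunction.comp₂ (G := fun z : (X →L[ℝ] X) × X => z.1 z.2)
        (contDiff_fst.clm_apply contDiff_snd) a3 a2
      exact IsJetFunction.comp₂ (G := fun z : X × X => z.1 + z.2)
        (contDiff_fst.add contDiff_snd) a4 hT.derivative
    · rw [iteratedDeriv_succ, h c hc]
      funext t
      have b1 : HasDerivAt (fun t => P (c t)) (fderiv ℝ P (c t) (deriv c t)) t :=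
        ((hP.differentiable (by simp)).differentiableAt.hasFDerivAt).comp_hasDerivAt t
          (hc.differentiable (by simp)).differentiableAt.hasDerivAt
      have b2 : HasDerivAt (iteratedDeriv (l + 1) c) (iteratedDeriv (l + 2) c t) t := by
        have := ((contDiff_iteratedDeriv_curve hc (l + 1)).differentiable (by simp) t).hasDerivAt
        rwa [← iteratedDeriv_succ] at this
      have b3 : HasDerivAt (T c) (deriv (T c) t) t :=
        ((hT.contDiff hc).differentiable (by simp) t).hasDerivAt
      refine ((b1.clm_apply b2).add b3).deriv.trans ?_
      rw [add_assoc]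
      exact add_left_comm _ _ _

theorem contDiff_iterate_covDeriv {X : Type} [NormedAddCommGroup X] [NormedSpace ℝ X]
    {p : ℝ → X →L[ℝ] X} (hp : ContDiff ℝ ∞ p) {c : ℝ → X} (hc : ContDiff ℝ ∞ c) (l : ℕ) :
    ContDiff ℝ ∞ ((fun (w : ℝ → X) (t : ℝ) => p t (deriv w t))^[l] c) := by
  induction l with
  | zero => exact hc
  | succ l ih =>
    rw [Function.iterate_succ_apply']
    exact hp.clm_apply (contDiff_deriv_curve ih)

/-- With w = ∇_t^l c, the chain is p w' ≈ P(c)w' ≈ P(c)(c^{(l+1)} - S_l') ≈ c^{(l+1)} - T -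
P(c)S_l'. The last step is c' ≈ P(c)c' differentiated l times, with T the Leibniz remainder; so
S_{l+1} = T + P(c)S_l'. The parameter m counts spare orders of accuracy: every covariant derivative
consumes one. -/
theorem exists_iterate_covDeriv {X : Type} [NormedAddCommGroup X] [NormedSpace ℝ X]
    {P : X → X →L[ℝ] X} (hP : ContDiff ℝ ∞ P) (l : ℕ) :
    ∃ S : (ℝ → X) → ℝ → X, IsJetFunction l S ∧ ∀ (m : ℕ) (c : ℝ → X) (p : ℝ → X →L[ℝ] X),
      ContDiff ℝ ∞ c → ContDiff ℝ ∞ p →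
      VanishesToOrder (m + l) (fun t => deriv c t - P (c t) (deriv c t)) →
      VanishesToOrder (m + 1 + l) (fun t => p t - P (c t)) →
      VanishesToOrder (m + 1) (fun t => (fun (w : ℝ → X) (t : ℝ) => p t (deriv w t))^[l] c t
        - (iteratedDeriv l c t - S c t)) := by
  induction l with
  | zero =>
    refine ⟨fun _ _ => 0, ⟨fun _ => 0, contDiff_const, fun _ _ _ => rfl⟩, fun m c p _ _ _ _ => ?_⟩
    exact vanishesToOrder_of_eventually (Eventually.of_forall fun t => by simp)
  | succ l ih =>
    obtain ⟨S, hS, h⟩ := ih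
    obtain ⟨T, hT, hTc⟩ := exists_iteratedDeriv_apply_deriv hP l
    refine ⟨fun c t => T c t + P (c t) (deriv (S c) t), ?_, fun m c p hc hp h1 h2 => ?_⟩
    · have hid : IsJetFunction (l + 1) (fun (c : ℝ → X) => c) := by
        have := isJetFunction_iteratedDeriv (Z := X) 0
        simp only [iteratedDeriv_zero] at this
        exact this.mono (by omega)
      have a1 := IsJetFunction.comp₂ (G := fun z : X × X => P z.1 z.2)
        ((hP.comp contDiff_fst).clm_apply contDiff_snd) hid hS.derivative
      exact IsJetFunction.comp₂ (G := fun z : X × X => z.1 + z.2)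
        (contDiff_fst.add contDiff_snd) hT a1
    · have hw := contDiff_iterate_covDeriv hp hc l
      set w := (fun (w : ℝ → X) (t : ℝ) => p t (deriv w t))^[l] c with hw_def
      have hw' := contDiff_deriv_curve hw
      have hPc : ContDiff ℝ ∞ (fun t => P (c t)) := hP.comp hc
      have hSc := hS.contDiff hc
      have hTT := hT.contDiff hc
      have hSc' := contDiff_deriv_curve hSc
      have hcl := contDiff_iteratedDeriv_curve hc l
      have hcl1 := contDiff_iteratedDeriv_curve hc (l + 1)
      have hc' := contDiff_deriv_curve hc
      have hPc' : ContDiff ℝ ∞ (fun t => P (c t) (deriv c t)) := hPc.clm_apply hc'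
      -- One extra order is requested here because it is lost on differentiating.
      have ih1 := (h (m + 1) c p hc hp (by rwa [add_right_comm, add_assoc])
        (by rwa [add_right_comm _ 1 l, add_assoc])).derivative
      have e1 : deriv (fun t => w t - (iteratedDeriv l c t - S c t)) = fun t =>
          deriv w t - (iteratedDeriv (l + 1) c t - deriv (S c) t) := by
        funext t
        have d1 := hw.differentiable (by simp) t
        have d2 := hcl.differentiable (by simp) t
        have d3 := hSc.differentiable (by simp) t
        rw [deriv_fun_sub d1 (d2.fun_sub d3), deriv_fun_sub d2 d3, iteratedDeriv_succ]
      rw [e1] at ih1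
      have v1 : VanishesToOrder (m + 1) (fun t => P (c t) (deriv w t -
          (iteratedDeriv (l + 1) c t - deriv (S c) t))) :=
        VanishesToOrder.clm_apply_right hPc (hw'.sub (hcl1.sub hSc')) ih1
      have v2 : VanishesToOrder (m + 1) (fun t => (p t - P (c t)) (deriv w t)) :=
        (VanishesToOrder.clm_apply_left (hp.sub hPc) hw' h2).mono (by omega)
      have v3 : VanishesToOrder (m + 1) (fun t => iteratedDeriv (l + 1) c t -
          (P (c t) (iteratedDeriv (l + 1) c t) + T c t)) := by
        have := VanishesToOrder.iterated_derivative (n := m + 1) (l := l) (h1.mono (by omega))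
        refine this.congr (Eventually.of_forall fun t => ?_)
        rw [iteratedDeriv_sub_curve hc' hPc', hTc c hc, iteratedDeriv_succ']
      have e2 : (fun t => (fun (w : ℝ → X) (t : ℝ) => p t (deriv w t))^[l + 1] c t
          - (iteratedDeriv (l + 1) c t - (T c t + P (c t) (deriv (S c) t)))) = fun t =>
          (P (c t) (deriv w t - (iteratedDeriv (l + 1) c t - deriv (S c) t))
            + (p t - P (c t)) (deriv w t))
          - (iteratedDeriv (l + 1) c t - (P (c t) (iteratedDeriv (l + 1) c t) + T c t)) := by
        funext t
        rw [Function.iterate_succ_apply']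
        simp only [map_sub, sub_apply]
        abel
      rw [e2]
      have s1 := hPc.clm_apply (hw'.sub (hcl1.sub hSc'))
      have s2 := (hp.sub hPc).clm_apply hw'
      exact VanishesToOrder.sub (s1.add s2)
        (hcl1.sub ((hPc.clm_apply hcl1).add hTT)) (VanishesToOrder.add s1 s2 v1 v2) v3

/-- `v_j(0)` differs from `V_j` by a smooth function, which does not depend on `x`, of the `V_i`,
`i < j`. -/
theorem exists_covTimeDeriv_eq (hN : IsEmbeddedSubmanifold N d) (hNc : IsClosed N)
    (hJ : IsKahlerStructure N J) (j : ℕ) : ∃ R : (Fin j → Euc K) → Euc K, ContDiff ℝ ∞ R ∧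
      ∀ (Ω : Set (Euc 3)) (u₀ : Euc 3 → Euc K) (x : Euc 3), u₀ x ∈ N →
        covTimeDeriv Ω N J u₀ j x =
          timeDeriv Ω N J u₀ j x - R (fun i => timeDeriv Ω N J u₀ i x) := by
  obtain ⟨P, hP, hPN⟩ := hN.exists_extension_tangentProj hNc
  obtain ⟨S, ⟨R, hR, hRS⟩, hS⟩ := exists_iterate_covDeriv hP j
  refine ⟨R, hR, fun Ω u₀ x hx => ?_⟩
  obtain ⟨r, hr, hrV⟩ := flowJet_retraction hN hNc hJ Ω u₀ hx
  obtain ⟨hPe, hPe'⟩ := extendAt_spec hP hPN (u₀ x)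
  set c := taylorCurve j (fun i => timeDeriv Ω N J u₀ i x) with hc_def
  have hc : ContDiff ℝ ∞ c := contDiff_taylorCurve _ _
  have hc' := contDiff_deriv_curve hc
  have hcy : c 0 = u₀ x := by simp [hc_def, taylorCurve_apply_zero, timeDeriv_zero]
  have hPc : ContDiff ℝ ∞ (fun t => P (c t)) := hP.comp hc
  have hr' := contDiff_fderiv_infty hr.1
  have hrc : ContDiff ℝ ∞ (fun t => r (c t)) := hr.1.comp hc
  have hdr : ContDiff ℝ ∞ (fun t => fderiv ℝ r (c t)) := hr'.comp hc
  have h1 : VanishesToOrder (j + 1) (fun t => extendAt N (tangentProj N) (u₀ x) (c t) - P (c t)) :=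
    hr.vanishesToOrder hx (Y := Euc K)
      (H := fun z => extendAt N (tangentProj N) (u₀ x) z.1 - P z.1)
      ((hPe.comp contDiff_fst).sub (hP.comp contDiff_fst))
      (hPe'.mono fun z hz hzN w => by simp [hz hzN]) hc hcy hc (hrV j)
  -- Differentiating c - r(c) = O(t^{j+1}) gives c' = Dr(c)c' + O(t^j), and P fixes the range of Dr
  -- at points of N.
  have h2 : VanishesToOrder j (fun t => deriv c t - P (c t) (deriv c t)) := by
    have a1 : VanishesToOrder j (fun t => deriv c t - fderiv ℝ r (c t) (deriv c t)) := by
      have := (hrV j).derivative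
      have e : deriv (fun t => c t - r (c t)) =
          fun t => deriv c t - fderiv ℝ r (c t) (deriv c t) := by
        funext t
        rw [deriv_fun_sub (hc.differentiable (by simp) t) (hrc.differentiable (by simp) t),
          deriv_comp_curve hr.1 hc]
      rwa [e] at this
    have hs1 := hc'.sub (hdr.clm_apply hc')
    have a2 : VanishesToOrder j (fun t => P (c t) (deriv c t - fderiv ℝ r (c t) (deriv c t))) :=
      VanishesToOrder.clm_apply_right hPc hs1 a1
    have hr1 : ContDiff ℝ ∞ (fun z : Euc K × Euc K => fderiv ℝ r z.1 z.2) :=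
      (hr'.comp contDiff_fst).clm_apply contDiff_snd
    have hP1 : ContDiff ℝ ∞ (fun z : Euc K × Euc K => P z.1) := hP.comp contDiff_fst
    have a3 : VanishesToOrder j (fun t => fderiv ℝ r (c t) (deriv c t)
        - P (c t) (fderiv ℝ r (c t) (deriv c t))) := by
      refine (hr.vanishesToOrder hx (H := fun z : Euc K × Euc K => fderiv ℝ r z.1 z.2
        - P z.1 (fderiv ℝ r z.1 z.2)) (hr1.sub (hP1.clm_apply hr1)) ?_ hc hcy hc'
        (hrV j)).mono (by omega)
      filter_upwards [hr.eventually] with z hrz hzN w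
      rw [hPN z hzN, tangentProj_apply_eq_self (hrz.fderiv_mem hzN w), sub_self]
    have hs2 := (hdr.clm_apply hc').sub (hPc.clm_apply (hdr.clm_apply hc'))
    have := VanishesToOrder.add (hs1.sub (hPc.clm_apply hs1)) hs2
      (VanishesToOrder.sub hs1 (hPc.clm_apply hs1) a1 a2) a3
    refine this.congr (Eventually.of_forall fun t => ?_)
    simp only [map_sub]
    abel
  -- No spare order (m = 0): only the value at t = 0 is needed.
  have h3 := (vanishesToOrder_succ.1 (hS 0 c (fun t => extendAt N (tangentProj N) (u₀ x) (c t)) hc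
    (hPe.comp hc) (by simpa using h2) (by simpa [add_comm] using h1))).1
  rw [sub_eq_zero, hRS c hc] at h3
  have e4 : covTimeDeriv Ω N J u₀ j x = (fun (w : ℝ → Euc K) (t : ℝ) =>
      extendAt N (tangentProj N) (u₀ x) (c t) (deriv w t))^[j] c 0 := rfl
  rw [e4, h3, hc_def, iteratedDeriv_taylorCurve le_rfl]
  congr 2
  funext i
  exact iteratedDeriv_taylorCurve (by omega) _

/-- The outermost operation is the projection at t = 0, where the base point is u₀(x) ∈ N and the
extension is exact. The index starts at 1, since v_0 = u is a point of N rather than a tangent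
vector. -/
theorem tangentProj_covTimeDeriv (hN : IsEmbeddedSubmanifold N d) (hNc : IsClosed N)
    (Ω : Set (Euc 3)) {u₀ : Euc 3 → Euc K} {x : Euc 3} (hx : u₀ x ∈ N) (j : ℕ) :
    tangentProj N (u₀ x) (covTimeDeriv Ω N J u₀ (j + 1) x) = covTimeDeriv Ω N J u₀ (j + 1) x := by
  obtain ⟨P, hP, hPN⟩ := hN.exists_extension_tangentProj hNc
  obtain ⟨hPe, hPe'⟩ := extendAt_spec hP hPN (u₀ x)
  have e : covTimeDeriv Ω N J u₀ (j + 1) x = (fun (w : ℝ → Euc K) (t : ℝ) =>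
      extendAt N (tangentProj N) (u₀ x)
        (taylorCurve (j + 1) (fun i => timeDeriv Ω N J u₀ i x) t) (deriv w t))^[j + 1]
      (taylorCurve (j + 1) (fun i => timeDeriv Ω N J u₀ i x)) 0 := rfl
  rw [e, Function.iterate_succ_apply']
  apply tangentProj_apply_eq_self
  rw [taylorCurve_apply_zero, timeDeriv_zero, hPe'.self_of_nhds hx, hPN _ hx]
  exact tangentProj_mem _ _

end

/-! ### The uniform cone condition -/

/-- The truncated cone with vertex `z` over the ball `B(w, s)` is contained in `Ω`. -/
def ConeAt (Ω : Set (Euc 3)) (z w : Euc 3) (s : ℝ) : Prop :=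
  ∀ e ∈ Metric.ball w s, ∀ t : ℝ, 0 < t → t ≤ 1 → z + t • e ∈ Ω

theorem coneAt_of_ball_subset {Ω : Set (Euc 3)} {x : Euc 3} {δ : ℝ}
    (h : Metric.ball x (2 * δ) ⊆ Ω) {z : Euc 3} (hz : z ∈ Metric.ball x δ) : ConeAt Ω z 0 δ := by
  intro e he t ht0 ht1
  apply h
  rw [mem_ball_zero_iff] at he
  rw [mem_ball_iff_norm] at hz ⊢
  have h1 : ‖t • e‖ ≤ ‖e‖ := by
    rw [norm_smul, Real.norm_of_nonneg ht0.le]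
    exact mul_le_of_le_one_left (norm_nonneg _) ht1
  calc ‖z + t • e - x‖ = ‖(z - x) + t • e‖ := by congr 1; abel
    _ ≤ ‖z - x‖ + ‖t • e‖ := norm_add_le _ _
    _ < 2 * δ := by linarith

/-- Pick v with dρ_x(v) < 0. By continuity ρ decreases along all directions near v from all points
near x, so by the mean value theorem it stays negative along a short segment that starts in Ω. -/
theorem IsLocalDefiningFunction.exists_coneAt {Ω : Set (Euc 3)} {x : Euc 3} {ρ : Euc 3 → ℝ}
    (h : IsLocalDefiningFunction Ω x ρ) :
    ∃ w : Euc 3, ∃ s > 0, ∃ δ > 0, ∀ z ∈ Metric.ball x δ, z ∈ Ω → ConeAt Ω z w s := by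
  obtain ⟨hρ, hgrad, hΩ⟩ := h
  have hf : fderiv ℝ ρ x ≠ 0 := fun h0 => hgrad (by simp [gradient, h0])
  obtain ⟨v, hv⟩ : ∃ v, fderiv ℝ ρ x v < 0 := by
    obtain ⟨v, hv⟩ : ∃ v, fderiv ℝ ρ x v ≠ 0 := by
      by_contra! hc
      exact hf (ContinuousLinearMap.ext hc)
    rcases lt_or_gt_of_ne hv with h1 | h1
    · exact ⟨v, h1⟩
    · exact ⟨-v, by simpa using h1⟩
  have hcont : Continuous (fun p : Euc 3 × Euc 3 => fderiv ℝ ρ p.1 p.2) :=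
    ((contDiff_fderiv_infty hρ).continuous.comp continuous_fst).clm_apply continuous_snd
  obtain ⟨δ₁, hδ₁, h1⟩ := Metric.isOpen_iff.1 (isOpen_lt hcont continuous_const) (x, v) hv
  obtain ⟨δ₂, hδ₂, h2⟩ := Metric.eventually_nhds_iff_ball.1 hΩ
  obtain ⟨δ, hδ, hδ₁', hδ₂'⟩ : ∃ δ > 0, δ ≤ δ₁ ∧ δ ≤ δ₂ :=
    ⟨min δ₁ δ₂, lt_min hδ₁ hδ₂, min_le_left _ _, min_le_right _ _⟩
  have hpos : 0 < ‖v‖ + δ := by positivity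
  -- This scale gives every vector of the base of the cone length at most δ/2, so segments starting
  -- in the ball of radius δ/2 do not leave the ball of radius δ.
  set l : ℝ := δ / (2 * (‖v‖ + δ)) with hl
  have hl0 : 0 < l := by positivity
  have hlv : l * (‖v‖ + δ) = δ / 2 := by rw [hl]; field_simp
  refine ⟨l • v, l * δ, by positivity, δ / 2, by positivity, fun z hz hzΩ e he t ht0 ht1 => ?_⟩
  set e' : Euc 3 := l⁻¹ • e with he'
  have hee : e = l • e' := by rw [he', smul_inv_smul₀ hl0.ne']
  have he'v : e' ∈ Metric.ball v δ := by
    rw [mem_ball_iff_norm] at he ⊢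
    rw [hee, ← smul_sub, norm_smul, Real.norm_of_nonneg hl0.le] at he
    exact lt_of_mul_lt_mul_left he hl0.le
  have hen : ‖e‖ ≤ δ / 2 := by
    rw [hee, norm_smul, Real.norm_of_nonneg hl0.le, ← hlv]
    refine mul_le_mul_of_nonneg_left ?_ hl0.le
    rw [mem_ball_iff_norm] at he'v
    calc ‖e'‖ = ‖v + (e' - v)‖ := by congr 1; abel
      _ ≤ ‖v‖ + ‖e' - v‖ := norm_add_le _ _
      _ ≤ ‖v‖ + δ := by linarith
  have hseg : ∀ τ : ℝ, 0 ≤ τ → τ ≤ 1 → z + τ • e ∈ Metric.ball x δ := by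
    intro τ h0 h1
    rw [mem_ball_iff_norm] at hz ⊢
    have : ‖τ • e‖ ≤ ‖e‖ := by
      rw [norm_smul, Real.norm_of_nonneg h0]
      exact mul_le_of_le_one_left (norm_nonneg _) h1
    calc ‖z + τ • e - x‖ = ‖(z - x) + τ • e‖ := by congr 1; abel
      _ ≤ ‖z - x‖ + ‖τ • e‖ := norm_add_le _ _
      _ < δ := by linarith
  have hder : ∀ τ : ℝ, HasDerivAt (fun τ : ℝ => ρ (z + τ • e)) (fderiv ℝ ρ (z + τ • e) e) τ := by
    intro τ
    have a1 : HasDerivAt (fun τ : ℝ => z + τ • e) e τ := by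
      simpa using ((hasDerivAt_id τ).smul_const e).const_add z
    exact ((hρ.differentiable (by simp)) _).hasFDerivAt.comp_hasDerivAt τ a1
  obtain ⟨c, hc, hce⟩ := exists_hasDerivAt_eq_slope (fun τ : ℝ => ρ (z + τ • e)) _ ht0
    (fun τ _ => (hder τ).continuousAt.continuousWithinAt) (fun τ _ => hder τ)
  have hneg : fderiv ℝ ρ (z + c • e) e < 0 := by
    have h3 : fderiv ℝ ρ (z + c • e) e' < 0 := by
      suffices h4 : (z + c • e, e') ∈ Metric.ball (x, v) δ₁ from h1 h4
      rw [← ball_prod_same]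
      exact ⟨Metric.ball_subset_ball hδ₁' (hseg c hc.1.le (hc.2.le.trans ht1)),
        Metric.ball_subset_ball hδ₁' he'v⟩
    have : fderiv ℝ ρ (z + c • e) e = l * fderiv ℝ ρ (z + c • e) e' := by
      have h4 : fderiv ℝ ρ (z + c • e) (l • e') = l * fderiv ℝ ρ (z + c • e) e' := by
        rw [map_smul, smul_eq_mul]
      rwa [← hee] at h4
    rw [this]
    exact mul_neg_of_pos_of_neg hl0 h3
  rw [hce, sub_zero, div_lt_iff₀ ht0, zero_mul, zero_smul, add_zero] at hneg
  have hzρ : ρ z < 0 := (h2 z (Metric.ball_subset_ball (by linarith) hz)).1 hzΩ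
  exact (h2 _ (Metric.ball_subset_ball hδ₂' (hseg t ht0.le ht1))).2 (by linarith)

theorem IsBoundedSmoothDomain.exists_coneAt {Ω : Set (Euc 3)} (hΩ : IsBoundedSmoothDomain Ω)
    {x : Euc 3} (hx : x ∈ closure Ω) :
    ∃ w : Euc 3, ∃ s > 0, ∃ δ > 0, ∀ z ∈ Metric.ball x δ, z ∈ Ω → ConeAt Ω z w s := by
  by_cases hxΩ : x ∈ Ω
  · obtain ⟨ε, hε, hball⟩ := Metric.isOpen_iff.1 hΩ.isOpen x hxΩ
    refine ⟨0, ε / 2, by positivity, ε / 2, by positivity, fun z hz _ => ?_⟩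
    exact coneAt_of_ball_subset (x := x) (by rwa [mul_div_cancel₀ _ two_ne_zero]) hz
  · have : x ∈ frontier Ω := by
      rw [hΩ.isOpen.frontier_eq]
      exact ⟨hx, hxΩ⟩
    obtain ⟨ρ, hρ⟩ := hΩ.smooth_boundary x this
    exact hρ.exists_coneAt

/-- A smooth partition of unity on a neighbourhood of `Ω`, together with a cone for each of its
members. -/
structure ConePartition (Ω : Set (Euc 3)) (ι : Type) [Fintype ι] where
  /-- the partition functions -/
  χ : ι → Euc 3 → ℝ
  /-- the axes of the cones -/
  w : ι → Euc 3
  /-- the radii of the bases of the cones -/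
  s : ι → ℝ
  contDiff : ∀ i, ContDiff ℝ ∞ (χ i)
  s_pos : ∀ i, 0 < s i
  sum_eq_one : ∀ x ∈ Ω, ∑ i, χ i x = 1
  cone : ∀ i, ∀ z ∈ Ω, z ∈ tsupport (χ i) → ConeAt Ω z (w i) (s i)

theorem IsBoundedSmoothDomain.exists_conePartition {Ω : Set (Euc 3)}
    (hΩ : IsBoundedSmoothDomain Ω) :
    ∃ (ι : Type) (_ : Fintype ι), Nonempty (ConePartition Ω ι) := by
  have hcomp : IsCompact (closure Ω) := hΩ.isBounded.isCompact_closure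
  choose! w s hs δ hδ hcone using fun x (hx : x ∈ closure Ω) => hΩ.exists_coneAt hx
  obtain ⟨t, ht, hcover⟩ := hcomp.elim_nhds_subcover (fun x => Metric.ball x (δ x))
    fun x hx => Metric.ball_mem_nhds x (hδ x hx)
  obtain ⟨f, hf⟩ := SmoothPartitionOfUnity.exists_isSubordinate (modelWithCornersSelf ℝ (Euc 3))
    (isClosed_closure (s := Ω)) (fun i : t => Metric.ball (i : Euc 3) (δ i))
    (fun _ => Metric.isOpen_ball) (by
      intro x hx
      obtain ⟨i, hi, hxi⟩ := Set.mem_iUnion₂.1 (hcover hx)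
      exact Set.mem_iUnion.2 ⟨⟨i, hi⟩, hxi⟩)
  refine ⟨t, inferInstance, ⟨⟨fun i => f i, fun i => w i, fun i => s i,
    fun i => (f i).contMDiff.contDiff, fun i => hs _ (ht _ i.2), fun x hx => ?_,
    fun i z hz hzi => hcone i (ht _ i.2) z (hf i hzi) hz⟩⟩⟩
  rw [← finsum_eq_sum_of_fintype]
  exact f.sum_eq_one (subset_closure hx)

/-! ### Mollification in `Lᵖ` -/

section

variable {X : Type} [NormedAddCommGroup X] [NormedSpace ℝ X]

/-- The convolution `k ⋆ h` of a scalar kernel and a vector-valued function. -/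
def mollify (k : Euc 3 → ℝ) (h : Euc 3 → X) : Euc 3 → X :=
  k ⋆[ContinuousLinearMap.lsmul ℝ ℝ, volume] h

/-- As k dx is a probability measure, the p-th power of the average is at most the average of the
p-th powers; then Tonelli and translation invariance apply. -/
theorem eLpNorm_mollify_le {k : Euc 3 → ℝ} (hk : Continuous k) (hk0 : ∀ x, 0 ≤ k x)
    (hk1 : ∫ x, k x = 1) {p : ENNReal} (hp1 : 1 ≤ p) (hp : p ≠ ⊤) {h : Euc 3 → X}
    (hh : AEStronglyMeasurable h) : eLpNorm (mollify k h) p ≤ eLpNorm h p := by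
  wlog hm : StronglyMeasurable h generalizing h
  · have e : mollify k h = mollify k (hh.mk h) :=
      convolution_congr _ (ae_eq_refl k) hh.ae_eq_mk
    rw [e, eLpNorm_congr_ae hh.ae_eq_mk]
    exact this hh.stronglyMeasurable_mk.aestronglyMeasurable hh.stronglyMeasurable_mk
  have hp0 : p ≠ 0 := (zero_lt_one.trans_le hp1).ne'
  set ν : Measure (Euc 3) := volume.withDensity (fun x => ‖k x‖ₑ) with hν
  have hkm : Measurable (fun x => ‖k x‖ₑ) := hk.enorm.measurable
  have hν1 : IsProbabilityMeasure ν := by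
    constructor
    rw [hν, withDensity_apply _ MeasurableSet.univ, Measure.restrict_univ]
    have := integral_norm_eq_lintegral_enorm hk.aestronglyMeasurable (μ := volume)
    have e : (fun x => ‖k x‖) = k := funext fun x => Real.norm_of_nonneg (hk0 x)
    rw [e, hk1] at this
    have h1 := (ENNReal.toReal_eq_one_iff _).1 this.symm
    exact h1
  have hpt : ∀ z, ‖mollify k h z‖ₑ ^ p.toReal ≤ ∫⁻ y, ‖h (z - y)‖ₑ ^ p.toReal ∂ν := by
    intro z
    have hmz : StronglyMeasurable (fun y => h (z - y)) :=
      hm.comp_measurable (measurable_const.sub measurable_id)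
    have h1 : ‖mollify k h z‖ₑ ≤ eLpNorm (fun y => h (z - y)) 1 ν := by
      rw [eLpNorm_one_eq_lintegral_enorm, hν,
        lintegral_withDensity_eq_lintegral_mul _ hkm hmz.enorm]
      refine (enorm_integral_le_lintegral_enorm _).trans (lintegral_mono fun y => ?_)
      simp [enorm_smul]
    have h2 := h1.trans (eLpNorm_le_eLpNorm_of_exponent_le hp1 hmz.aestronglyMeasurable)
    rw [eLpNorm_eq_lintegral_rpow_enorm_toReal hp0 hp] at h2
    calc ‖mollify k h z‖ₑ ^ p.toReal
        ≤ ((∫⁻ y, ‖h (z - y)‖ₑ ^ p.toReal ∂ν) ^ (1 / p.toReal)) ^ p.toReal :=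
          ENNReal.rpow_le_rpow h2 ENNReal.toReal_nonneg
      _ = _ := by
          rw [← ENNReal.rpow_mul, one_div, inv_mul_cancel₀ (ENNReal.toReal_pos hp0 hp).ne',
            ENNReal.rpow_one]
  rw [eLpNorm_eq_lintegral_rpow_enorm_toReal hp0 hp, eLpNorm_eq_lintegral_rpow_enorm_toReal hp0 hp]
  refine ENNReal.rpow_le_rpow ?_ (by positivity)
  calc ∫⁻ z, ‖mollify k h z‖ₑ ^ p.toReal
      ≤ ∫⁻ z, ∫⁻ y, ‖h (z - y)‖ₑ ^ p.toReal ∂ν := lintegral_mono hpt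
    _ = ∫⁻ y, (∫⁻ z, ‖h (z - y)‖ₑ ^ p.toReal) ∂ν := by
        refine lintegral_lintegral_swap ?_
        exact ((hm.comp_measurable (measurable_fst.sub measurable_snd)).enorm.pow_const _).aemeasurable
    _ = ∫⁻ y, (∫⁻ z, ‖h z‖ₑ ^ p.toReal) ∂ν := by
        congr 1
        funext y
        exact lintegral_sub_right_eq_self (fun z => ‖h z‖ₑ ^ p.toReal) y
    _ = ∫⁻ z, ‖h z‖ₑ ^ p.toReal := by simp

/-- Uniform continuity gives uniform convergence, and all differences eventually live on the
1-thickening of the support, a set of finite measure. -/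
theorem tendsto_eLpNorm_mollify_sub_of_continuous [CompleteSpace X] {k : ℕ → Euc 3 → ℝ}
    {r : ℕ → ℝ} (hk0 : ∀ n x, 0 ≤ k n x)
    (hk1 : ∀ n, ∫ x, k n x = 1) (hkr : ∀ n, Function.support (k n) ⊆ Metric.ball 0 (r n))
    (hr : Tendsto r atTop (𝓝 0)) {p : ENNReal}
    {g : Euc 3 → X} (hg : Continuous g) (hgc : HasCompactSupport g) :
    Tendsto (fun n => eLpNorm (mollify (k n) g - g) p) atTop (𝓝 0) := by
  set S := Metric.cthickening 1 (tsupport g) with hS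
  have hScomp : IsCompact S := hgc.isCompact.cthickening
  have hSfin : volume S ≠ ⊤ := hScomp.measure_lt_top.ne
  have huc : UniformContinuous g := hgc.uniformContinuous_of_continuous hg
  have hsupp : ∀ n, r n < 1 → Function.support (mollify (k n) g - g) ⊆ S := by
    intro n hn z hz
    by_contra hzS
    apply hz
    have h0 : ∀ y ∈ Metric.ball z 1, g y = 0 := by
      intro y hy
      by_contra hgy
      refine hzS (Metric.mem_cthickening_of_dist_le z y 1 _ (subset_tsupport g hgy) ?_)
      rw [dist_comm]
      exact (Metric.mem_ball.1 hy).le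
    have hz0 : g z = 0 := h0 z (Metric.mem_ball_self one_pos)
    have : mollify (k n) g z = 0 := by
      refine integral_eq_zero_of_ae (Eventually.of_forall fun y => ?_)
      by_cases hy : k n y = 0
      · simp [hy]
      · have h1 := hkr n hy
        rw [mem_ball_zero_iff] at h1
        have : g (z - y) = 0 := h0 _ (by rw [mem_ball_iff_norm]; simpa using h1.trans hn)
        simp [this]
    simp [this, hz0]
  rw [ENNReal.tendsto_nhds_zero]
  intro ε hε
  have hlim : Tendsto (fun δ : ℝ => (volume S) ^ (p.toReal⁻¹) * ENNReal.ofReal δ) (𝓝 0) (𝓝 0) := by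
    have h1 := (ENNReal.continuous_ofReal.tendsto 0)
    rw [ENNReal.ofReal_zero] at h1
    have := ENNReal.Tendsto.const_mul h1 (a := (volume S) ^ (p.toReal⁻¹)) (Or.inr
      (ENNReal.rpow_ne_top_of_nonneg (by positivity) hSfin))
    simpa using this
  obtain ⟨δ, hδ, hδε⟩ : ∃ δ > 0, (volume S) ^ (p.toReal⁻¹) * ENNReal.ofReal δ ≤ ε := by
    have := (hlim.mono_left (nhdsWithin_le_nhds (s := Set.Ioi 0))).eventually_le_const hε
    obtain ⟨δ, h1, h2⟩ := (this.and self_mem_nhdsWithin).exists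
    exact ⟨δ, h2, h1⟩
  obtain ⟨η, hη, hgη⟩ := Metric.uniformContinuous_iff.1 huc δ hδ
  filter_upwards [hr.eventually_lt_const one_pos, hr.eventually_lt_const hη] with n hn1 hn2
  refine le_trans ?_ hδε
  rw [← eLpNorm_restrict_eq_of_support_subset (hsupp n hn1)]
  refine (eLpNorm_le_of_ae_bound (C := δ) (Eventually.of_forall fun z => ?_)).trans ?_
  · rw [Pi.sub_apply, ← dist_eq_norm]
    refine dist_convolution_le hδ.le (hkr n) (hk0 n) (hk1 n) hg.aestronglyMeasurable ?_
    intro y hy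
    exact (hgη ((Metric.mem_ball.1 hy).trans hn2)).le
  · simp

theorem mollify_add {k : Euc 3 → ℝ} (hk : Continuous k) (hkc : HasCompactSupport k)
    {f g : Euc 3 → X} (hf : LocallyIntegrable f) (hg : LocallyIntegrable g) :
    mollify k (f + g) = mollify k f + mollify k g :=
  ConvolutionExists.distrib_add (hkc.convolutionExists_left _ hk hf)
    (hkc.convolutionExists_left _ hk hg)

theorem continuous_mollify {k : Euc 3 → ℝ} (hk : Continuous k) (hkc : HasCompactSupport k)
    {f : Euc 3 → X} (hf : LocallyIntegrable f) : Continuous (mollify k f) :=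
  hkc.continuous_convolution_left _ hk hf

theorem tendsto_eLpNorm_mollify_sub [CompleteSpace X] {k : ℕ → Euc 3 → ℝ}
    {r : ℕ → ℝ} (hkc : ∀ n, Continuous (k n)) (hks : ∀ n, HasCompactSupport (k n))
    (hk0 : ∀ n x, 0 ≤ k n x)
    (hk1 : ∀ n, ∫ x, k n x = 1) (hkr : ∀ n, Function.support (k n) ⊆ Metric.ball 0 (r n))
    (hr : Tendsto r atTop (𝓝 0)) {p : ENNReal} (hp1 : 1 ≤ p) (hp : p ≠ ⊤)
    {h : Euc 3 → X} (hh : MemLp h p) :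
    Tendsto (fun n => eLpNorm (mollify (k n) h - h) p) atTop (𝓝 0) := by
  rw [ENNReal.tendsto_nhds_zero]
  intro ε hε
  have hε3 : ε / 3 ≠ 0 := by simp [hε.ne']
  obtain ⟨g, hgc, hgε, hg, hgp⟩ := hh.exists_hasCompactSupport_eLpNorm_sub_le hp hε3
  have hlim := tendsto_eLpNorm_mollify_sub_of_continuous (p := p) hk0 hk1 hkr hr hg hgc
  filter_upwards [ENNReal.tendsto_nhds_zero.1 hlim (ε / 3) (pos_iff_ne_zero.2 hε3)] with n hn
  have hdiff : MemLp (h - g) p := hh.sub hgp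
  have hgl : LocallyIntegrable g := hgp.locallyIntegrable hp1
  have hdl : LocallyIntegrable (h - g) := hdiff.locallyIntegrable hp1
  have e : mollify (k n) h = mollify (k n) g + mollify (k n) (h - g) := by
    rw [← mollify_add (hkc n) (hks n) hgl hdl, add_sub_cancel]
  have m1 : AEStronglyMeasurable (mollify (k n) g) :=
    (continuous_mollify (hkc n) (hks n) hgl).aestronglyMeasurable
  have m2 : AEStronglyMeasurable (mollify (k n) (h - g)) :=
    (continuous_mollify (hkc n) (hks n) hdl).aestronglyMeasurable
  have e2 : mollify (k n) h - h = (mollify (k n) g - g) + (mollify (k n) (h - g) - (h - g)) := by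
    rw [e]
    funext z
    simp only [Pi.add_apply, Pi.sub_apply]
    abel
  have h1 := eLpNorm_mollify_le (hkc n) (hk0 n) (hk1 n)
    hp1 hp hdiff.1
  have b1 : eLpNorm ((mollify (k n) g - g) + (mollify (k n) (h - g) - (h - g))) p ≤
      eLpNorm (mollify (k n) g - g) p + eLpNorm (mollify (k n) (h - g) - (h - g)) p :=
    eLpNorm_add_le (m1.sub hgp.1) (m2.sub hdiff.1) hp1
  have b2 : eLpNorm (mollify (k n) (h - g) - (h - g)) p ≤ ε / 3 + ε / 3 :=
    (eLpNorm_sub_le m2 hdiff.1 hp1).trans (add_le_add (h1.trans hgε) hgε)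
  rw [← e2] at b1
  refine b1.trans ((add_le_add hn b2).trans ?_)
  rw [← add_assoc, ENNReal.add_thirds]

end

/-! ### Density of smooth functions -/

section

variable {X : Type} [NormedAddCommGroup X] [NormedSpace ℝ X]

/-- `g = ∂ₐ f` weakly in `Ω`, for functions with values in a normed space. -/
def HasWeakPartial (Ω : Set (Euc 3)) (a : Fin 3) (f g : Euc 3 → X) : Prop :=
  LocallyIntegrableOn f Ω ∧ LocallyIntegrableOn g Ω ∧
    ∀ φ : Euc 3 → ℝ, ContDiff ℝ ∞ φ → HasCompactSupport φ → tsupport φ ⊆ Ω →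
      ∫ x in Ω, (fderiv ℝ φ x (basisVec a)) • f x = - ∫ x in Ω, φ x • g x

theorem isWeakPartial_iff {K : ℕ} {Ω : Set (Euc 3)} {a : Fin 3} {f g : Euc 3 → Euc K} :
    IsWeakPartial Ω a f g ↔ HasWeakPartial Ω a f g := Iff.rfl

theorem contDiff_mollify {k : Euc 3 → ℝ} (hk : ContDiff ℝ ∞ k) (hkc : HasCompactSupport k)
    {h : Euc 3 → X} (hh : LocallyIntegrable h) : ContDiff ℝ ∞ (mollify k h) :=
  hkc.contDiff_convolution_left (n := (⊤ : ℕ∞)) _ hk hh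

theorem fderiv_mollify_apply [CompleteSpace X] {k : Euc 3 → ℝ} (hk : ContDiff ℝ ∞ k)
    (hkc : HasCompactSupport k)
    {h : Euc 3 → X} (hh : LocallyIntegrable h) (z v : Euc 3) :
    fderiv ℝ (mollify k h) z v = ∫ y, fderiv ℝ k (z - y) v • h y := by
  have h1 := hkc.hasFDerivAt_convolution_left (ContinuousLinearMap.lsmul ℝ ℝ)
    (hk.of_le (by simp)) hh (μ := volume) z
  have h2 : fderiv ℝ (mollify k h) z = _ := h1.fderiv
  have hex : ConvolutionExistsAt (fderiv ℝ k) h z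
      (ContinuousLinearMap.precompL (Euc 3) (ContinuousLinearMap.lsmul ℝ ℝ)) volume :=
    (hkc.fderiv ℝ).convolutionExists_left _ (contDiff_fderiv_infty hk).continuous hh z
  rw [h2, convolution_def, ContinuousLinearMap.integral_apply hex.integrable]
  have e := integral_sub_left_eq_self (fun y => fderiv ℝ k y v • h (z - y)) volume z
  simp only [sub_sub_cancel] at e
  rw [e]
  rfl

/-- When z - supp k ⊆ Ω, the function y ↦ k(z - y) is an admissible test function, and the
definition of the weak derivative is the claim. The jump of the zero extension across ∂Ω is not
seen. -/
theorem fderiv_mollify_indicator [CompleteSpace X] {Ω : Set (Euc 3)} (hΩ : MeasurableSet Ω)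
    {k : Euc 3 → ℝ} (hk : ContDiff ℝ ∞ k) (hkc : HasCompactSupport k) {a : Fin 3}
    {f g : Euc 3 → X} (hfg : HasWeakPartial Ω a f g)
    (hf : LocallyIntegrable (Ω.indicator f)) {z : Euc 3} (hz : ∀ v ∈ tsupport k, z - v ∈ Ω) :
    fderiv ℝ (mollify k (Ω.indicator f)) z (basisVec a) = mollify k (Ω.indicator g) z := by
  rw [fderiv_mollify_apply hk hkc hf]
  have hφ : ContDiff ℝ ∞ (fun y => k (z - y)) := hk.comp (contDiff_const.sub contDiff_id)
  have hφc : HasCompactSupport (fun y => k (z - y)) :=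
    hkc.comp_homeomorph (Homeomorph.subLeft z)
  have hφs : tsupport (fun y => k (z - y)) ⊆ Ω := by
    have hcl : IsClosed {y | z - y ∈ tsupport k} :=
      (isClosed_tsupport k).preimage (continuous_const.sub continuous_id)
    have h1 : tsupport (fun y => k (z - y)) ⊆ {y | z - y ∈ tsupport k} :=
      closure_minimal (fun y hy => subset_tsupport k hy) hcl
    intro y hy
    simpa using hz _ (h1 hy)
  have hd : ∀ y, fderiv ℝ (fun y => k (z - y)) y (basisVec a) = - fderiv ℝ k (z - y) (basisVec a) := by
    intro y
    have h1 : HasFDerivAt (fun y => k (z - y))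
        ((fderiv ℝ k (z - y)).comp (-(ContinuousLinearMap.id ℝ (Euc 3)))) y :=
      ((hk.differentiable (by simp)) _).hasFDerivAt.comp y
        ((hasFDerivAt_id y).const_sub z)
    rw [h1.fderiv]
    simp
  have key := hfg.2.2 _ hφ hφc hφs
  simp only [hd, neg_smul, integral_neg, neg_inj] at key
  have e1 : ∀ (c : Euc 3 → ℝ) (u : Euc 3 → X), (∫ y, c y • Ω.indicator u y) = ∫ y in Ω, c y • u y := by
    intro c u
    rw [← integral_indicator hΩ]
    congr 1
    funext y
    by_cases hy : y ∈ Ω <;> simp [hy]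
  rw [e1, key, ← e1]
  have e2 := integral_sub_left_eq_self (fun y => k y • Ω.indicator g (z - y)) volume z
  simp only [sub_sub_cancel] at e2
  rw [e2]
  rfl

/-- The `φ n` are smooth on `ℝ³`, and converge to `f` in `Lᵖ(Ω)` together with their derivatives,
whose limits are the `G a`. -/
structure SmoothApprox (Ω : Set (Euc 3)) (p : ENNReal) (f : Euc 3 → X) (G : Fin 3 → Euc 3 → X)
    (φ : ℕ → Euc 3 → X) : Prop where
  memLp : MemLp f p (volume.restrict Ω)
  memLp_partial : ∀ a, MemLp (G a) p (volume.restrict Ω)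
  contDiff : ∀ n, ContDiff ℝ ∞ (φ n)
  tendsto : Tendsto (fun n => eLpNorm (φ n - f) p (volume.restrict Ω)) atTop (𝓝 0)
  tendsto_partial : ∀ a, Tendsto (fun n => eLpNorm
    ((fun x => fderiv ℝ (φ n) x (basisVec a)) - G a) p (volume.restrict Ω)) atTop (𝓝 0)

theorem tendsto_eLpNorm_sum {α ι X : Type*} [MeasurableSpace α] {μ : Measure α} [Fintype ι]
    [NormedAddCommGroup X] {p : ENNReal} (hp1 : 1 ≤ p) {u : ι → ℕ → α → X}
    (hm : ∀ i n, AEStronglyMeasurable (u i n) μ)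
    (hu : ∀ i, Tendsto (fun n => eLpNorm (u i n) p μ) atTop (𝓝 0)) :
    Tendsto (fun n => eLpNorm (fun x => ∑ i, u i n x) p μ) atTop (𝓝 0) := by
  have h1 : Tendsto (fun n => ∑ i, eLpNorm (u i n) p μ) atTop (𝓝 0) := by
    have := tendsto_finsetSum (Finset.univ : Finset ι) fun i _ => hu i
    simpa using this
  refine tendsto_of_tendsto_of_tendsto_of_le_of_le tendsto_const_nhds h1
    (fun n => zero_le) fun n => ?_
  have e : (fun x => ∑ i, u i n x) = ∑ i, u i n := by
    funext x; simp
  rw [e]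
  exact eLpNorm_sum_le (fun i _ => hm i n) hp1

theorem tendsto_eLpNorm_smul_of_bdd {α : Type*} [MeasurableSpace α] {μ : Measure α}
    {p : ENNReal} {c : α → ℝ} {C : ℝ} (hc : ∀ᵐ x ∂μ, |c x| ≤ C) {u : ℕ → α → X}
    (hu : Tendsto (fun n => eLpNorm (u n) p μ) atTop (𝓝 0)) :
    Tendsto (fun n => eLpNorm (fun x => c x • u n x) p μ) atTop (𝓝 0) := by
  have h1 : Tendsto (fun n => ENNReal.ofReal C * eLpNorm (u n) p μ) atTop (𝓝 0) := by
    simpa using ENNReal.Tendsto.const_mul hu (Or.inr ENNReal.ofReal_ne_top)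
  refine tendsto_of_tendsto_of_tendsto_of_le_of_le tendsto_const_nhds h1
    (fun n => zero_le) fun n => ?_
  refine eLpNorm_le_mul_eLpNorm_of_ae_le_mul ?_ p
  filter_upwards [hc] with x hx
  rw [norm_smul]
  exact mul_le_mul_of_nonneg_right hx (norm_nonneg _)

theorem exists_bound_of_continuous {Ω : Set (Euc 3)} (hΩ : IsBoundedSmoothDomain Ω)
    {Y : Type*} [NormedAddCommGroup Y] {c : Euc 3 → Y} (hc : Continuous c) :
    ∃ C, ∀ x ∈ closure Ω, ‖c x‖ ≤ C :=
  hΩ.isBounded.isCompact_closure.exists_bound_of_continuousOn hc.continuousOn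

/-- The kernel with which the `i`-th part is mollified. -/
def ConePartition.kernel {Ω : Set (Euc 3)} {ι : Type} [Fintype ι] (c : ConePartition Ω ι) (i : ι)
    (n : ℕ) : ContDiffBump (-((n + 1 : ℝ)⁻¹ • c.w i)) where
  rIn := (n + 1 : ℝ)⁻¹ * c.s i / 4
  rOut := (n + 1 : ℝ)⁻¹ * c.s i / 2
  rIn_pos := by have := c.s_pos i; positivity
  rIn_lt_rOut := by
    have := c.s_pos i
    have : 0 < (n + 1 : ℝ)⁻¹ * c.s i := by positivity
    linarith

/-- The kernel is centred at -w/(n+1) with radius s/(2(n+1)), so z - v = z + te with t = 1/(n+1) and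
e in the base of the cone: the mollifier samples only inside Ω. -/
theorem ConePartition.sub_mem {Ω : Set (Euc 3)} {ι : Type} [Fintype ι] (c : ConePartition Ω ι)
    (i : ι) (n : ℕ) {z : Euc 3} (hz : z ∈ Ω) (hzi : z ∈ tsupport (c.χ i)) {v : Euc 3}
    (hv : v ∈ tsupport ((c.kernel i n).normed volume)) : z - v ∈ Ω := by
  have hs := c.s_pos i
  have hn : (0 : ℝ) < n + 1 := by positivity
  rw [ContDiffBump.tsupport_normed_eq, mem_closedBall_iff_norm] at hv
  have h1 : ‖(-((n + 1 : ℝ) • v)) - c.w i‖ < c.s i := by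
    have e : (-((n + 1 : ℝ) • v)) - c.w i = -((n + 1 : ℝ) • (v - (-((n + 1 : ℝ)⁻¹ • c.w i)))) := by
      rw [sub_neg_eq_add, smul_add, smul_inv_smul₀ hn.ne']
      abel
    rw [e, norm_neg, norm_smul, Real.norm_of_nonneg hn.le]
    have : (n + 1 : ℝ) * ‖v - (-((n + 1 : ℝ)⁻¹ • c.w i))‖ ≤ c.s i / 2 := by
      have h2 : ‖v - (-((n + 1 : ℝ)⁻¹ • c.w i))‖ ≤ (n + 1 : ℝ)⁻¹ * c.s i / 2 := hv
      calc (n + 1 : ℝ) * ‖v - (-((n + 1 : ℝ)⁻¹ • c.w i))‖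
          ≤ (n + 1 : ℝ) * ((n + 1 : ℝ)⁻¹ * c.s i / 2) := mul_le_mul_of_nonneg_left h2 hn.le
        _ = c.s i / 2 := by field_simp
    linarith
  have h2 := c.cone i z hz hzi _ (mem_ball_iff_norm.2 h1) ((n + 1 : ℝ)⁻¹) (by positivity)
    (inv_le_one_of_one_le₀ (by linarith [n.cast_nonneg (α := ℝ)]))
  rwa [smul_neg, inv_smul_smul₀ hn.ne', ← sub_eq_add_neg] at h2

theorem ConePartition.tendsto_mollify [CompleteSpace X] {Ω : Set (Euc 3)} {ι : Type} [Fintype ι]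
    (c : ConePartition Ω ι) (i : ι) {p : ENNReal} (hp1 : 1 ≤ p) (hp : p ≠ ⊤) {h : Euc 3 → X}
    (hh : MemLp h p) : Tendsto (fun n => eLpNorm
      (mollify ((c.kernel i n).normed volume) h - h) p (volume.restrict Ω)) atTop (𝓝 0) := by
  have hs := c.s_pos i
  have h1 := tendsto_eLpNorm_mollify_sub (k := fun n => (c.kernel i n).normed volume)
    (r := fun n : ℕ => (n + 1 : ℝ)⁻¹ * (‖c.w i‖ + c.s i))
    (fun n => (c.kernel i n).continuous_normed) (fun n => (c.kernel i n).hasCompactSupport_normed)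
    (fun n => (c.kernel i n).nonneg_normed) (fun n => (c.kernel i n).integral_normed)
    (fun n v hv => by
      rw [ContDiffBump.support_normed_eq, mem_ball_iff_norm] at hv
      have h2 : ‖v - (-((n + 1 : ℝ)⁻¹ • c.w i))‖ < (n + 1 : ℝ)⁻¹ * c.s i / 2 := hv
      have hn : (0 : ℝ) < (n + 1 : ℝ)⁻¹ := by positivity
      rw [mem_ball_zero_iff]
      calc ‖v‖ = ‖(v - (-((n + 1 : ℝ)⁻¹ • c.w i))) + (-((n + 1 : ℝ)⁻¹ • c.w i))‖ := by
            rw [sub_add_cancel]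
        _ ≤ ‖v - (-((n + 1 : ℝ)⁻¹ • c.w i))‖ + ‖-((n + 1 : ℝ)⁻¹ • c.w i)‖ := norm_add_le _ _
        _ = ‖v - (-((n + 1 : ℝ)⁻¹ • c.w i))‖ + (n + 1 : ℝ)⁻¹ * ‖c.w i‖ := by
            rw [norm_neg, norm_smul, Real.norm_of_nonneg hn.le]
        _ < (n + 1 : ℝ)⁻¹ * (‖c.w i‖ + c.s i) := by
            have : 0 < (n + 1 : ℝ)⁻¹ * c.s i := by positivity
            rw [mul_add]
            linarith)
    (by
      have := (tendsto_one_div_add_atTop_nhds_zero_nat (𝕜 := ℝ)).mul_const (‖c.w i‖ + c.s i)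
      simpa using this) hp1 hp hh
  exact tendsto_of_tendsto_of_tendsto_of_le_of_le tendsto_const_nhds h1 (fun n => zero_le)
    fun n => eLpNorm_mono_measure _ Measure.restrict_le_self

/-- The approximations are ∑ χ_i (k_{i,n} ⋆ 1_Ω f), each piece being mollified with a kernel shifted
into its own cone. The cutoffs multiply after mollification, so the weak derivative of f is used
only at points of the support of χ_i. -/
theorem exists_smoothApprox [CompleteSpace X] {Ω : Set (Euc 3)} (hΩ : IsBoundedSmoothDomain Ω)
    {p : ENNReal} (hp1 : 1 ≤ p) (hp : p ≠ ⊤) {f : Euc 3 → X} {G : Fin 3 → Euc 3 → X}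
    (hf : MemLp f p (volume.restrict Ω)) (hG : ∀ a, MemLp (G a) p (volume.restrict Ω))
    (hfG : ∀ a, HasWeakPartial Ω a f (G a)) : ∃ φ, SmoothApprox Ω p f G φ := by
  obtain ⟨ι, _, ⟨c⟩⟩ := hΩ.exists_conePartition
  have hΩm := hΩ.isOpen.measurableSet
  have hf' : MemLp (Ω.indicator f) p := (memLp_indicator_iff_restrict hΩm).2 hf
  have hG' : ∀ a, MemLp (Ω.indicator (G a)) p := fun a =>
    (memLp_indicator_iff_restrict hΩm).2 (hG a)
  have hfl : LocallyIntegrable (Ω.indicator f) := hf'.locallyIntegrable hp1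
  have hGl : ∀ a, LocallyIntegrable (Ω.indicator (G a)) := fun a => (hG' a).locallyIntegrable hp1
  have hks : ∀ i n, ContDiff ℝ ∞ ((c.kernel i n).normed volume) := fun i n =>
    (c.kernel i n).contDiff_normed (n := (⊤ : ℕ∞))
  have hkc : ∀ i n, HasCompactSupport ((c.kernel i n).normed volume) := fun i n =>
    (c.kernel i n).hasCompactSupport_normed
  set m : (Euc 3 → X) → ι → ℕ → Euc 3 → X := fun h i n =>
    mollify ((c.kernel i n).normed volume) (Ω.indicator h) with hm
  have hmf : ∀ i n, ContDiff ℝ ∞ (m f i n) := fun i n => contDiff_mollify (hks i n) (hkc i n) hfl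
  have hmG : ∀ a i n, ContDiff ℝ ∞ (m (G a) i n) := fun a i n =>
    contDiff_mollify (hks i n) (hkc i n) (hGl a)
  have hdχ : ∀ i a, Continuous (fun x => fderiv ℝ (c.χ i) x (basisVec a)) := fun i a =>
    (contDiff_fderiv_infty (c.contDiff i)).continuous.clm_apply continuous_const
  have hb : ∀ {u : Euc 3 → ℝ}, Continuous u → ∃ C, ∀ᵐ x ∂(volume.restrict Ω), |u x| ≤ C :=
    fun {u} hu => by
      obtain ⟨C, hC⟩ := exists_bound_of_continuous hΩ hu
      exact ⟨C, ae_restrict_of_forall_mem hΩm fun x hx => hC x (subset_closure hx)⟩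
  refine ⟨fun n z => ∑ i, c.χ i z • m f i n z, hf, hG, fun n => ContDiff.sum fun i _ =>
    (c.contDiff i).smul (hmf i n), ?_, fun a => ?_⟩
  · have h1 : Tendsto (fun n => eLpNorm
        (fun x => ∑ i, c.χ i x • (m f i n - Ω.indicator f) x) p (volume.restrict Ω)) atTop (𝓝 0) := by
      refine tendsto_eLpNorm_sum hp1 (fun i n => ?_) (fun i => ?_)
      · exact (c.contDiff i).continuous.aestronglyMeasurable.smul
          ((hmf i n).continuous.aestronglyMeasurable.sub hf'.1.restrict)
      · obtain ⟨C, hC⟩ := hb (c.contDiff i).continuous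
        exact tendsto_eLpNorm_smul_of_bdd hC (c.tendsto_mollify i hp1 hp hf')
    refine h1.congr fun n => eLpNorm_congr_ae (ae_restrict_of_forall_mem hΩm fun x hx => ?_)
    simp only [Pi.sub_apply, smul_sub, Finset.sum_sub_distrib, Set.indicator_of_mem hx,
      ← Finset.sum_smul, c.sum_eq_one x hx, one_smul]
  · have h1 : Tendsto (fun n => eLpNorm
        (fun x => ∑ i, (fderiv ℝ (c.χ i) x (basisVec a) • (m f i n - Ω.indicator f) x
          + c.χ i x • (m (G a) i n - Ω.indicator (G a)) x)) p (volume.restrict Ω)) atTop (𝓝 0) := by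
      have m1 : ∀ i n, AEStronglyMeasurable (fun x => fderiv ℝ (c.χ i) x (basisVec a) •
          (m f i n - Ω.indicator f) x) (volume.restrict Ω) := fun i n =>
        (hdχ i a).aestronglyMeasurable.smul
          ((hmf i n).continuous.aestronglyMeasurable.sub hf'.1.restrict)
      have m2 : ∀ i n, AEStronglyMeasurable (fun x => c.χ i x •
          (m (G a) i n - Ω.indicator (G a)) x) (volume.restrict Ω) := fun i n =>
        (c.contDiff i).continuous.aestronglyMeasurable.smul
          ((hmG a i n).continuous.aestronglyMeasurable.sub (hG' a).1.restrict)
      refine tendsto_eLpNorm_sum hp1 (fun i n => (m1 i n).add (m2 i n)) (fun i => ?_)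
      obtain ⟨C, hC⟩ := hb (c.contDiff i).continuous
      obtain ⟨D, hD⟩ := hb (hdχ i a)
      have l1 := tendsto_eLpNorm_smul_of_bdd hD (c.tendsto_mollify i hp1 hp hf')
      have l2 := tendsto_eLpNorm_smul_of_bdd hC (c.tendsto_mollify i hp1 hp (hG' a))
      have l3 := l1.add l2
      rw [add_zero] at l3
      exact tendsto_of_tendsto_of_tendsto_of_le_of_le tendsto_const_nhds l3 (fun n => zero_le)
        fun n => eLpNorm_add_le (m1 i n) (m2 i n) hp1
    refine h1.congr fun n => eLpNorm_congr_ae (ae_restrict_of_forall_mem hΩm fun x hx => ?_)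
    have hd : ∀ i, HasFDerivAt (fun z => c.χ i z • m f i n z)
        (c.χ i x • fderiv ℝ (m f i n) x + (fderiv ℝ (c.χ i) x).smulRight (m f i n x)) x := fun i =>
      (((c.contDiff i).differentiable (by simp)) x).hasFDerivAt.smul
        (((hmf i n).differentiable (by simp)) x).hasFDerivAt
    -- The terms with ∂χ_i converge to (∑ ∂χ_i) f, which vanishes because ∑ χ_i = 1 on the open set
    -- Ω.
    have hsum : ∑ i, fderiv ℝ (c.χ i) x (basisVec a) = 0 := by
      have e1 : HasFDerivAt (fun z => ∑ i, c.χ i z) (∑ i, fderiv ℝ (c.χ i) x) x :=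
        HasFDerivAt.fun_sum fun i _ => (((c.contDiff i).differentiable (by simp)) x).hasFDerivAt
      have e2 : HasFDerivAt (fun z => ∑ i, c.χ i z) (0 : Euc 3 →L[ℝ] ℝ) x := by
        refine (hasFDerivAt_const (1 : ℝ) x).congr_of_eventuallyEq ?_
        filter_upwards [hΩ.isOpen.mem_nhds hx] with z hz
        exact c.sum_eq_one z hz
      have := congrArg (fun T : Euc 3 →L[ℝ] ℝ => T (basisVec a)) (e1.unique e2)
      simpa [sum_apply] using this
    have hterm : ∀ i, c.χ i x • fderiv ℝ (m f i n) x (basisVec a) = c.χ i x • m (G a) i n x := by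
      intro i
      by_cases hxi : c.χ i x = 0
      · simp [hxi]
      · rw [fderiv_mollify_indicator hΩm (hks i n) (hkc i n) (hfG a) hfl]
        exact fun v hv => c.sub_mem i n hx (subset_tsupport _ hxi) hv
    rw [Pi.sub_apply, (HasFDerivAt.fun_sum fun i (_ : i ∈ Finset.univ) => hd i).fderiv]
    simp only [Pi.sub_apply, smul_sub, Finset.sum_sub_distrib, Set.indicator_of_mem hx,
      ← Finset.sum_smul, c.sum_eq_one x hx, one_smul, hsum, zero_smul,
      sum_apply, add_apply, smul_apply,
      ContinuousLinearMap.smulRight_apply, hterm, Finset.sum_add_distrib, sub_zero]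
    abel

end

/-! ### Sobolev inequalities -/

section

/-- The truncated kernel `|h|^{-2/3}`. -/
def rieszKernel (D : ℝ) (h : Euc 3) : ENNReal :=
  (Metric.ball (0 : Euc 3) D).indicator (fun h => ENNReal.ofReal (‖h‖ ^ (-(2 / 3) : ℝ))) h

theorem measurable_rieszKernel (D : ℝ) : Measurable (rieszKernel D) :=
  Measurable.indicator (by fun_prop) measurableSet_ball

/-- The exponent -2/3 is chosen so that the cube of the kernel is the kernel |h|^{-2} of the
pointwise bound, while its fourth power |h|^{-8/3} is still integrable near 0 in ℝ³. -/
theorem lintegral_rieszKernel_pow_four_lt_top (D : ℝ) : ∫⁻ h, rieszKernel D h ^ 4 < ⊤ := by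
  have h1 : IntegrableOn (fun h : Euc 3 => ‖h‖ ^ (-(8 / 3) : ℝ)) (Metric.ball 0 D) := by
    refine integrableOn_ball_of_norm_le_rpow (C := 1) (α := 8 / 3) ?_ ?_ ?_ ?_
    · simp
    · simp; norm_num
    · refine Eventually.of_forall fun x => ?_
      rw [one_mul, Real.norm_of_nonneg (by positivity)]
    · exact (by fun_prop : Measurable (fun h : Euc 3 => ‖h‖ ^ (-(8 / 3) : ℝ))).aestronglyMeasurable
  have h2 := h1.lintegral_lt_top
  rw [← lintegral_indicator measurableSet_ball] at h2
  refine lt_of_eq_of_lt (lintegral_congr fun h => ?_) h2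
  unfold rieszKernel
  by_cases hh : h ∈ Metric.ball (0 : Euc 3) D
  · rw [Set.indicator_of_mem hh, Set.indicator_of_mem hh, ← ENNReal.ofReal_pow (by positivity),
      ← Real.rpow_natCast, ← Real.rpow_mul (norm_nonneg _)]
    norm_num
  · simp [Set.indicator_of_notMem hh]

theorem rieszKernel_pow_three {D : ℝ} {h : Euc 3} (hh : h ∈ Metric.ball (0 : Euc 3) D) :
    rieszKernel D h ^ 3 = ENNReal.ofReal (‖h‖ ^ (-2 : ℝ)) := by
  unfold rieszKernel
  rw [Set.indicator_of_mem hh, ← ENNReal.ofReal_pow (by positivity),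
      ← Real.rpow_natCast, ← Real.rpow_mul (norm_nonneg _)]
  norm_num

theorem lintegral_comp_smul_eq {t : ℝ} (ht : 0 < t) (g : Euc 3 → ENNReal) (hg : Measurable g) :
    ∫⁻ e, g (t • e) = ENNReal.ofReal (t ^ (-3 : ℝ)) * ∫⁻ h, g h := by
  have h1 := Measure.map_addHaar_smul (volume : Measure (Euc 3)) ht.ne'
  rw [← lintegral_map (f := g) (g := fun e : Euc 3 => t • e) hg (by fun_prop), h1,
    lintegral_smul_measure, finrank_euclideanSpace_fin, abs_of_pos (by positivity), smul_eq_mul]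
  congr 2
  rw [Real.rpow_neg ht.le]
  norm_cast

theorem lintegral_rpow_le {R : ℝ} (hR : 0 < R) {h : Euc 3} (hh : h ≠ 0) :
    ∫⁻ t in Set.Ioc (0 : ℝ) 1, ENNReal.ofReal (t ^ (-3 : ℝ)) *
      (Set.Ioi (‖h‖ / R)).indicator 1 t ≤ ENNReal.ofReal (R ^ 2) * ENNReal.ofReal (‖h‖ ^ (-2 : ℝ)) := by
  have hpos : 0 < ‖h‖ / R := div_pos (norm_pos_iff.2 hh) hR
  calc ∫⁻ t in Set.Ioc (0 : ℝ) 1, ENNReal.ofReal (t ^ (-3 : ℝ)) *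
      (Set.Ioi (‖h‖ / R)).indicator 1 t
      ≤ ∫⁻ t, ENNReal.ofReal (t ^ (-3 : ℝ)) * (Set.Ioi (‖h‖ / R)).indicator 1 t :=
        setLIntegral_le_lintegral _ _
    _ = ∫⁻ t in Set.Ioi (‖h‖ / R), ENNReal.ofReal (t ^ (-3 : ℝ)) := by
        rw [← lintegral_indicator measurableSet_Ioi]
        congr 1
        funext t
        by_cases ht : t ∈ Set.Ioi (‖h‖ / R) <;> simp [ht]
    _ = ENNReal.ofReal (∫ t in Set.Ioi (‖h‖ / R), t ^ (-3 : ℝ)) := by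
        rw [ofReal_integral_eq_lintegral_ofReal (integrableOn_Ioi_rpow_of_lt (by norm_num) hpos)]
        refine (ae_restrict_of_forall_mem measurableSet_Ioi fun t ht => ?_)
        have : 0 < t := hpos.trans ht
        change (0 : ℝ) ≤ t ^ (-3 : ℝ)
        positivity
    _ ≤ _ := by
        rw [integral_Ioi_rpow_of_lt (by norm_num) hpos, ← ENNReal.ofReal_mul (by positivity)]
        refine ENNReal.ofReal_le_ofReal ?_
        have e : ((-3 : ℝ) + 1) = -2 := by norm_num
        rw [e, Real.div_rpow (norm_nonneg _) hR.le, Real.rpow_neg hR.le 2]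
        have e2 : R ^ (2 : ℝ) = R ^ 2 := by norm_cast
        rw [e2, div_inv_eq_mul]
        have : 0 ≤ ‖h‖ ^ (-2 : ℝ) * R ^ 2 := by positivity
        linarith

variable {X : Type} [NormedAddCommGroup X] [NormedSpace ℝ X]

theorem enorm_sub_le_lintegral_fderiv {φ : Euc 3 → X} (hφ : ContDiff ℝ ∞ φ) (z e : Euc 3) :
    ‖φ z‖ₑ ≤ ‖φ (z + e)‖ₑ + ∫⁻ t in Set.Ioc (0 : ℝ) 1, ‖fderiv ℝ φ (z + t • e)‖ₑ * ‖e‖ₑ := by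
  have hc : ContDiff ℝ ∞ (fun t : ℝ => φ (z + t • e)) := hφ.comp (by fun_prop)
  have h1 := enorm_sub_le_lintegral_deriv_of_contDiffOn_Icc (f := fun t : ℝ => φ (z + t • e))
    (a := 0) (b := 1) (hc.of_le (by simp)).contDiffOn zero_le_one
  simp only [one_smul, zero_smul, add_zero] at h1
  have hd : ∀ t : ℝ, deriv (fun t : ℝ => φ (z + t • e)) t = fderiv ℝ φ (z + t • e) e := by
    intro t
    have a1 : HasDerivAt (fun τ : ℝ => z + τ • e) e t := by
      simpa using ((hasDerivAt_id t).smul_const e).const_add z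
    exact (((hφ.differentiable (by simp)) _).hasFDerivAt.comp_hasDerivAt t a1).deriv
  rw [← restrict_Ioc_eq_restrict_Icc] at h1
  calc ‖φ z‖ₑ = ‖φ (z + e) - (φ (z + e) - φ z)‖ₑ := by rw [sub_sub_cancel]
    _ ≤ ‖φ (z + e)‖ₑ + ‖φ (z + e) - φ z‖ₑ := enorm_sub_le
    _ ≤ _ := by
      refine add_le_add le_rfl (h1.trans (lintegral_mono fun t => ?_))
      rw [hd]
      exact ContinuousLinearMap.le_opENorm _ _

/-- Average the fundamental theorem of calculus along z + te over the base of the cone, then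
substitute h = te. The Jacobian is t^{-3} and |h| < tR, so integrating in t over t > |h|/R leaves
the kernel |h|^{-2}. -/
theorem enorm_mul_volume_le {Ω : Set (Euc 3)} (hΩ : MeasurableSet Ω) {D : ℝ}
    (hD : ∀ x ∈ Ω, ∀ y ∈ Ω, x - y ∈ Metric.ball (0 : Euc 3) D) {w : Euc 3} {s : ℝ} (hs : 0 < s)
    {φ : Euc 3 → X} (hφ : ContDiff ℝ ∞ φ) {z : Euc 3} (hz : z ∈ Ω) (hc : ConeAt Ω z w s) :
    ‖φ z‖ₑ * volume (Metric.ball w s) ≤ (∫⁻ y in Ω, ‖φ y‖ₑ) +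
      ENNReal.ofReal ((‖w‖ + s) ^ 3) *
        ∫⁻ y in Ω, ‖fderiv ℝ φ y‖ₑ * rieszKernel D (y - z) ^ 3 := by
  set B := Metric.ball w s with hB
  set R := ‖w‖ + s with hR
  have hR0 : 0 < R := by positivity
  have hBm : MeasurableSet B := measurableSet_ball
  have hBR : ∀ e ∈ B, ‖e‖ < R := by
    intro e he
    rw [hB, mem_ball_iff_norm] at he
    calc ‖e‖ = ‖w + (e - w)‖ := by congr 1; abel
      _ ≤ ‖w‖ + ‖e - w‖ := norm_add_le _ _
      _ < R := by linarith
  have hfd : Continuous (fderiv ℝ φ) := (contDiff_fderiv_infty hφ).continuous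
  set F : Euc 3 → ENNReal := Ω.indicator fun y => ‖fderiv ℝ φ y‖ₑ with hF
  have hFm : Measurable F := Measurable.indicator hfd.enorm.measurable hΩ
  have step1 : ∫⁻ e in B, ‖φ (z + e)‖ₑ ≤ ∫⁻ y in Ω, ‖φ y‖ₑ := by
    rw [← lintegral_indicator hBm, ← lintegral_indicator hΩ,
      ← lintegral_add_left_eq_self (fun y => Ω.indicator (fun y => ‖φ y‖ₑ) y) z]
    refine lintegral_mono fun e => ?_
    by_cases he : e ∈ B
    · have : z + e ∈ Ω := by simpa using hc e he 1 one_pos le_rfl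
      simp [he, this]
    · simp [he]
  have step2 : ∀ t ∈ Set.Ioc (0 : ℝ) 1, ∫⁻ e in B, ‖fderiv ℝ φ (z + t • e)‖ₑ * ‖e‖ₑ ≤
      ENNReal.ofReal R * ∫⁻ h, F (z + h) * (ENNReal.ofReal (t ^ (-3 : ℝ)) *
        (Set.Ioi (‖h‖ / R)).indicator 1 t) := by
    intro t ht
    have hg : Measurable (fun h : Euc 3 => F (z + h) * (Set.Ioi (‖h‖ / R)).indicator 1 t) := by
      refine (hFm.comp (measurable_const_add z)).mul ?_
      have : (fun h : Euc 3 => (Set.Ioi (‖h‖ / R)).indicator (1 : ℝ → ENNReal) t) =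
          ({h : Euc 3 | ‖h‖ / R < t}).indicator 1 := by
        funext h
        simp [Set.indicator]
      rw [this]
      exact measurable_one.indicator (measurableSet_lt (by fun_prop) measurable_const)
    have e1 : ∫⁻ h, F (z + h) * (ENNReal.ofReal (t ^ (-3 : ℝ)) *
        (Set.Ioi (‖h‖ / R)).indicator 1 t) = ∫⁻ e, F (z + t • e) *
          (Set.Ioi (‖t • e‖ / R)).indicator 1 t := by
      rw [lintegral_comp_smul_eq ht.1 _ hg, ← lintegral_const_mul _ hg]
      refine lintegral_congr fun h => ?_
      ring
    rw [e1, ← lintegral_const_mul' _ _ ENNReal.ofReal_ne_top, ← lintegral_indicator hBm]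
    refine lintegral_mono fun e => ?_
    by_cases he : e ∈ B
    · have h1 : z + t • e ∈ Ω := hc e he t ht.1 ht.2
      have h2 : t ∈ Set.Ioi (‖t • e‖ / R) := by
        rw [Set.mem_Ioi, div_lt_iff₀ hR0, norm_smul, Real.norm_of_nonneg ht.1.le]
        exact mul_lt_mul_of_pos_left (hBR e he) ht.1
      have h3 : ‖e‖ₑ ≤ ENNReal.ofReal R := by
        rw [← ofReal_norm]
        exact ENNReal.ofReal_le_ofReal (hBR e he).le
      simp only [Set.indicator_of_mem he, hF, Set.indicator_of_mem h1, Set.indicator_of_mem h2,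
        Pi.one_apply, mul_one]
      rw [mul_comm]
      exact mul_le_mul_left h3 _
    · simp [he]
  have step3 : ∫⁻ t in Set.Ioc (0 : ℝ) 1, ∫⁻ h, F (z + h) * (ENNReal.ofReal (t ^ (-3 : ℝ)) *
        (Set.Ioi (‖h‖ / R)).indicator 1 t) ≤
      ENNReal.ofReal (R ^ 2) * ∫⁻ y in Ω, ‖fderiv ℝ φ y‖ₑ * rieszKernel D (y - z) ^ 3 := by
    rw [lintegral_lintegral_swap]
    · have e2 : ∫⁻ y in Ω, ‖fderiv ℝ φ y‖ₑ * rieszKernel D (y - z) ^ 3 =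
          ∫⁻ h, F (z + h) * rieszKernel D h ^ 3 := by
        rw [← lintegral_indicator hΩ, ← lintegral_add_left_eq_self _ z]
        refine lintegral_congr fun h => ?_
        by_cases hh : z + h ∈ Ω <;> simp [hF, hh]
      rw [e2, ← lintegral_const_mul' _ _ ENNReal.ofReal_ne_top]
      refine lintegral_mono_ae ?_
      filter_upwards [compl_mem_ae_iff.2 (measure_singleton (0 : Euc 3))] with h hh
      have hm : Measurable (fun t : ℝ => ENNReal.ofReal (t ^ (-3 : ℝ)) *
          (Set.Ioi (‖h‖ / R)).indicator (1 : ℝ → ENNReal) t) :=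
        (by fun_prop : Measurable (fun t : ℝ => ENNReal.ofReal (t ^ (-3 : ℝ)))).mul
          (measurable_one.indicator measurableSet_Ioi)
      rw [lintegral_const_mul _ hm]
      by_cases hzh : z + h ∈ Ω
      · have h1 : h ∈ Metric.ball (0 : Euc 3) D := by simpa using hD _ hzh _ hz
        rw [rieszKernel_pow_three h1]
        calc F (z + h) * _ ≤ F (z + h) * (ENNReal.ofReal (R ^ 2) * ENNReal.ofReal (‖h‖ ^ (-2 : ℝ))) :=
              mul_le_mul_right (lintegral_rpow_le hR0 hh) _
          _ = _ := by ring
      · simp [hF, hzh]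
    · refine AEMeasurable.mul ?_ (AEMeasurable.mul ?_ ?_)
      · exact (hFm.comp (by fun_prop : Measurable (fun p : ℝ × Euc 3 => z + p.2))).aemeasurable
      · exact (by fun_prop : Measurable
          (fun p : ℝ × Euc 3 => ENNReal.ofReal (p.1 ^ (-3 : ℝ)))).aemeasurable
      · have : (fun a : ℝ × Euc 3 =>
            (Set.Ioi (‖a.2‖ / R)).indicator (1 : ℝ → ENNReal) a.1) =
            ({p : ℝ × Euc 3 | ‖p.2‖ / R < p.1}).indicator 1 := by
          funext p
          simp [Set.indicator]
        rw [this]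
        exact (measurable_one.indicator (measurableSet_lt (by fun_prop) (by fun_prop))).aemeasurable
  calc ‖φ z‖ₑ * volume B = ∫⁻ _ in B, ‖φ z‖ₑ := by rw [setLIntegral_const]
    _ ≤ ∫⁻ e in B, (‖φ (z + e)‖ₑ +
        ∫⁻ t in Set.Ioc (0 : ℝ) 1, ‖fderiv ℝ φ (z + t • e)‖ₑ * ‖e‖ₑ) :=
      lintegral_mono fun e => enorm_sub_le_lintegral_fderiv hφ z e
    _ = (∫⁻ e in B, ‖φ (z + e)‖ₑ) + ∫⁻ e in B,
        ∫⁻ t in Set.Ioc (0 : ℝ) 1, ‖fderiv ℝ φ (z + t • e)‖ₑ * ‖e‖ₑ :=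
      lintegral_add_left (hφ.continuous.comp (by fun_prop)).enorm.measurable _
    _ = (∫⁻ e in B, ‖φ (z + e)‖ₑ) + ∫⁻ t in Set.Ioc (0 : ℝ) 1,
        ∫⁻ e in B, ‖fderiv ℝ φ (z + t • e)‖ₑ * ‖e‖ₑ := by
      congr 1
      refine lintegral_lintegral_swap ?_
      have c1 : Continuous fun p : Euc 3 × ℝ => fderiv ℝ φ (z + p.2 • p.1) :=
        hfd.comp (by fun_prop)
      exact c1.enorm.aemeasurable.mul (continuous_fst (X := Euc 3) (Y := ℝ)).enorm.aemeasurable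
    _ ≤ (∫⁻ y in Ω, ‖φ y‖ₑ) + ENNReal.ofReal R * ∫⁻ t in Set.Ioc (0 : ℝ) 1,
        ∫⁻ h, F (z + h) * (ENNReal.ofReal (t ^ (-3 : ℝ)) *
        (Set.Ioi (‖h‖ / R)).indicator 1 t) := by
      refine add_le_add step1 ?_
      rw [← lintegral_const_mul' _ _ ENNReal.ofReal_ne_top]
      exact setLIntegral_mono' measurableSet_Ioc step2
    _ ≤ (∫⁻ y in Ω, ‖φ y‖ₑ) + ENNReal.ofReal R * (ENNReal.ofReal (R ^ 2) *
        ∫⁻ y in Ω, ‖fderiv ℝ φ y‖ₑ * rieszKernel D (y - z) ^ 3) :=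
      add_le_add le_rfl (mul_le_mul_right step3 _)
    _ = _ := by
      rw [← mul_assoc, ← ENNReal.ofReal_mul hR0.le]
      congr 3
      ring

end

/-! ### Riesz potential estimates and the two Sobolev embeddings -/

section

theorem sq_lintegral_mul_le {α : Type*} [MeasurableSpace α] {μ : Measure α} {f g : α → ENNReal}
    (hf : AEMeasurable f μ) (hg : AEMeasurable g μ) :
    (∫⁻ x, f x * g x ∂μ) ^ 2 ≤ (∫⁻ x, f x ^ 2 ∂μ) * ∫⁻ x, g x ^ 2 ∂μ := by
  have h := ENNReal.lintegral_mul_le_Lp_mul_Lq μ Real.HolderConjugate.two_two hf hg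
  have e : ∀ y : ENNReal, (y ^ (1 / 2 : ℝ)) ^ 2 = y := fun y => by
    rw [← ENNReal.rpow_natCast, ← ENNReal.rpow_mul]
    norm_num
  calc (∫⁻ x, f x * g x ∂μ) ^ 2
      ≤ ((∫⁻ x, f x ^ (2 : ℝ) ∂μ) ^ (1 / 2 : ℝ) * (∫⁻ x, g x ^ (2 : ℝ) ∂μ) ^ (1 / 2 : ℝ)) ^ 2 :=
        pow_le_pow_left' h 2
    _ = _ := by
        rw [mul_pow, e, e]
        simp only [ENNReal.rpow_two]

theorem eLpNorm_two_sq {α Y : Type*} [MeasurableSpace α] {μ : Measure α} [NormedAddCommGroup Y]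
    (f : α → Y) : eLpNorm f 2 μ ^ 2 = ∫⁻ x, ‖f x‖ₑ ^ 2 ∂μ := by
  have := eLpNorm_nnreal_pow_eq_lintegral (μ := μ) (f := f) (p := 2) two_ne_zero
  simpa using this

theorem eLpNorm_four_pow {α Y : Type*} [MeasurableSpace α] {μ : Measure α} [NormedAddCommGroup Y]
    (f : α → Y) : eLpNorm f 4 μ ^ 4 = ∫⁻ x, ‖f x‖ₑ ^ 4 ∂μ := by
  have := eLpNorm_nnreal_pow_eq_lintegral (μ := μ) (f := f) (p := 4) four_ne_zero
  have e : ((4 : NNReal) : ℝ) = ((4 : ℕ) : ℝ) := by norm_num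
  simp only [e, ENNReal.rpow_natCast] at this
  simpa using this

/-- The crude constant 1 + c, with c ≤ (1 + c)⁴, avoids taking a fourth root. -/
theorem le_mul_of_pow_four_le {x c T : ENNReal} (h : x ^ 4 ≤ c * T ^ 4) : x ≤ (1 + c) * T := by
  have h1 : c ≤ (1 + c) ^ 4 := by
    calc c ≤ 1 + c := le_add_self
      _ ≤ (1 + c) ^ 4 := le_self_pow₀ le_self_add (by norm_num)
  have h2 : x ^ 4 ≤ ((1 + c) * T) ^ 4 := by
    rw [mul_pow]
    exact h.trans (mul_le_mul_left h1 _)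
  exact (ENNReal.pow_right_strictMono (n := 4) (by norm_num)).le_iff_le.1 h2

theorem add_pow_four_le (a b : ENNReal) : (a + b) ^ 4 ≤ 16 * (a ^ 4 + b ^ 4) := by
  have h : ∀ {a b : ENNReal}, a ≤ b → (a + b) ^ 4 ≤ 16 * b ^ 4 := fun {a b} hab => by
    calc (a + b) ^ 4 ≤ (b + b) ^ 4 := pow_le_pow_left' (add_le_add hab le_rfl) 4
      _ = 16 * b ^ 4 := by ring
  rcases le_total a b with hab | hab
  · exact (h hab).trans (mul_le_mul_right le_add_self _)
  · rw [add_comm a b]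
    exact (h hab).trans (mul_le_mul_right le_self_add _)

variable {Ω : Set (Euc 3)} {X : Type} [NormedAddCommGroup X] [NormedSpace ℝ X]

theorem lintegral_sub_right_le (D : ℝ) (z : Euc 3) :
    ∫⁻ y in Ω, rieszKernel D (y - z) ^ 4 ≤ ∫⁻ h, rieszKernel D h ^ 4 := by
  calc ∫⁻ y in Ω, rieszKernel D (y - z) ^ 4 ≤ ∫⁻ y, rieszKernel D (y - z) ^ 4 :=
        setLIntegral_le_lintegral _ _
    _ = _ := lintegral_sub_right_eq_self (fun y => rieszKernel D y ^ 4) z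

theorem measurable_rieszKernel_sub (D : ℝ) (z : Euc 3) :
    Measurable fun y => rieszKernel D (y - z) :=
  (measurable_rieszKernel D).comp (measurable_id.sub_const z)

/-- Cauchy–Schwarz for the splitting Fk³ = (Fk)·k². -/
theorem riesz_sq_le {F : Euc 3 → ENNReal} (hF : Measurable F) (D : ℝ) (z : Euc 3) :
    (∫⁻ y in Ω, F y * rieszKernel D (y - z) ^ 3) ^ 2 ≤
      (∫⁻ y in Ω, F y ^ 2 * rieszKernel D (y - z) ^ 2) * ∫⁻ h, rieszKernel D h ^ 4 := by
  have hk := measurable_rieszKernel_sub D z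
  have h1 := sq_lintegral_mul_le (μ := volume.restrict Ω) (hF.mul hk).aemeasurable
    (hk.pow_const 2).aemeasurable
  calc (∫⁻ y in Ω, F y * rieszKernel D (y - z) ^ 3) ^ 2
      = (∫⁻ y in Ω, (F y * rieszKernel D (y - z)) * rieszKernel D (y - z) ^ 2) ^ 2 := by
        congr 1
        refine lintegral_congr fun y => ?_
        ring
    _ ≤ _ := h1
    _ = (∫⁻ y in Ω, F y ^ 2 * rieszKernel D (y - z) ^ 2) *
        ∫⁻ y in Ω, rieszKernel D (y - z) ^ 4 := by
        congr 1
        · refine lintegral_congr fun y => ?_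
          simp only [Pi.mul_apply]
          ring
        · refine lintegral_congr fun y => ?_
          ring
    _ ≤ _ := mul_le_mul_right (lintegral_sub_right_le D z) _

/-- After `riesz_sq_le`, a second Cauchy–Schwarz on F²·k². The bound is uniform in z and yields the
embedding in L^∞. -/
theorem riesz_pow_four_le_of_pow_four {F : Euc 3 → ENNReal} (hF : Measurable F) (D : ℝ)
    (z : Euc 3) : (∫⁻ y in Ω, F y * rieszKernel D (y - z) ^ 3) ^ 4 ≤
      (∫⁻ h, rieszKernel D h ^ 4) ^ 3 * ∫⁻ y in Ω, F y ^ 4 := by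
  have hk := measurable_rieszKernel_sub D z
  set M := ∫⁻ h, rieszKernel D h ^ 4
  have h1 := sq_lintegral_mul_le (μ := volume.restrict Ω) (hF.pow_const 2).aemeasurable
    (hk.pow_const 2).aemeasurable
  calc (∫⁻ y in Ω, F y * rieszKernel D (y - z) ^ 3) ^ 4
      = ((∫⁻ y in Ω, F y * rieszKernel D (y - z) ^ 3) ^ 2) ^ 2 := by ring
    _ ≤ ((∫⁻ y in Ω, F y ^ 2 * rieszKernel D (y - z) ^ 2) * M) ^ 2 :=
        pow_le_pow_left' (riesz_sq_le hF D z) 2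
    _ = (∫⁻ y in Ω, F y ^ 2 * rieszKernel D (y - z) ^ 2) ^ 2 * M ^ 2 := by ring
    _ ≤ ((∫⁻ y in Ω, (F y ^ 2) ^ 2) * ∫⁻ y in Ω, (rieszKernel D (y - z) ^ 2) ^ 2) * M ^ 2 :=
        mul_le_mul_left h1 _
    _ ≤ ((∫⁻ y in Ω, F y ^ 4) * M) * M ^ 2 := by
        refine mul_le_mul_left (mul_le_mul' (le_of_eq ?_) ?_) _
        · refine lintegral_congr fun y => ?_
          ring
        · refine le_trans (le_of_eq (lintegral_congr fun y => ?_)) (lintegral_sub_right_le D z)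
          ring
    _ = _ := by ring

/-- After `riesz_sq_le`, the second Cauchy–Schwarz splits F²k² as F·(Fk²). What remains is ∫F²k⁴,
and Tonelli integrates the k⁴ in z. -/
theorem lintegral_riesz_pow_four_le {F : Euc 3 → ENNReal} (hF : Measurable F) (D : ℝ) :
    ∫⁻ z in Ω, (∫⁻ y in Ω, F y * rieszKernel D (y - z) ^ 3) ^ 4 ≤
      (∫⁻ h, rieszKernel D h ^ 4) ^ 3 * (∫⁻ y in Ω, F y ^ 2) ^ 2 := by
  set M := ∫⁻ h, rieszKernel D h ^ 4
  set S := ∫⁻ y in Ω, F y ^ 2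
  have hk2 : Measurable fun p : Euc 3 × Euc 3 => rieszKernel D (p.2 - p.1) :=
    (measurable_rieszKernel D).comp (measurable_snd.sub measurable_fst)
  have hm : Measurable fun z => ∫⁻ y in Ω, F y ^ 2 * rieszKernel D (y - z) ^ 4 :=
    Measurable.lintegral_prod_right (((hF.comp measurable_snd).pow_const 2).mul (hk2.pow_const 4))
  have hpt : ∀ z, (∫⁻ y in Ω, F y * rieszKernel D (y - z) ^ 3) ^ 4 ≤
      (M ^ 2 * S) * ∫⁻ y in Ω, F y ^ 2 * rieszKernel D (y - z) ^ 4 := by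
    intro z
    have hk := measurable_rieszKernel_sub D z
    have h1 := sq_lintegral_mul_le (μ := volume.restrict Ω) hF.aemeasurable
      (hF.mul (hk.pow_const 2)).aemeasurable
    calc (∫⁻ y in Ω, F y * rieszKernel D (y - z) ^ 3) ^ 4
        = ((∫⁻ y in Ω, F y * rieszKernel D (y - z) ^ 3) ^ 2) ^ 2 := by ring
      _ ≤ ((∫⁻ y in Ω, F y ^ 2 * rieszKernel D (y - z) ^ 2) * M) ^ 2 :=
          pow_le_pow_left' (riesz_sq_le hF D z) 2
      _ = M ^ 2 * (∫⁻ y in Ω, F y * (F * fun y => rieszKernel D (y - z) ^ 2) y) ^ 2 := by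
          rw [mul_pow, mul_comm]
          congr 2
          refine lintegral_congr fun y => ?_
          simp only [Pi.mul_apply]
          ring
      _ ≤ M ^ 2 * _ := mul_le_mul_right h1 _
      _ = (M ^ 2 * S) * ∫⁻ y in Ω, F y ^ 2 * rieszKernel D (y - z) ^ 4 := by
          rw [mul_assoc]
          congr 2
          refine lintegral_congr fun y => ?_
          simp only [Pi.mul_apply]
          ring
  calc ∫⁻ z in Ω, (∫⁻ y in Ω, F y * rieszKernel D (y - z) ^ 3) ^ 4
      ≤ ∫⁻ z in Ω, (M ^ 2 * S) * ∫⁻ y in Ω, F y ^ 2 * rieszKernel D (y - z) ^ 4 :=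
        lintegral_mono hpt
    _ = (M ^ 2 * S) * ∫⁻ z in Ω, ∫⁻ y in Ω, F y ^ 2 * rieszKernel D (y - z) ^ 4 :=
        lintegral_const_mul _ hm
    _ = (M ^ 2 * S) * ∫⁻ y in Ω, ∫⁻ z in Ω, F y ^ 2 * rieszKernel D (y - z) ^ 4 := by
        congr 1
        exact lintegral_lintegral_swap
          (((hF.comp measurable_snd).pow_const 2).mul (hk2.pow_const 4)).aemeasurable
    _ ≤ (M ^ 2 * S) * ∫⁻ y in Ω, F y ^ 2 * M := by
        refine mul_le_mul_right (lintegral_mono fun y => ?_) _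
        have hk' : Measurable fun z => rieszKernel D (y - z) :=
          (measurable_rieszKernel D).comp (measurable_const.sub measurable_id)
        rw [lintegral_const_mul _ (hk'.pow_const 4)]
        refine mul_le_mul_right ((setLIntegral_le_lintegral _ _).trans (le_of_eq ?_)) _
        exact lintegral_sub_left_eq_self (fun z => rieszKernel D z ^ 4) y
    _ = _ := by
        rw [lintegral_mul_const _ (hF.pow_const 2)]
        ring

theorem exists_pointwise_bound (hΩ : IsBoundedSmoothDomain Ω) : ∃ C : ENNReal, C ≠ ⊤ ∧ ∃ D : ℝ,
    ∀ {X : Type} [NormedAddCommGroup X] [NormedSpace ℝ X] (φ : Euc 3 → X), ContDiff ℝ ∞ φ →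
      ∀ z ∈ Ω, ‖φ z‖ₑ ≤ C * ((∫⁻ y in Ω, ‖φ y‖ₑ) +
        ∫⁻ y in Ω, ‖fderiv ℝ φ y‖ₑ * rieszKernel D (y - z) ^ 3) := by
  obtain ⟨ι, _, ⟨c⟩⟩ := hΩ.exists_conePartition
  have hΩm := hΩ.isOpen.measurableSet
  obtain ⟨D, hD⟩ : ∃ D, ∀ x ∈ Ω, ∀ y ∈ Ω, x - y ∈ Metric.ball (0 : Euc 3) D := by
    refine ⟨Metric.diam Ω + 1, fun x hx y hy => ?_⟩
    rw [mem_ball_zero_iff, ← dist_eq_norm]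
    exact (Metric.dist_le_diam_of_mem hΩ.isBounded hx hy).trans_lt (lt_add_one _)
  set C : ι → ENNReal := fun i => (volume (Metric.ball (c.w i) (c.s i)))⁻¹ *
    (1 + ENNReal.ofReal ((‖c.w i‖ + c.s i) ^ 3)) with hC
  have hpos : ∀ i, volume (Metric.ball (c.w i) (c.s i)) ≠ 0 := fun i =>
    (Metric.measure_ball_pos _ _ (c.s_pos i)).ne'
  have hfin : ∀ i, volume (Metric.ball (c.w i) (c.s i)) ≠ ⊤ := fun i => measure_ball_lt_top.ne
  refine ⟨∑ i, C i, ?_, D, fun φ hφ z hz => ?_⟩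
  · refine ENNReal.sum_ne_top.2 fun i _ => ENNReal.mul_ne_top (ENNReal.inv_ne_top.2 (hpos i)) ?_
    simp
  · obtain ⟨i, hi⟩ : ∃ i, c.χ i z ≠ 0 := by
      by_contra! h
      have := c.sum_eq_one z hz
      simp [h] at this
    have h1 := enorm_mul_volume_le hΩm hD (c.s_pos i) hφ hz (c.cone i z hz (subset_tsupport _ hi))
    set A := ∫⁻ y in Ω, ‖φ y‖ₑ
    set u := ∫⁻ y in Ω, ‖fderiv ℝ φ y‖ₑ * rieszKernel D (y - z) ^ 3
    have h2 : ‖φ z‖ₑ * volume (Metric.ball (c.w i) (c.s i)) ≤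
        (1 + ENNReal.ofReal ((‖c.w i‖ + c.s i) ^ 3)) * (A + u) := by
      refine h1.trans ?_
      rw [add_mul, one_mul]
      exact add_le_add le_self_add (mul_le_mul_right le_add_self _)
    calc ‖φ z‖ₑ = (volume (Metric.ball (c.w i) (c.s i)))⁻¹ *
          (‖φ z‖ₑ * volume (Metric.ball (c.w i) (c.s i))) := by
          rw [mul_comm ‖φ z‖ₑ, ← mul_assoc, ENNReal.inv_mul_cancel (hpos i) (hfin i), one_mul]
      _ ≤ C i * (A + u) := by
          rw [hC, mul_assoc]
          exact mul_le_mul_right h2 _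
      _ ≤ (∑ i, C i) * (A + u) :=
          mul_le_mul_left (Finset.single_le_sum (f := C) (fun _ _ => zero_le) (Finset.mem_univ i)) _

theorem opNorm_le_sum_basisVec (T : Euc 3 →L[ℝ] X) : ‖T‖ ≤ ∑ a : Fin 3, ‖T (basisVec a)‖ := by
  refine T.opNorm_le_bound (Finset.sum_nonneg fun _ _ => norm_nonneg _) fun x => ?_
  have hx : x = ∑ a : Fin 3, x a • basisVec a := by
    have := (EuclideanSpace.basisFun (Fin 3) ℝ).sum_repr x
    simpa [basisVec] using this.symm
  calc ‖T x‖ = ‖∑ a : Fin 3, x a • T (basisVec a)‖ := by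
        conv_lhs => rw [hx]
        simp [map_sum]
    _ ≤ ∑ a : Fin 3, ‖x a • T (basisVec a)‖ := norm_sum_le _ _
    _ ≤ ∑ a : Fin 3, ‖T (basisVec a)‖ * ‖x‖ := by
        refine Finset.sum_le_sum fun a _ => ?_
        rw [norm_smul, mul_comm]
        exact mul_le_mul_of_nonneg_left (PiLp.norm_apply_le x a) (norm_nonneg _)
    _ = _ := by rw [Finset.sum_mul]

theorem eLpNorm_fderiv_le {φ : Euc 3 → X} (hφ : ContDiff ℝ ∞ φ) {p : ENNReal} (hp : 1 ≤ p)
    (μ : Measure (Euc 3)) : eLpNorm (fderiv ℝ φ) p μ ≤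
      ∑ a : Fin 3, eLpNorm (fun x => fderiv ℝ φ x (basisVec a)) p μ := by
  have hfd : Continuous (fderiv ℝ φ) := (contDiff_fderiv_infty hφ).continuous
  have hc : ∀ a : Fin 3, Continuous fun x => ‖fderiv ℝ φ x (basisVec a)‖ := fun a =>
    (hfd.clm_apply continuous_const).norm
  calc eLpNorm (fderiv ℝ φ) p μ
      ≤ eLpNorm (∑ a : Fin 3, fun x => ‖fderiv ℝ φ x (basisVec a)‖) p μ := by
        refine eLpNorm_mono fun x => ?_
        rw [Finset.sum_apply, Real.norm_of_nonneg (Finset.sum_nonneg fun _ _ => norm_nonneg _)]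
        exact opNorm_le_sum_basisVec _
    _ ≤ ∑ a : Fin 3, eLpNorm (fun x => ‖fderiv ℝ φ x (basisVec a)‖) p μ :=
        eLpNorm_sum_le (fun a _ => (hc a).aestronglyMeasurable) hp
    _ = _ := by simp only [eLpNorm_norm]

theorem IsBoundedSmoothDomain.volume_ne_top (hΩ : IsBoundedSmoothDomain Ω) : volume Ω ≠ ⊤ :=
  hΩ.isBounded.measure_lt_top.ne

theorem lintegral_enorm_le_mul_eLpNorm {Y : Type} [NormedAddCommGroup Y] {φ : Euc 3 → Y} (hφ : Continuous φ) {p : ENNReal}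
    (hp : 1 ≤ p) : ∫⁻ y in Ω, ‖φ y‖ₑ ≤ eLpNorm φ p (volume.restrict Ω) *
      volume Ω ^ (1 - 1 / p.toReal) := by
  have := eLpNorm_le_eLpNorm_mul_rpow_measure_univ hp
    (hφ.aestronglyMeasurable (μ := volume.restrict Ω))
  simpa [eLpNorm_one_eq_lintegral_enorm] using this

/-- The Sobolev inequality `W^{1,4} ⊆ L^∞` for functions that are smooth up to the boundary. -/
theorem exists_enorm_le_eLpNorm_four (hΩ : IsBoundedSmoothDomain Ω) : ∃ C : ENNReal, C ≠ ⊤ ∧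
    ∀ {X : Type} [NormedAddCommGroup X] [NormedSpace ℝ X] (φ : Euc 3 → X), ContDiff ℝ ∞ φ →
      ∀ z ∈ Ω, ‖φ z‖ₑ ≤ C * (eLpNorm φ 4 (volume.restrict Ω) +
        ∑ a : Fin 3, eLpNorm (fun x => fderiv ℝ φ x (basisVec a)) 4 (volume.restrict Ω)) := by
  obtain ⟨C, hC, D, h⟩ := exists_pointwise_bound hΩ
  have hM := lintegral_rieszKernel_pow_four_lt_top D
  set M := ∫⁻ h, rieszKernel D h ^ 4 with hM_def
  set c₁ : ENNReal := volume Ω ^ (1 - 1 / (4 : ENNReal).toReal) with hc₁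
  have hc₁' : c₁ ≠ ⊤ := ENNReal.rpow_ne_top_of_nonneg (by norm_num) hΩ.volume_ne_top
  set c₂ : ENNReal := 1 + M ^ 3 with hc₂
  have hc₂' : c₂ ≠ ⊤ := by simp [hc₂, hM.ne]
  refine ⟨C * (c₁ + c₂), ENNReal.mul_ne_top hC (by simp [hc₁', hc₂']), fun φ hφ z hz => ?_⟩
  have hfd : Continuous (fderiv ℝ φ) := (contDiff_fderiv_infty hφ).continuous
  have h1 := lintegral_enorm_le_mul_eLpNorm (Ω := Ω) hφ.continuous (p := 4) (by norm_num)
  have h2 := le_mul_of_pow_four_le ((riesz_pow_four_le_of_pow_four (Ω := Ω) hfd.enorm.measurable D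
    z).trans_eq (by rw [← eLpNorm_four_pow]))
  have h3 := eLpNorm_fderiv_le hφ (p := 4) (by norm_num) (volume.restrict Ω)
  refine (h φ hφ z hz).trans ?_
  set T := ∑ a : Fin 3, eLpNorm (fun x => fderiv ℝ φ x (basisVec a)) 4 (volume.restrict Ω)
  set L := eLpNorm φ 4 (volume.restrict Ω)
  rw [mul_assoc]
  refine mul_le_mul_right ?_ _
  calc _ ≤ L * c₁ + c₂ * T := add_le_add h1 (h2.trans (mul_le_mul_right h3 _))
    _ ≤ c₁ * (L + T) + c₂ * (L + T) := by
        rw [mul_comm L]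
        exact add_le_add (mul_le_mul_right le_self_add _) (mul_le_mul_right le_add_self _)
    _ = _ := (add_mul _ _ _).symm

/-- The Sobolev inequality `W^{1,2} ⊆ L⁴` for functions that are smooth up to the boundary. -/
theorem exists_eLpNorm_four_le_eLpNorm_two (hΩ : IsBoundedSmoothDomain Ω) : ∃ C : ENNReal, C ≠ ⊤ ∧
    ∀ {X : Type} [NormedAddCommGroup X] [NormedSpace ℝ X] (φ : Euc 3 → X), ContDiff ℝ ∞ φ →
      eLpNorm φ 4 (volume.restrict Ω) ≤ C * (eLpNorm φ 2 (volume.restrict Ω) +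
        ∑ a : Fin 3, eLpNorm (fun x => fderiv ℝ φ x (basisVec a)) 2 (volume.restrict Ω)) := by
  obtain ⟨C, hC, D, h⟩ := exists_pointwise_bound hΩ
  have hΩm := hΩ.isOpen.measurableSet
  have hM := lintegral_rieszKernel_pow_four_lt_top D
  set M := ∫⁻ h, rieszKernel D h ^ 4 with hM_def
  set c₁ : ENNReal := volume Ω ^ (1 - 1 / (2 : ENNReal).toReal) with hc₁
  have hV := hΩ.volume_ne_top
  have hc₁' : c₁ ≠ ⊤ := ENNReal.rpow_ne_top_of_nonneg (by norm_num) hV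
  set c : ENNReal := C ^ 4 * (16 * (c₁ ^ 4 * volume Ω + M ^ 3)) with hc
  have hc' : c ≠ ⊤ := by
    refine ENNReal.mul_ne_top (ENNReal.pow_ne_top hC) (ENNReal.mul_ne_top (by norm_num) ?_)
    exact ENNReal.add_ne_top.2 ⟨ENNReal.mul_ne_top (ENNReal.pow_ne_top hc₁') hV,
      ENNReal.pow_ne_top hM.ne⟩
  refine ⟨1 + c, by simp [hc'], fun φ hφ => le_mul_of_pow_four_le ?_⟩
  have hfd : Continuous (fderiv ℝ φ) := (contDiff_fderiv_infty hφ).continuous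
  have h1 := lintegral_enorm_le_mul_eLpNorm (Ω := Ω) hφ.continuous (p := 2) (by norm_num)
  have h2 := lintegral_riesz_pow_four_le (Ω := Ω) hfd.enorm.measurable D
  rw [← eLpNorm_two_sq] at h2
  have h3 := eLpNorm_fderiv_le hφ (p := 2) (by norm_num) (volume.restrict Ω)
  set T := ∑ a : Fin 3, eLpNorm (fun x => fderiv ℝ φ x (basisVec a)) 2 (volume.restrict Ω)
  set L := eLpNorm φ 2 (volume.restrict Ω)
  set A := ∫⁻ y in Ω, ‖φ y‖ₑ
  set u : Euc 3 → ENNReal := fun z => ∫⁻ y in Ω, ‖fderiv ℝ φ y‖ₑ * rieszKernel D (y - z) ^ 3 with hu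
  have hum : Measurable u :=
    Measurable.lintegral_prod_right ((hfd.enorm.measurable.comp measurable_snd).mul
      (((measurable_rieszKernel D).comp (measurable_snd.sub measurable_fst)).pow_const 3))
  rw [eLpNorm_four_pow]
  calc ∫⁻ z in Ω, ‖φ z‖ₑ ^ 4 ≤ ∫⁻ z in Ω, C ^ 4 * (16 * (A ^ 4 + u z ^ 4)) := by
        refine setLIntegral_mono' hΩm fun z hz => ?_
        calc ‖φ z‖ₑ ^ 4 ≤ (C * (A + u z)) ^ 4 := pow_le_pow_left' (h φ hφ z hz) 4
          _ = C ^ 4 * (A + u z) ^ 4 := mul_pow _ _ _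
          _ ≤ _ := mul_le_mul_right (add_pow_four_le _ _) _
    _ = C ^ 4 * (16 * (A ^ 4 * volume Ω + ∫⁻ z in Ω, u z ^ 4)) := by
        have m1 : Measurable fun z => A ^ 4 + u z ^ 4 := measurable_const.add (hum.pow_const 4)
        have m2 : Measurable fun z => 16 * (A ^ 4 + u z ^ 4) := m1.const_mul 16
        rw [lintegral_const_mul _ m2, lintegral_const_mul _ m1,
          lintegral_add_left measurable_const, setLIntegral_const]
    _ ≤ C ^ 4 * (16 * ((c₁ * (L + T)) ^ 4 * volume Ω + M ^ 3 * (L + T) ^ 4)) := by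
        refine mul_le_mul_right (mul_le_mul_right (add_le_add (mul_le_mul_left ?_ _) ?_) _) _
        · refine pow_le_pow_left' (h1.trans ?_) 4
          rw [mul_comm]
          exact mul_le_mul_right le_self_add _
        · refine h2.trans (mul_le_mul_right ?_ _)
          rw [← pow_mul]
          exact pow_le_pow_left' (h3.trans le_add_self) 4
    _ = c * (L + T) ^ 4 := by
        rw [hc, mul_pow]
        ring

end

/-! ### Convergence in `Lᵖ` -/

section

variable {α : Type} [MeasurableSpace α] {μ : Measure α} {p q r : ENNReal}
  {X Y Z : Type} [NormedAddCommGroup X] [NormedAddCommGroup Y] [NormedAddCommGroup Z]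

/-- The functions `u n` converge in `Lᵖ` to the function `f ∈ Lᵖ`. -/
structure LpTendsto (p : ENNReal) (μ : Measure α) (u : ℕ → α → X) (f : α → X) : Prop where
  memLp : MemLp f p μ
  aestronglyMeasurable : ∀ n, AEStronglyMeasurable (u n) μ
  tendsto : Tendsto (fun n => eLpNorm (u n - f) p μ) atTop (𝓝 0)

theorem tendsto_zero_of_le {u v : ℕ → ENNReal} (hv : Tendsto v atTop (𝓝 0)) (h : ∀ n, u n ≤ v n) :
    Tendsto u atTop (𝓝 0) :=
  tendsto_of_tendsto_of_tendsto_of_le_of_le tendsto_const_nhds hv (fun _ => zero_le) h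

theorem LpTendsto.congr {u u' : ℕ → α → X} {f f' : α → X} (h : LpTendsto p μ u f)
    (hu : ∀ n, u n =ᵐ[μ] u' n) (hf : f =ᵐ[μ] f') : LpTendsto p μ u' f' where
  memLp := (memLp_congr_ae hf).1 h.memLp
  aestronglyMeasurable n := (h.aestronglyMeasurable n).congr (hu n)
  tendsto := h.tendsto.congr fun n => eLpNorm_congr_ae ((hu n).sub hf)

theorem LpTendsto.add {u v : ℕ → α → X} {f g : α → X} (hp : 1 ≤ p) (hu : LpTendsto p μ u f)
    (hv : LpTendsto p μ v g) : LpTendsto p μ (fun n x => u n x + v n x) (fun x => f x + g x) where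
  memLp := hu.memLp.add hv.memLp
  aestronglyMeasurable n := (hu.aestronglyMeasurable n).add (hv.aestronglyMeasurable n)
  tendsto := by
    have h := hu.tendsto.add hv.tendsto
    rw [add_zero] at h
    refine tendsto_zero_of_le h fun n => ?_
    have e : (fun x => u n x + v n x) - (fun x => f x + g x) = (u n - f) + (v n - g) := by
      funext x
      simp only [Pi.sub_apply, Pi.add_apply]
      abel
    rw [e]
    exact eLpNorm_add_le ((hu.aestronglyMeasurable n).sub hu.memLp.1)
      ((hv.aestronglyMeasurable n).sub hv.memLp.1) hp

theorem LpTendsto.mono_exponent [IsFiniteMeasure μ] {u : ℕ → α → X} {f : α → X}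
    (h : LpTendsto q μ u f) (hpq : p ≤ q) : LpTendsto p μ u f where
  memLp := h.memLp.mono_exponent hpq
  aestronglyMeasurable := h.aestronglyMeasurable
  tendsto := by
    rcases eq_or_ne p 0 with rfl | hp
    · simp
    · have hc : μ Set.univ ^ (1 / p.toReal - 1 / q.toReal) ≠ ⊤ := by
        refine ENNReal.rpow_ne_top_of_nonneg ?_ (measure_ne_top μ _)
        rcases eq_or_ne q ⊤ with rfl | hq
        · simp
        · have hq' : p ≠ ⊤ := ne_top_of_le_ne_top hq hpq
          have := ENNReal.toReal_mono hq hpq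
          have h0 := ENNReal.toReal_pos hp hq'
          rw [sub_nonneg]
          exact one_div_le_one_div_of_le h0 this
      have h1 := ENNReal.Tendsto.mul_const h.tendsto (Or.inr hc)
      rw [zero_mul] at h1
      exact tendsto_zero_of_le h1 fun n => eLpNorm_le_eLpNorm_mul_rpow_measure_univ hpq
        ((h.aestronglyMeasurable n).sub h.memLp.1)

/-- By Fatou the Lᵖ distance to the almost everywhere limit is at most the liminf of the mutual
distances. This upgrades the mode of convergence without changing the limit function. -/
theorem LpTendsto.of_cauchy {u : ℕ → α → X} {f : α → X} (hm : ∀ n, MemLp (u n) p μ)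
    (hp : 1 ≤ p) {ns : ℕ → ℕ} (hns : Tendsto ns atTop atTop)
    (hf : ∀ᵐ x ∂μ, Tendsto (fun k => u (ns k) x) atTop (𝓝 (f x)))
    (hc : ∀ ε : ENNReal, 0 < ε → ∃ N, ∀ n ≥ N, ∀ m ≥ N, eLpNorm (u n - u m) p μ ≤ ε) :
    LpTendsto p μ u f := by
  have h1 : ∀ ε : ENNReal, 0 < ε → ∃ N, ∀ n ≥ N, eLpNorm (u n - f) p μ ≤ ε := by
    intro ε hε
    obtain ⟨N, hN⟩ := hc ε hε
    refine ⟨N, fun n hn => ?_⟩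
    have h2 := Lp.eLpNorm_lim_le_liminf_eLpNorm (f := fun k => u n - u (ns k)) (p := p) (μ := μ)
      (fun k => ((hm n).sub (hm (ns k))).1) (u n - f)
      (by filter_upwards [hf] with x hx using tendsto_const_nhds.sub hx)
    refine h2.trans (liminf_le_of_frequently_le' (Eventually.frequently ?_))
    filter_upwards [hns.eventually_ge_atTop N] with k hk using hN n hn _ hk
  have hfm : AEStronglyMeasurable f μ :=
    aestronglyMeasurable_of_tendsto_ae atTop (fun k => (hm (ns k)).1) hf
  refine ⟨⟨hfm, ?_⟩, fun n => (hm n).1, ?_⟩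
  · obtain ⟨N, hN⟩ := h1 1 one_pos
    have e : f = u N - (u N - f) := by simp
    rw [e]
    exact (eLpNorm_sub_le (hm N).1 ((hm N).1.sub hfm) hp).trans_lt
      (ENNReal.add_lt_top.2 ⟨(hm N).2, (hN N le_rfl).trans_lt ENNReal.one_lt_top⟩)
  · rw [ENNReal.tendsto_atTop_zero]
    exact h1

theorem LpTendsto.exists_seq_tendsto_ae {u : ℕ → α → X} {f : α → X} (h : LpTendsto p μ u f)
    (hp : p ≠ 0) : ∃ ns : ℕ → ℕ, Tendsto ns atTop atTop ∧
      ∀ᵐ x ∂μ, Tendsto (fun k => u (ns k) x) atTop (𝓝 (f x)) := by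
  obtain ⟨ns, hns, h1⟩ := (tendstoInMeasure_of_tendsto_eLpNorm hp h.aestronglyMeasurable h.memLp.1
    h.tendsto).exists_seq_tendsto_ae
  exact ⟨ns, hns.tendsto_atTop, h1⟩

theorem ae_norm_le_of_eLpNorm_top_le {f : α → X} {C : ENNReal} (h : eLpNorm f ⊤ μ ≤ C) :
    ∀ᵐ x ∂μ, ‖f x‖ₑ ≤ C := by
  rw [eLpNorm_exponent_top] at h
  filter_upwards [enorm_ae_le_eLpNormEssSup f μ] with x hx using hx.trans h

variable [NormedSpace ℝ X]

/-- Eventually all values lie in the compact ball of radius ‖f‖_∞ + 1, on which F is bounded and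
uniformly continuous. -/
theorem LpTendsto.comp_continuous [FiniteDimensional ℝ X] {u : ℕ → α → X} {f : α → X}
    (h : LpTendsto ⊤ μ u f) {F : X → Y} (hF : Continuous F) :
    LpTendsto ⊤ μ (fun n x => F (u n x)) (fun x => F (f x)) := by
  have : ProperSpace X := FiniteDimensional.proper_real X
  have hfm : AEStronglyMeasurable (fun x => F (f x)) μ := hF.comp_aestronglyMeasurable h.memLp.1
  set M := (eLpNorm f ⊤ μ).toReal with hM
  have hfM : ∀ᵐ x ∂μ, ‖f x‖ ≤ M := by
    filter_upwards [ae_norm_le_of_eLpNorm_top_le (le_refl (eLpNorm f ⊤ μ))] with x hx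
    rw [hM, ← toReal_enorm]
    exact ENNReal.toReal_mono h.memLp.2.ne hx
  have hK : IsCompact (Metric.closedBall (0 : X) (M + 1)) := isCompact_closedBall _ _
  refine ⟨?_, fun n => hF.comp_aestronglyMeasurable (h.aestronglyMeasurable n), ?_⟩
  · obtain ⟨C, hC⟩ := hK.exists_bound_of_continuousOn hF.continuousOn
    refine memLp_top_of_bound hfm C ?_
    filter_upwards [hfM] with x hx
    refine hC _ (mem_closedBall_zero_iff.2 ?_)
    linarith
  · rw [ENNReal.tendsto_atTop_zero]
    intro ε hε
    obtain ⟨e, he0, heε⟩ : ∃ e : NNReal, 0 < e ∧ (e : ENNReal) ≤ ε := by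
      obtain ⟨e, he, h'⟩ := ENNReal.lt_iff_exists_nnreal_btwn.1 hε
      exact ⟨e, by simpa using he, h'.le⟩
    obtain ⟨δ, hδ, hδ'⟩ := Metric.uniformContinuousOn_iff.1
      (hK.uniformContinuousOn_of_continuous hF.continuousOn) e (by exact_mod_cast he0)
    have hδ1 : 0 < min δ 1 / 2 := by positivity
    obtain ⟨N, hN⟩ := ENNReal.tendsto_atTop_zero.1 h.tendsto (ENNReal.ofReal (min δ 1 / 2))
      (by simpa using hδ1)
    refine ⟨N, fun n hn => le_trans ?_ heε⟩
    rw [eLpNorm_exponent_top]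
    refine eLpNormEssSup_le_of_ae_enorm_bound ?_
    filter_upwards [hfM, ae_norm_le_of_eLpNorm_top_le (hN n hn)] with x hx hx'
    have h1 : ‖u n x - f x‖ ≤ min δ 1 / 2 := by
      rw [Pi.sub_apply, ← ofReal_norm] at hx'
      exact (ENNReal.ofReal_le_ofReal_iff hδ1.le).1 hx'
    have h2 : ‖u n x - f x‖ < δ := by linarith [min_le_left δ 1]
    have h3 : ‖u n x‖ ≤ M + 1 := by
      have := norm_le_norm_add_norm_sub' (u n x) (f x)
      linarith [min_le_right δ 1]
    have h4 := hδ' (u n x) (mem_closedBall_zero_iff.2 h3) (f x)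
      (mem_closedBall_zero_iff.2 (by linarith)) (by rwa [dist_eq_norm])
    rw [dist_eq_norm] at h4
    rw [Pi.sub_apply, enorm_le_coe]
    exact h4.le

variable [NormedSpace ℝ Y] [NormedSpace ℝ Z]

theorem LpTendsto.clm {u : ℕ → α → X} {f : α → X} (h : LpTendsto p μ u f) (T : X →L[ℝ] Y) :
    LpTendsto p μ (fun n x => T (u n x)) (fun x => T (f x)) where
  memLp := T.comp_memLp' h.memLp
  aestronglyMeasurable n := T.continuous.comp_aestronglyMeasurable (h.aestronglyMeasurable n)
  tendsto := by
    have h1 := ENNReal.Tendsto.const_mul (a := ENNReal.ofReal ‖T‖) h.tendsto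
      (Or.inr ENNReal.ofReal_ne_top)
    rw [mul_zero] at h1
    refine tendsto_zero_of_le h1 fun n => eLpNorm_le_mul_eLpNorm_of_ae_le_mul (.of_forall fun x => ?_) p
    simp only [Pi.sub_apply, ← map_sub]
    exact T.le_opNorm _

theorem LpTendsto.bilin [ENNReal.HolderTriple p q r] (hr : 1 ≤ r) (B : X →L[ℝ] Y →L[ℝ] Z)
    {u : ℕ → α → X} {f : α → X} {v : ℕ → α → Y} {g : α → Y} (hu : LpTendsto p μ u f)
    (hv : LpTendsto q μ v g) : LpTendsto r μ (fun n x => B (u n x) (v n x))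
      (fun x => B (f x) (g x)) := by
  have hm : ∀ {a : α → X} {b : α → Y}, AEStronglyMeasurable a μ → AEStronglyMeasurable b μ →
      AEStronglyMeasurable (fun x => B (a x) (b x)) μ := fun ha hb =>
    B.aestronglyMeasurable_comp₂ ha hb
  have hb : ∀ {a : α → X} {b : α → Y}, AEStronglyMeasurable a μ → AEStronglyMeasurable b μ →
      eLpNorm (fun x => B (a x) (b x)) r μ ≤ ‖B‖₊ * eLpNorm a p μ * eLpNorm b q μ := fun ha hb =>
    eLpNorm_le_eLpNorm_mul_eLpNorm_of_nnnorm ha hb (fun x y => B x y) ‖B‖₊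
      (.of_forall fun x => B.le_opNorm₂ _ _)
  have hfg : MemLp (fun x => B (f x) (g x)) r μ := ⟨hm hu.memLp.1 hv.memLp.1,
    (hb hu.memLp.1 hv.memLp.1).trans_lt (ENNReal.mul_lt_top (ENNReal.mul_lt_top
      ENNReal.coe_lt_top hu.memLp.2) hv.memLp.2)⟩
  refine ⟨hfg, fun n => hm (hu.aestronglyMeasurable n) (hv.aestronglyMeasurable n), ?_⟩
  have mu : ∀ n, AEStronglyMeasurable (u n - f) μ := fun n =>
    (hu.aestronglyMeasurable n).sub hu.memLp.1
  have mv : ∀ n, AEStronglyMeasurable (v n - g) μ := fun n =>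
    (hv.aestronglyMeasurable n).sub hv.memLp.1
  have c0 : ((‖B‖₊ : NNReal) : ENNReal) ≠ ⊤ := ENNReal.coe_ne_top
  have l1 := ENNReal.Tendsto.mul (ENNReal.Tendsto.const_mul (a := (‖B‖₊ : ENNReal)) hu.tendsto
    (Or.inr c0)) (Or.inr (by simp)) hv.tendsto (Or.inr (by simp))
  have l2 := ENNReal.Tendsto.mul_const (b := eLpNorm g q μ) (ENNReal.Tendsto.const_mul
    (a := (‖B‖₊ : ENNReal)) hu.tendsto (Or.inr c0)) (Or.inr hv.memLp.2.ne)
  have l3 := ENNReal.Tendsto.const_mul (a := (‖B‖₊ : ENNReal) * eLpNorm f p μ) hv.tendsto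
    (Or.inr (ENNReal.mul_ne_top c0 hu.memLp.2.ne))
  have l := (l1.add l2).add l3
  simp only [mul_zero, zero_mul, add_zero] at l
  refine tendsto_zero_of_le l fun n => ?_
  have e : (fun x => B (u n x) (v n x)) - (fun x => B (f x) (g x)) =
      ((fun x => B ((u n - f) x) ((v n - g) x)) + fun x => B ((u n - f) x) (g x)) +
        fun x => B (f x) ((v n - g) x) := by
    funext x
    simp only [Pi.sub_apply, Pi.add_apply, map_sub, sub_apply]
    abel
  rw [e]
  refine (eLpNorm_add_le ((hm (mu n) (mv n)).add (hm (mu n) hv.memLp.1))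
    (hm hu.memLp.1 (mv n)) hr).trans (add_le_add ?_ (hb hu.memLp.1 (mv n)))
  exact (eLpNorm_add_le (hm (mu n) (mv n)) (hm (mu n) hv.memLp.1) hr).trans
    (add_le_add (hb (mu n) (mv n)) (hb (mu n) hv.memLp.1))

theorem LpTendsto.integral_smul [IsFiniteMeasure μ] {u : ℕ → α → X} {f : α → X} (hp : 1 ≤ p)
    (h : LpTendsto p μ u f) {c : α → ℝ} {C : ℝ} (hcm : AEStronglyMeasurable c μ)
    (hc : ∀ᵐ x ∂μ, |c x| ≤ C) :
    Tendsto (fun n => ∫ x, c x • u n x ∂μ) atTop (𝓝 (∫ x, c x • f x ∂μ)) := by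
  have h1 := h.mono_exponent hp
  have hcM : MemLp c ⊤ μ := memLp_top_of_bound hcm C hc
  have h2 : LpTendsto ⊤ μ (fun _ : ℕ => c) c := ⟨hcM, fun _ => hcm, by simp⟩
  have h3 := h2.bilin le_rfl (ContinuousLinearMap.lsmul ℝ ℝ (E := X)) h1
  have hev : ∀ᶠ n in atTop, eLpNorm ((fun x => c x • u n x) - fun x => c x • f x) 1 μ < 1 :=
    h3.tendsto.eventually (gt_mem_nhds one_pos)
  refine tendsto_integral_of_L1' _ h3.memLp.1 ?_ h3.tendsto
  filter_upwards [hev] with n hn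
  have h4 : MemLp ((fun x => c x • u n x) - fun x => c x • f x) 1 μ :=
    ⟨(h3.aestronglyMeasurable n).sub h3.memLp.1, hn.trans ENNReal.one_lt_top⟩
  have h5 := h4.add h3.memLp
  rw [memLp_one_iff_integrable] at h5
  refine h5.congr (.of_forall fun x => ?_)
  simp

end

/-! ### Calculus of functions that are approximated by smooth functions -/

section

variable {Ω : Set (Euc 3)} {p q : ENNReal}
  {X Y Z : Type} [NormedAddCommGroup X] [NormedSpace ℝ X] [NormedAddCommGroup Y] [NormedSpace ℝ Y]
  [NormedAddCommGroup Z] [NormedSpace ℝ Z]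

theorem IsBoundedSmoothDomain.isFiniteMeasure (hΩ : IsBoundedSmoothDomain Ω) :
    IsFiniteMeasure (volume.restrict Ω) :=
  ⟨by simpa using hΩ.isBounded.measure_lt_top⟩

instance : ENNReal.HolderTriple 4 4 2 where
  inv_add_inv_eq_inv := by
    have h : (4 : ENNReal) = 2 * 2 := by norm_num
    rw [h, ENNReal.mul_inv (by simp) (by simp), ← mul_add, ENNReal.inv_two_add_inv_two, mul_one]

theorem continuous_partial {φ : Euc 3 → X} (hφ : ContDiff ℝ ∞ φ) (a : Fin 3) :
    Continuous fun x => fderiv ℝ φ x (basisVec a) :=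
  (contDiff_fderiv_infty hφ).continuous.clm_apply continuous_const

theorem SmoothApprox.lpTendsto {f : Euc 3 → X} {G : Fin 3 → Euc 3 → X} {φ : ℕ → Euc 3 → X}
    (h : SmoothApprox Ω p f G φ) : LpTendsto p (volume.restrict Ω) φ f :=
  ⟨h.memLp, fun n => (h.contDiff n).continuous.aestronglyMeasurable, h.tendsto⟩

theorem SmoothApprox.lpTendsto_partial {f : Euc 3 → X} {G : Fin 3 → Euc 3 → X}
    {φ : ℕ → Euc 3 → X} (h : SmoothApprox Ω p f G φ) (a : Fin 3) :
    LpTendsto p (volume.restrict Ω) (fun n x => fderiv ℝ (φ n) x (basisVec a)) (G a) :=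
  ⟨h.memLp_partial a, fun n => (continuous_partial (h.contDiff n) a).aestronglyMeasurable,
    h.tendsto_partial a⟩

theorem SmoothApprox.of_lpTendsto {f : Euc 3 → X} {G : Fin 3 → Euc 3 → X} {φ : ℕ → Euc 3 → X}
    (hφ : ∀ n, ContDiff ℝ ∞ (φ n)) (h : LpTendsto p (volume.restrict Ω) φ f)
    (h' : ∀ a, LpTendsto p (volume.restrict Ω) (fun n x => fderiv ℝ (φ n) x (basisVec a)) (G a)) :
    SmoothApprox Ω p f G φ :=
  ⟨h.memLp, fun a => (h' a).memLp, hφ, h.tendsto, fun a => (h' a).tendsto⟩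

theorem SmoothApprox.congr {f f' : Euc 3 → X} {G G' : Fin 3 → Euc 3 → X} {φ : ℕ → Euc 3 → X}
    (h : SmoothApprox Ω p f G φ) (hf : f =ᵐ[volume.restrict Ω] f')
    (hG : ∀ a, G a =ᵐ[volume.restrict Ω] G' a) : SmoothApprox Ω p f' G' φ :=
  .of_lpTendsto h.contDiff (h.lpTendsto.congr (fun _ => .rfl) hf)
    fun a => (h.lpTendsto_partial a).congr (fun _ => .rfl) (hG a)

theorem SmoothApprox.mono_exponent (hΩ : IsBoundedSmoothDomain Ω) {f : Euc 3 → X}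
    {G : Fin 3 → Euc 3 → X} {φ : ℕ → Euc 3 → X} (h : SmoothApprox Ω q f G φ) (hpq : p ≤ q) :
    SmoothApprox Ω p f G φ :=
  have := hΩ.isFiniteMeasure
  .of_lpTendsto h.contDiff (h.lpTendsto.mono_exponent hpq)
    fun a => (h.lpTendsto_partial a).mono_exponent hpq

theorem SmoothApprox.add (hp : 1 ≤ p) {f g : Euc 3 → X} {F G : Fin 3 → Euc 3 → X}
    {φ ψ : ℕ → Euc 3 → X} (hf : SmoothApprox Ω p f F φ) (hg : SmoothApprox Ω p g G ψ) :
    SmoothApprox Ω p (fun x => f x + g x) (fun a x => F a x + G a x) (fun n x => φ n x + ψ n x) :=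
  .of_lpTendsto (fun n => (hf.contDiff n).add (hg.contDiff n)) (hf.lpTendsto.add hp hg.lpTendsto)
    fun a => ((hf.lpTendsto_partial a).add hp (hg.lpTendsto_partial a)).congr
      (fun n => .of_forall fun x => by
        beta_reduce
        rw [fderiv_fun_add ((hf.contDiff n).differentiable (by simp) x)
          ((hg.contDiff n).differentiable (by simp) x), add_apply]) .rfl

theorem SmoothApprox.clm {f : Euc 3 → X} {G : Fin 3 → Euc 3 → X} {φ : ℕ → Euc 3 → X}
    (h : SmoothApprox Ω p f G φ) (T : X →L[ℝ] Y) :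
    SmoothApprox Ω p (fun x => T (f x)) (fun a x => T (G a x)) (fun n x => T (φ n x)) :=
  .of_lpTendsto (fun n => T.contDiff.comp (h.contDiff n)) (h.lpTendsto.clm T)
    fun a => ((h.lpTendsto_partial a).clm T).congr
      (fun n => .of_forall fun x => by
        have h1 := (T.hasFDerivAt (x := φ n x)).comp x
          ((h.contDiff n).differentiable (by simp) x).hasFDerivAt
        have h2 : fderiv ℝ (fun x => T (φ n x)) x = _ := h1.fderiv
        beta_reduce
        rw [h2]
        rfl) .rfl

/-- Integration by parts for the smooth approximations, passed to the limit. -/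
theorem SmoothApprox.hasWeakPartial [CompleteSpace X] (hΩ : IsBoundedSmoothDomain Ω) (hp : 1 ≤ p)
    {f : Euc 3 → X} {G : Fin 3 → Euc 3 → X} {φ : ℕ → Euc 3 → X} (h : SmoothApprox Ω p f G φ)
    (a : Fin 3) : HasWeakPartial Ω a f (G a) := by
  have := hΩ.isFiniteMeasure
  have hm := hΩ.isOpen.measurableSet
  have hloc : ∀ {u : Euc 3 → X}, MemLp u p (volume.restrict Ω) → LocallyIntegrableOn u Ω :=
    fun hu => IntegrableOn.locallyIntegrableOn (hu.integrable hp)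
  refine ⟨hloc h.memLp, hloc (h.memLp_partial a), fun c hc hcc hcs => ?_⟩
  obtain ⟨C, hC⟩ := hcc.exists_bound_of_continuous hc.continuous
  have hd := continuous_partial hc a
  have hdc : HasCompactSupport fun x => fderiv ℝ c x (basisVec a) := hcc.fderiv_apply ℝ (basisVec a)
  obtain ⟨D, hD⟩ := hdc.exists_bound_of_continuous hd
  have l1 := h.lpTendsto.integral_smul hp (c := fun x => fderiv ℝ c x (basisVec a)) (C := D)
    hd.aestronglyMeasurable (.of_forall hD)
  have l2 := (h.lpTendsto_partial a).integral_smul hp hc.continuous.aestronglyMeasurable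
    (.of_forall hC)
  refine tendsto_nhds_unique l1 (l2.neg.congr fun n => ?_)
  have hφ := h.contDiff n
  have z1 : ∀ x, x ∉ Ω → c x = 0 := fun x hx => image_eq_zero_of_notMem_tsupport fun h' => hx (hcs h')
  have z2 : ∀ x, x ∉ Ω → fderiv ℝ c x (basisVec a) = 0 := fun x hx => by
    have : fderiv ℝ c x = 0 := image_eq_zero_of_notMem_tsupport
      fun h' => hx (hcs (tsupport_fderiv_subset ℝ h'))
    rw [this, zero_apply]
  have e1 : (∫ x in Ω, c x • fderiv ℝ (φ n) x (basisVec a)) =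
      ∫ x, c x • fderiv ℝ (φ n) x (basisVec a) :=
    setIntegral_eq_integral_of_forall_compl_eq_zero fun x hx => by rw [z1 x hx, zero_smul]
  have e2 : (∫ x in Ω, fderiv ℝ c x (basisVec a) • φ n x) =
      ∫ x, fderiv ℝ c x (basisVec a) • φ n x :=
    setIntegral_eq_integral_of_forall_compl_eq_zero fun x hx => by rw [z2 x hx, zero_smul]
  rw [e1, e2, integral_smul_fderiv_eq_neg_fderiv_smul_of_integrable, neg_neg]
  · exact (hd.smul hφ.continuous).integrable_of_hasCompactSupport hdc.smul_right
  · exact (hc.continuous.smul (continuous_partial hφ a)).integrable_of_hasCompactSupport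
      hcc.smul_right
  · exact (hc.continuous.smul hφ.continuous).integrable_of_hasCompactSupport hcc.smul_right
  · exact fun x _ => hc.differentiable (by simp) x
  · exact fun x _ => hφ.differentiable (by simp) x

theorem HasWeakPartial.congr {a : Fin 3} {f f' g g' : Euc 3 → X}
    (h : HasWeakPartial Ω a f g) (hf : f =ᵐ[volume.restrict Ω] f') (hg : g =ᵐ[volume.restrict Ω] g') :
    HasWeakPartial Ω a f' g' := by
  have hl : ∀ {u v : Euc 3 → X}, u =ᵐ[volume.restrict Ω] v → LocallyIntegrableOn u Ω →
      LocallyIntegrableOn v Ω := fun huv hu x hx => by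
    obtain ⟨s, hs, hi⟩ := hu x hx
    refine ⟨s ∩ Ω, inter_mem hs self_mem_nhdsWithin, (hi.mono_set Set.inter_subset_left).congr ?_⟩
    exact ae_restrict_of_ae_restrict_of_subset Set.inter_subset_right huv
  refine ⟨hl hf h.1, hl hg h.2.1, fun φ hφ hc hs => ?_⟩
  rw [← integral_congr_ae (hf.mono fun x hx => show fderiv ℝ φ x (basisVec a) • f x = _ by rw [hx]),
    ← integral_congr_ae (hg.mono fun x hx => show φ x • g x = φ x • g' x by rw [hx])]
  exact h.2.2 φ hφ hc hs

theorem HasWeakPartial.ae_eq [CompleteSpace X] {a : Fin 3} {f g g' : Euc 3 → X} (hΩ : IsOpen Ω)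
    (h : HasWeakPartial Ω a f g) (h' : HasWeakPartial Ω a f g') :
    g =ᵐ[volume.restrict Ω] g' := by
  have h1 := hΩ.ae_eq_zero_of_integral_contDiff_smul_eq_zero (h.2.1.sub h'.2.1) (μ := volume)
    fun φ hφ hc hs => by
      have hi : ∀ {u : Euc 3 → X}, LocallyIntegrableOn u Ω →
          Integrable (fun x => φ x • u x) (volume.restrict Ω) := fun {u} hu => by
        have hK : IntegrableOn u (tsupport φ) := hu.integrableOn_compact_subset hs hc
        have h2 : IntegrableOn (fun x => φ x • u x) (tsupport φ) :=
          hK.continuousOn_smul hφ.continuous.continuousOn hc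
        refine (IntegrableOn.integrable_of_forall_notMem_eq_zero h2 fun x hx => ?_).restrict
        rw [image_eq_zero_of_notMem_tsupport hx, zero_smul]
      have e : (∫ x, φ x • (g - g') x) = ∫ x in Ω, φ x • (g - g') x := by
        refine (setIntegral_eq_integral_of_forall_compl_eq_zero fun x hx => ?_).symm
        rw [image_eq_zero_of_notMem_tsupport fun h' => hx (hs h'), zero_smul]
      rw [e]
      simp only [Pi.sub_apply, smul_sub]
      rw [integral_sub (hi h.2.1) (hi h'.2.1), sub_eq_zero, ← neg_inj,
        ← h.2.2 φ hφ hc hs, ← h'.2.2 φ hφ hc hs]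
  rw [EventuallyEq, ae_restrict_iff' hΩ.measurableSet]
  filter_upwards [h1] with x hx hxΩ
  exact sub_eq_zero.1 (hx hxΩ)

theorem memLp_of_continuous (hΩ : IsBoundedSmoothDomain Ω) {Y : Type} [NormedAddCommGroup Y]
    {φ : Euc 3 → Y} (hφ : Continuous φ) :
    MemLp φ p (volume.restrict Ω) := by
  have := hΩ.isFiniteMeasure
  obtain ⟨C, hC⟩ := exists_bound_of_continuous hΩ hφ
  exact .of_bound hφ.aestronglyMeasurable C
    (ae_restrict_of_forall_mem hΩ.isOpen.measurableSet fun x hx => hC x (subset_closure hx))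

theorem SmoothApprox.exists_cauchy {f : Euc 3 → X} {G : Fin 3 → Euc 3 → X} {φ : ℕ → Euc 3 → X}
    (h : SmoothApprox Ω p f G φ) (hp : 1 ≤ p) {C : ENNReal} (hC : C ≠ ⊤) {ε : ENNReal}
    (hε : 0 < ε) : ∃ N, ∀ n ≥ N, ∀ m ≥ N, C * (eLpNorm (φ n - φ m) p (volume.restrict Ω) +
      ∑ a : Fin 3, eLpNorm (fun x => fderiv ℝ (φ n - φ m) x (basisVec a)) p
        (volume.restrict Ω)) ≤ ε := by
  set μ := volume.restrict Ω
  set b : ℕ → ENNReal := fun n => eLpNorm (φ n - f) p μ +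
    ∑ a : Fin 3, eLpNorm ((fun x => fderiv ℝ (φ n) x (basisVec a)) - G a) p μ with hb
  have hb0 : Tendsto b atTop (𝓝 0) := by
    have := h.tendsto.add (tendsto_finsetSum (Finset.univ : Finset (Fin 3))
      fun a _ => h.tendsto_partial a)
    simpa using this
  have hCb : Tendsto (fun p : ℕ × ℕ => C * (b p.1 + b p.2)) atTop (𝓝 0) := by
    rw [← prod_atTop_atTop_eq]
    have := ENNReal.Tendsto.const_mul (a := C) ((hb0.comp tendsto_fst).add (hb0.comp tendsto_snd))
      (Or.inr hC)
    simpa using this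
  obtain ⟨N, hN⟩ := eventually_atTop.1 (hCb.eventually (ge_mem_nhds hε))
  refine ⟨max N.1 N.2, fun n hn m hm => le_trans ?_
    (hN (n, m) ⟨(le_max_left _ _).trans hn, (le_max_right _ _).trans hm⟩)⟩
  have hmf := fun n => (h.lpTendsto.aestronglyMeasurable n).sub h.memLp.1
  have hmG := fun a n => ((h.lpTendsto_partial a).aestronglyMeasurable n).sub (h.memLp_partial a).1
  refine mul_le_mul_right ?_ _
  have e1 : φ n - φ m = (φ n - f) - (φ m - f) := by simp
  have e2 : ∀ a, (fun x => fderiv ℝ (φ n - φ m) x (basisVec a)) =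
      ((fun x => fderiv ℝ (φ n) x (basisVec a)) - G a) -
        ((fun x => fderiv ℝ (φ m) x (basisVec a)) - G a) := fun a => by
    funext x
    rw [fderiv_sub ((h.contDiff n).differentiable (by simp) x)
      ((h.contDiff m).differentiable (by simp) x)]
    simp
  have i1 : eLpNorm (φ n - φ m) p μ ≤ eLpNorm (φ n - f) p μ + eLpNorm (φ m - f) p μ := by
    rw [e1]
    exact eLpNorm_sub_le (hmf n) (hmf m) hp
  have i2 := Finset.sum_le_sum fun (a : Fin 3) (_ : a ∈ Finset.univ) => show
      eLpNorm (fun x => fderiv ℝ (φ n - φ m) x (basisVec a)) p μ ≤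
        eLpNorm ((fun x => fderiv ℝ (φ n) x (basisVec a)) - G a) p μ +
          eLpNorm ((fun x => fderiv ℝ (φ m) x (basisVec a)) - G a) p μ by
    rw [e2]
    exact eLpNorm_sub_le (hmG a n) (hmG a m) hp
  rw [Finset.sum_add_distrib] at i2
  refine (add_le_add i1 i2).trans (le_of_eq ?_)
  simp only [hb]
  abel

/-- The Sobolev inequality for φ_n - φ_m makes the sequence Cauchy in L⁴; an almost everywhere
convergent subsequence identifies the limit as f. -/
theorem SmoothApprox.lpTendsto_four (hΩ : IsBoundedSmoothDomain Ω) {f : Euc 3 → X}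
    {G : Fin 3 → Euc 3 → X} {φ : ℕ → Euc 3 → X} (h : SmoothApprox Ω 2 f G φ) :
    LpTendsto 4 (volume.restrict Ω) φ f := by
  obtain ⟨C, hC, hI⟩ := exists_eLpNorm_four_le_eLpNorm_two hΩ
  obtain ⟨ns, hns, hae⟩ := h.lpTendsto.exists_seq_tendsto_ae (by simp)
  refine .of_cauchy (fun n => memLp_of_continuous hΩ (h.contDiff n).continuous) (by norm_num) hns hae
    fun ε hε => ?_
  obtain ⟨N, hN⟩ := h.exists_cauchy (by norm_num) hC hε
  exact ⟨N, fun n hn m hm => (hI _ ((h.contDiff n).sub (h.contDiff m))).trans (hN n hn m hm)⟩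

/-- The pointwise bound on Ω extends to the closure by continuity of φ_n - φ_m. This is how
information reaches ∂Ω. -/
theorem SmoothApprox.exists_uniform_cauchy (hΩ : IsBoundedSmoothDomain Ω) {f : Euc 3 → X}
    {G : Fin 3 → Euc 3 → X} {φ : ℕ → Euc 3 → X} (h : SmoothApprox Ω 4 f G φ) {ε : ENNReal}
    (hε : 0 < ε) : ∃ N, ∀ n ≥ N, ∀ m ≥ N, ∀ z ∈ closure Ω, ‖φ n z - φ m z‖ₑ ≤ ε := by
  obtain ⟨C, hC, hI⟩ := exists_enorm_le_eLpNorm_four hΩ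
  obtain ⟨N, hN⟩ := h.exists_cauchy (by norm_num) hC hε
  refine ⟨N, fun n hn m hm => ?_⟩
  have hcl : IsClosed {z | ‖φ n z - φ m z‖ₑ ≤ ε} :=
    isClosed_le ((h.contDiff n).continuous.sub (h.contDiff m).continuous).enorm continuous_const
  exact closure_minimal
    (fun z hz => (hI _ ((h.contDiff n).sub (h.contDiff m)) z hz).trans (hN n hn m hm)) hcl

theorem SmoothApprox.lpTendsto_top (hΩ : IsBoundedSmoothDomain Ω) {f : Euc 3 → X}
    {G : Fin 3 → Euc 3 → X} {φ : ℕ → Euc 3 → X} (h : SmoothApprox Ω 4 f G φ) :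
    LpTendsto ⊤ (volume.restrict Ω) φ f := by
  obtain ⟨ns, hns, hae⟩ := h.lpTendsto.exists_seq_tendsto_ae (by simp)
  refine .of_cauchy (fun n => memLp_of_continuous hΩ (h.contDiff n).continuous) (by norm_num) hns hae
    fun ε hε => ?_
  obtain ⟨N, hN⟩ := h.exists_uniform_cauchy hΩ hε
  refine ⟨N, fun n hn m hm => ?_⟩
  rw [eLpNorm_exponent_top]
  exact eLpNormEssSup_le_of_ae_enorm_bound (ae_restrict_of_forall_mem hΩ.isOpen.measurableSet
    fun z hz => hN n hn m hm z (subset_closure hz))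

/-- The approximations converge uniformly on the closure of Ω. A function in W^{1,4} thus gets a
bounded trace, attained along the given sequence, so that it can be combined with other traces by
multiplying sequences. -/
theorem SmoothApprox.exists_lpTendsto_surface [CompleteSpace X] (hΩ : IsBoundedSmoothDomain Ω)
    {f : Euc 3 → X} {G : Fin 3 → Euc 3 → X} {φ : ℕ → Euc 3 → X} (h : SmoothApprox Ω 4 f G φ) :
    ∃ f₀, LpTendsto ⊤ (surfaceMeasure Ω) φ f₀ := by
  have hS : ∀ᵐ z ∂(surfaceMeasure Ω), z ∈ closure Ω :=
    ae_restrict_of_forall_mem isClosed_frontier.measurableSet fun z hz => frontier_subset_closure hz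
  have hlim : ∀ z ∈ closure Ω, ∃ y, Tendsto (fun n => φ n z) atTop (𝓝 y) := fun z hz => by
    refine cauchySeq_tendsto_of_complete (EMetric.cauchySeq_iff.2 fun ε hε => ?_)
    obtain ⟨e, he, he'⟩ := exists_between hε
    obtain ⟨N, hN⟩ := h.exists_uniform_cauchy hΩ he
    exact ⟨N, fun m hm n hn => by
      rw [edist_eq_enorm_sub]
      exact (hN m hm n hn z hz).trans_lt he'⟩
  choose! f₀ hf₀ using hlim
  refine ⟨f₀, .of_cauchy (fun n => ?_) (by norm_num) tendsto_id (hS.mono hf₀) fun ε hε => ?_⟩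
  · obtain ⟨C, hC⟩ := exists_bound_of_continuous hΩ (h.contDiff n).continuous
    exact memLp_top_of_bound (h.contDiff n).continuous.aestronglyMeasurable C (hS.mono hC)
  · obtain ⟨N, hN⟩ := h.exists_uniform_cauchy hΩ hε
    refine ⟨N, fun n hn m hm => ?_⟩
    rw [eLpNorm_exponent_top]
    exact eLpNormEssSup_le_of_ae_enorm_bound (hS.mono fun z hz => hN n hn m hm z hz)

/-- The chain rule. -/
theorem SmoothApprox.comp [FiniteDimensional ℝ X] (hΩ : IsBoundedSmoothDomain Ω) {f : Euc 3 → X}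
    {G : Fin 3 → Euc 3 → X} {φ : ℕ → Euc 3 → X} (h : SmoothApprox Ω 4 f G φ) {F : X → Y}
    (hF : ContDiff ℝ ∞ F) : SmoothApprox Ω 4 (fun x => F (f x))
      (fun a x => fderiv ℝ F (f x) (G a x)) (fun n x => F (φ n x)) := by
  have := hΩ.isFiniteMeasure
  have hu := h.lpTendsto_top hΩ
  refine .of_lpTendsto (fun n => hF.comp (h.contDiff n))
    ((hu.comp_continuous hF.continuous).mono_exponent le_top) fun a => ?_
  have h1 := (hu.comp_continuous (contDiff_fderiv_infty hF).continuous).bilin (r := 4) (by norm_num)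
    (ContinuousLinearMap.id ℝ (X →L[ℝ] Y)) (h.lpTendsto_partial a)
  refine h1.congr (fun n => .of_forall fun x => ?_) .rfl
  have h2 := (hF.differentiable (by simp) (φ n x)).hasFDerivAt.comp x
    ((h.contDiff n).differentiable (by simp) x).hasFDerivAt
  have h3 : fderiv ℝ (fun x => F (φ n x)) x = _ := h2.fderiv
  beta_reduce
  rw [h3]
  rfl

/-- The product rule. -/
theorem SmoothApprox.bilin (hΩ : IsBoundedSmoothDomain Ω) {f : Euc 3 → X}
    {F : Fin 3 → Euc 3 → X} {φ : ℕ → Euc 3 → X} {g : Euc 3 → Y} {G : Fin 3 → Euc 3 → Y}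
    {ψ : ℕ → Euc 3 → Y} (hf : SmoothApprox Ω 4 f F φ) (hg : SmoothApprox Ω 2 g G ψ)
    (B : X →L[ℝ] Y →L[ℝ] Z) : SmoothApprox Ω 2 (fun x => B (f x) (g x))
      (fun a x => B (f x) (G a x) + B (F a x) (g x)) (fun n x => B (φ n x) (ψ n x)) := by
  refine .of_lpTendsto (fun n => (B.contDiff.comp (hf.contDiff n)).clm_apply (hg.contDiff n))
    ((hf.lpTendsto_top hΩ).bilin (by norm_num) B hg.lpTendsto) fun a => ?_
  -- The two halves of the product rule converge in L² as L^∞·L² and as L⁴·L⁴.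
  have h1 := (hf.lpTendsto_top hΩ).bilin (r := 2) (by norm_num) B (hg.lpTendsto_partial a)
  have h2 := (hf.lpTendsto_partial a).bilin (r := 2) (by norm_num) B (hg.lpTendsto_four hΩ)
  refine (h1.add (by norm_num) h2).congr (fun n => .of_forall fun x => ?_) .rfl
  have h3 := B.hasFDerivAt_of_bilinear ((hf.contDiff n).differentiable (by simp) x).hasFDerivAt
    ((hg.contDiff n).differentiable (by simp) x).hasFDerivAt
  beta_reduce
  rw [h3.fderiv]
  simp [ContinuousLinearMap.precompR_apply, ContinuousLinearMap.precompL_apply]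

end

/-! ### Sobolev spaces of functions with values in a normed space -/

section

variable {Ω : Set (Euc 3)}

/-- `f ∈ W^{n,2}(Ω, X)`. -/
def Sob {X : Type} [NormedAddCommGroup X] [NormedSpace ℝ X] (Ω : Set (Euc 3)) :
    ℕ → (Euc 3 → X) → Prop
  | 0, f => MemLp f 2 (volume.restrict Ω)
  | n + 1, f => MemLp f 2 (volume.restrict Ω) ∧
      ∀ a : Fin 3, ∃ g, HasWeakPartial Ω a f g ∧ Sob Ω n g

theorem memSobolev_iff_sob {K : ℕ} : ∀ (n : ℕ) (f : Euc 3 → Euc K), MemSobolev Ω n f ↔ Sob Ω n f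
  | 0, _ => Iff.rfl
  | n + 1, _ => and_congr Iff.rfl <| forall_congr' fun _ => exists_congr fun g =>
      and_congr isWeakPartial_iff (memSobolev_iff_sob n g)

variable {X Y : Type} [NormedAddCommGroup X] [NormedSpace ℝ X] [NormedAddCommGroup Y]
  [NormedSpace ℝ Y]

theorem Sob.memLp {f : Euc 3 → X} : ∀ {n : ℕ}, Sob Ω n f → MemLp f 2 (volume.restrict Ω)
  | 0, h => h
  | _ + 1, h => h.1

theorem Sob.congr {n : ℕ} {f f' : Euc 3 → X} (h : Sob Ω n f) (hf : f =ᵐ[volume.restrict Ω] f') :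
    Sob Ω n f' := by
  cases n with
  | zero => exact (memLp_congr_ae hf).1 h
  | succ n =>
    refine ⟨(memLp_congr_ae hf).1 h.1, fun a => ?_⟩
    obtain ⟨g, hg, hgn⟩ := h.2 a
    exact ⟨g, hg.congr hf .rfl, hgn⟩

theorem Sob.of_succ : ∀ {n : ℕ} {f : Euc 3 → X}, Sob Ω (n + 1) f → Sob Ω n f
  | 0, _, h => h.1
  | _ + 1, _, h => ⟨h.1, fun a => let ⟨g, hg, hgn⟩ := h.2 a; ⟨g, hg, hgn.of_succ⟩⟩

theorem Sob.mono {m n : ℕ} (hmn : m ≤ n) {f : Euc 3 → X} (h : Sob Ω n f) : Sob Ω m f := by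
  induction hmn with
  | refl => exact h
  | step _ ih => exact ih h.of_succ

/-- By density, sums, linear images, products and compositions can all be treated on smooth
approximations rather than through test functions. -/
theorem sob_succ_iff [CompleteSpace X] (hΩ : IsBoundedSmoothDomain Ω) {n : ℕ} {f : Euc 3 → X} :
    Sob Ω (n + 1) f ↔ ∃ G φ, SmoothApprox Ω 2 f G φ ∧ ∀ a, Sob Ω n (G a) := by
  constructor
  · rintro ⟨hf, hG⟩
    choose G hG hGn using hG
    obtain ⟨φ, hφ⟩ := exists_smoothApprox hΩ (by norm_num) (by simp) hf (fun a => (hGn a).memLp) hG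
    exact ⟨G, φ, hφ, hGn⟩
  · rintro ⟨G, φ, h, hGn⟩
    exact ⟨h.memLp, fun a => ⟨G a, h.hasWeakPartial hΩ (by norm_num) a, hGn a⟩⟩

theorem Sob.add [CompleteSpace X] (hΩ : IsBoundedSmoothDomain Ω) {n : ℕ} {f g : Euc 3 → X}
    (hf : Sob Ω n f) (hg : Sob Ω n g) : Sob Ω n (fun x => f x + g x) := by
  induction n generalizing f g with
  | zero => exact MemLp.add hf hg
  | succ n ih =>
    obtain ⟨F, φ, hφ, hF⟩ := (sob_succ_iff hΩ).1 hf
    obtain ⟨G, ψ, hψ, hG⟩ := (sob_succ_iff hΩ).1 hg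
    exact (sob_succ_iff hΩ).2 ⟨_, _, hφ.add (by norm_num) hψ, fun a => ih (hF a) (hG a)⟩

theorem Sob.clm [CompleteSpace X] [CompleteSpace Y] (hΩ : IsBoundedSmoothDomain Ω) {n : ℕ}
    {f : Euc 3 → X} (hf : Sob Ω n f) (T : X →L[ℝ] Y) : Sob Ω n (fun x => T (f x)) := by
  induction n generalizing f with
  | zero => exact T.comp_memLp' hf
  | succ n ih =>
    obtain ⟨F, φ, hφ, hF⟩ := (sob_succ_iff hΩ).1 hf
    exact (sob_succ_iff hΩ).2 ⟨_, _, hφ.clm T, fun a => ih (hF a)⟩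

theorem sob_zero (n : ℕ) : Sob Ω n (fun _ => (0 : X)) := by
  induction n with
  | zero => exact MemLp.zero
  | succ n ih => exact ⟨MemLp.zero, fun a => ⟨fun _ => 0, ⟨locallyIntegrableOn_zero,
      locallyIntegrableOn_zero, by simp⟩, ih⟩⟩

theorem Sob.sum [CompleteSpace X] (hΩ : IsBoundedSmoothDomain Ω) {n : ℕ} {ι : Type} (s : Finset ι)
    {f : ι → Euc 3 → X} (hf : ∀ i, Sob Ω n (f i)) : Sob Ω n (fun x => ∑ i ∈ s, f i x) := by
  classical
  induction s using Finset.induction_on with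
  | empty => simpa using sob_zero n
  | insert i s hi ih =>
    simp only [Finset.sum_insert hi]
    exact (hf i).add hΩ ih

theorem Sob.pi [CompleteSpace X] (hΩ : IsBoundedSmoothDomain Ω) {n : ℕ} {ι : Type} [Fintype ι]
    {f : ι → Euc 3 → X} (hf : ∀ i, Sob Ω n (f i)) : Sob Ω n (fun x i => f i x) := by
  classical
  have h := Sob.sum hΩ Finset.univ fun i =>
    (hf i).clm hΩ (ContinuousLinearMap.single ℝ (fun _ : ι => X) i)
  convert h using 1
  funext x i
  simp [Finset.sum_apply, Pi.single_apply]

theorem Sob.prodMk [CompleteSpace X] [CompleteSpace Y] (hΩ : IsBoundedSmoothDomain Ω) {n : ℕ}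
    {f : Euc 3 → X} {g : Euc 3 → Y} (hf : Sob Ω n f) (hg : Sob Ω n g) :
    Sob Ω n (fun x => (f x, g x)) := by
  have h := (hf.clm hΩ (ContinuousLinearMap.inl ℝ X Y)).add hΩ
    (hg.clm hΩ (ContinuousLinearMap.inr ℝ X Y))
  convert h using 1
  funext x
  simp

theorem Sob.memLp_four [CompleteSpace X] (hΩ : IsBoundedSmoothDomain Ω) {f : Euc 3 → X}
    (hf : Sob Ω 1 f) : MemLp f 4 (volume.restrict Ω) := by
  obtain ⟨F, φ, hφ, -⟩ := (sob_succ_iff hΩ).1 hf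
  exact (hφ.lpTendsto_four hΩ).memLp

theorem Sob.partial [CompleteSpace X] (hΩ : IsBoundedSmoothDomain Ω) {n : ℕ} {f g : Euc 3 → X}
    (hf : Sob Ω (n + 1) f) {a : Fin 3} (hg : HasWeakPartial Ω a f g) : Sob Ω n g := by
  obtain ⟨g', hg', hn⟩ := hf.2 a
  exact hn.congr (hg'.ae_eq hΩ.isOpen hg)

theorem Sob.exists_smoothApprox_four [CompleteSpace X] (hΩ : IsBoundedSmoothDomain Ω)
    {f : Euc 3 → X} (hf : Sob Ω 2 f) {G : Fin 3 → Euc 3 → X}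
    (hG : ∀ a, HasWeakPartial Ω a f (G a)) : ∃ φ, SmoothApprox Ω 4 f G φ :=
  exists_smoothApprox hΩ (by norm_num) (by simp) (hf.of_succ.memLp_four hΩ)
    (fun a => (hf.partial hΩ (hG a)).memLp_four hΩ) hG

/-- Two derivatives are the threshold: W^{2,2} lies in W^{1,4}, hence in L^∞. For m = 0 the
derivative DF(f)∂f is a product of W^{1,4} and W^{1,2}, so it lies in W^{1,2}. For larger m it is a
smooth function of the pair (f, ∂f), which has one derivative less; the induction therefore ranges
over all spaces X and Y. -/
theorem Sob.comp (hΩ : IsBoundedSmoothDomain Ω) (m : ℕ) : ∀ {X Y : Type} [NormedAddCommGroup X]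
    [NormedSpace ℝ X] [NormedAddCommGroup Y] [NormedSpace ℝ Y] [FiniteDimensional ℝ X]
    [FiniteDimensional ℝ Y] {f : Euc 3 → X} {F : X → Y}, Sob Ω (m + 2) f → ContDiff ℝ ∞ F →
      Sob Ω (m + 2) (fun x => F (f x)) := by
  induction m with
  | zero =>
    intro X Y _ _ _ _ _ _ f F hf hF
    have := FiniteDimensional.complete ℝ X
    have := FiniteDimensional.complete ℝ Y
    choose G hG hG1 using hf.2
    obtain ⟨φ, hφ⟩ := hf.exists_smoothApprox_four hΩ hG
    refine (sob_succ_iff hΩ).2 ⟨_, _, (hφ.comp hΩ hF).mono_exponent hΩ (by norm_num), fun a => ?_⟩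
    obtain ⟨H, ψ, hψ, -⟩ := (sob_succ_iff hΩ).1 (hG1 a)
    have h := (hφ.comp hΩ (contDiff_fderiv_infty hF)).bilin hΩ hψ
      (ContinuousLinearMap.id ℝ (X →L[ℝ] Y))
    exact (sob_succ_iff hΩ).2 ⟨_, _, h, fun b => h.memLp_partial b⟩
  | succ m ih =>
    intro X Y _ _ _ _ _ _ f F hf hF
    have := FiniteDimensional.complete ℝ X
    have := FiniteDimensional.complete ℝ Y
    choose G hG hG1 using hf.2
    obtain ⟨φ, hφ⟩ := (hf.mono (by omega) : Sob Ω 2 f).exists_smoothApprox_four hΩ hG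
    refine (sob_succ_iff hΩ).2 ⟨_, _, (hφ.comp hΩ hF).mono_exponent hΩ (by norm_num), fun a => ?_⟩
    exact ih (F := fun z : X × X => fderiv ℝ F z.1 z.2) (hf.of_succ.prodMk hΩ (hG1 a))
      (((contDiff_fderiv_infty hF).comp contDiff_fst).clm_apply contDiff_snd)

variable {K : ℕ}

theorem Sob.hasWeakPartial {n : ℕ} {f : Euc 3 → Euc K} (hf : Sob Ω (n + 1) f) (a : Fin 3) :
    HasWeakPartial Ω a f (weakPartial Ω a f) := by
  obtain ⟨g, hg, -⟩ := hf.2 a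
  have h : ∃ g, IsWeakPartial Ω a f g := ⟨g, hg⟩
  rw [weakPartial, dif_pos h]
  exact h.choose_spec

theorem Sob.weakPartial (hΩ : IsBoundedSmoothDomain Ω) {n : ℕ} {f : Euc 3 → Euc K}
    (hf : Sob Ω (n + 1) f) (a : Fin 3) : Sob Ω n (weakPartial Ω a f) :=
  hf.partial hΩ (hf.hasWeakPartial a)

theorem Sob.weakLaplacian (hΩ : IsBoundedSmoothDomain Ω) {n : ℕ} {f : Euc 3 → Euc K}
    (hf : Sob Ω (n + 2) f) : Sob Ω n (weakLaplacian Ω f) :=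
  Sob.sum hΩ Finset.univ fun a => (hf.weakPartial hΩ a).weakPartial hΩ a

variable {N : Set (Euc K)} {d : ℕ} {J : Euc K → Euc K →L[ℝ] Euc K} {u₀ : Euc 3 → Euc K} {k : ℕ}

/-- Each time derivative costs two space derivatives, through ΔV_i; what is left is always at least
W^{2,2}, so `Sob.comp` applies. -/
theorem sob_timeDeriv (hN : IsEmbeddedSubmanifold N d) (hNc : IsClosed N)
    (hJ : IsKahlerStructure N J) (hΩ : IsBoundedSmoothDomain Ω)
    (hu : Sob Ω (2 * k + 2) u₀) (huN : ∀ᵐ x ∂(volume.restrict Ω), u₀ x ∈ N) (j : ℕ) (hj : j ≤ k) :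
    Sob Ω (2 * (k - j) + 2) (timeDeriv Ω N J u₀ j) := by
  induction j using Nat.strong_induction_on with
  | _ j ih =>
    cases j with
    | zero => rwa [timeDeriv_zero]
    | succ j =>
      obtain ⟨F, hF, h⟩ := exists_timeDeriv_succ_eq hN hNc hJ j
      have hV : ∀ i : Fin (j + 1), Sob Ω (2 * (k - (j + 1)) + 2 + 2) (timeDeriv Ω N J u₀ i) :=
        fun i => (ih i i.2 (by omega)).mono (by omega)
      have hjet : Sob Ω (2 * (k - (j + 1)) + 2) (fun x (i : Fin (j + 1)) => flowJet Ω N J u₀ x i) :=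
        Sob.pi hΩ fun i => (hV i).of_succ.of_succ.prodMk hΩ
          ((Sob.pi hΩ fun a => ((hV i).of_succ.weakPartial hΩ a)).prodMk hΩ
            ((hV i).weakLaplacian hΩ))
      refine (Sob.comp hΩ _ hjet hF).congr ?_
      filter_upwards [huN] with x hx using (h Ω u₀ x hx).symm

theorem sob_covTimeDeriv (hN : IsEmbeddedSubmanifold N d) (hNc : IsClosed N)
    (hJ : IsKahlerStructure N J) (hΩ : IsBoundedSmoothDomain Ω)
    (hu : Sob Ω (2 * k + 2) u₀) (huN : ∀ᵐ x ∂(volume.restrict Ω), u₀ x ∈ N) (j : ℕ) (hj : j ≤ k) :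
    Sob Ω (2 * (k - j) + 2) (covTimeDeriv Ω N J u₀ j) := by
  obtain ⟨R, hR, h⟩ := exists_covTimeDeriv_eq hN hNc hJ j
  have hV : ∀ i : ℕ, i ≤ j → Sob Ω (2 * (k - j) + 2) (timeDeriv Ω N J u₀ i) := fun i hi =>
    (sob_timeDeriv hN hNc hJ hΩ hu huN i (by omega)).mono (by omega)
  have h1 : Sob Ω (2 * (k - j) + 2) (fun x (i : Fin j) => timeDeriv Ω N J u₀ i x) :=
    Sob.pi hΩ fun i => hV i i.2.le
  have h2 := Sob.comp hΩ _ ((hV j le_rfl).prodMk hΩ h1)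
    (F := fun z : Euc K × (Fin j → Euc K) => z.1 - R z.2) (contDiff_fst.sub (hR.comp contDiff_snd))
  refine h2.congr ?_
  filter_upwards [huN] with x hx using (h Ω u₀ x hx).symm

end

/-! ### Weak derivatives of composite functions -/

section

variable {Ω : Set (Euc 3)} {X Y : Type} [NormedAddCommGroup X] [NormedSpace ℝ X]
  [NormedAddCommGroup Y] [NormedSpace ℝ Y] {K : ℕ}

theorem Sob.hasWeakPartial_comp [FiniteDimensional ℝ X] [FiniteDimensional ℝ Y]
    (hΩ : IsBoundedSmoothDomain Ω) {f : Euc 3 → X} (hf : Sob Ω 2 f)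
    {G : Fin 3 → Euc 3 → X} (hG : ∀ a, HasWeakPartial Ω a f (G a)) {F : X → Y}
    (hF : ContDiff ℝ ∞ F) (a : Fin 3) :
    HasWeakPartial Ω a (fun x => F (f x)) (fun x => fderiv ℝ F (f x) (G a x)) := by
  have := FiniteDimensional.complete ℝ X
  have := FiniteDimensional.complete ℝ Y
  obtain ⟨φ, hφ⟩ := hf.exists_smoothApprox_four hΩ hG
  exact (hφ.comp hΩ hF).hasWeakPartial hΩ (by norm_num) a

theorem Sob.hasWeakPartial_pi [CompleteSpace X] (hΩ : IsBoundedSmoothDomain Ω) {ι : Type}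
    [Fintype ι] {f : ι → Euc 3 → X} (hf : ∀ i, Sob Ω 1 (f i)) {a : Fin 3} {g : ι → Euc 3 → X}
    (hg : ∀ i, HasWeakPartial Ω a (f i) (g i)) :
    HasWeakPartial Ω a (fun x i => f i x) (fun x i => g i x) := by
  obtain ⟨G, φ, h, -⟩ := (sob_succ_iff hΩ).1 (Sob.pi hΩ hf)
  refine (h.hasWeakPartial hΩ (by norm_num) a).congr .rfl ?_
  have h1 : ∀ i, (fun x => G a x i) =ᵐ[volume.restrict Ω] g i := fun i =>
    ((h.clm (ContinuousLinearMap.proj (R := ℝ) (φ := fun _ : ι => X) i)).hasWeakPartial hΩ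
      (by norm_num) a).ae_eq hΩ.isOpen (hg i)
  filter_upwards [ae_all_iff.2 h1] with x hx
  exact funext hx

theorem Sob.hasWeakPartial_prodMk [CompleteSpace X] [CompleteSpace Y]
    (hΩ : IsBoundedSmoothDomain Ω) {f : Euc 3 → X} {f' : Euc 3 → Y} (hf : Sob Ω 1 f)
    (hf' : Sob Ω 1 f') {a : Fin 3} {g : Euc 3 → X} {g' : Euc 3 → Y} (hg : HasWeakPartial Ω a f g)
    (hg' : HasWeakPartial Ω a f' g') :
    HasWeakPartial Ω a (fun x => (f x, f' x)) (fun x => (g x, g' x)) := by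
  obtain ⟨G, φ, h, -⟩ := (sob_succ_iff hΩ).1 (hf.prodMk hΩ hf')
  refine (h.hasWeakPartial hΩ (by norm_num) a).congr .rfl ?_
  have h1 := ((h.clm (ContinuousLinearMap.fst ℝ X Y)).hasWeakPartial hΩ
      (by norm_num) a).ae_eq hΩ.isOpen hg
  have h2 := ((h.clm (ContinuousLinearMap.snd ℝ X Y)).hasWeakPartial hΩ
      (by norm_num) a).ae_eq hΩ.isOpen hg'
  filter_upwards [h1, h2] with x hx hx'
  exact Prod.ext hx hx'

/-! ### Traces and normal components -/

theorem hasTrace_iff (hΩ : IsBoundedSmoothDomain Ω) {f g : Euc 3 → Euc K} : HasTrace Ω f g ↔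
    ∃ G φ, SmoothApprox Ω 2 f G φ ∧ LpTendsto 2 (surfaceMeasure Ω) φ g := by
  constructor
  · rintro ⟨hf, hg, φ, hφ, h1, h2, h3⟩
    rw [memSobolev_iff_sob] at hf
    exact ⟨_, φ, ⟨hf.memLp, fun a => (hf.weakPartial hΩ a).memLp, hφ, h1, h2⟩,
      ⟨hg, fun n => (hφ n).continuous.aestronglyMeasurable, h3⟩⟩
  · rintro ⟨G, φ, h, h'⟩
    have hf : Sob Ω 1 f := (sob_succ_iff hΩ).2 ⟨G, φ, h, fun a => h.memLp_partial a⟩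
    have h2 : SmoothApprox Ω 2 f (fun a => weakPartial Ω a f) φ := h.congr .rfl fun a =>
      (h.hasWeakPartial hΩ (by norm_num) a).ae_eq hΩ.isOpen (hf.hasWeakPartial a)
    exact ⟨(memSobolev_iff_sob 1 f).2 hf, h'.memLp, φ, h.contDiff, h.tendsto, h2.tendsto_partial,
      h'.tendsto⟩

theorem NormalComponentVanishes.congr (hΩ : IsBoundedSmoothDomain Ω) {F G : Fin 3 → Euc 3 → Euc K}
    (h : NormalComponentVanishes Ω F) (hFG : ∀ a, F a =ᵐ[volume.restrict Ω] G a) :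
    NormalComponentVanishes Ω G := by
  obtain ⟨g, hg, h0⟩ := h
  refine ⟨g, fun a => ?_, h0⟩
  obtain ⟨H, φ, h1, h2⟩ := (hasTrace_iff hΩ).1 (hg a)
  exact (hasTrace_iff hΩ).2 ⟨H, φ, h1.congr (hFG a) fun _ => .rfl, h2⟩

theorem NormalComponentVanishes.add (hΩ : IsBoundedSmoothDomain Ω) {F G : Fin 3 → Euc 3 → Euc K}
    (hF : NormalComponentVanishes Ω F) (hG : NormalComponentVanishes Ω G) :
    NormalComponentVanishes Ω (fun a x => F a x + G a x) := by
  obtain ⟨f, hf, hf0⟩ := hF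
  obtain ⟨g, hg, hg0⟩ := hG
  refine ⟨fun a x => f a x + g a x, fun a => ?_, ?_⟩
  · obtain ⟨H, φ, h1, h2⟩ := (hasTrace_iff hΩ).1 (hf a)
    obtain ⟨H', φ', h1', h2'⟩ := (hasTrace_iff hΩ).1 (hg a)
    exact (hasTrace_iff hΩ).2 ⟨_, _, h1.add (by norm_num) h1', h2.add (by norm_num) h2'⟩
  · filter_upwards [hf0, hg0] with x hx hx'
    simp only [smul_add, Finset.sum_add_distrib, hx, hx', add_zero]

/-- Multiplication by coefficients in `W^{1,4}`. -/
theorem NormalComponentVanishes.mul (hΩ : IsBoundedSmoothDomain Ω) {G : Fin 3 → Euc 3 → Euc K}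
    (hG : NormalComponentVanishes Ω G) {c : Euc 3 → Euc K →L[ℝ] Euc K}
    {C : Fin 3 → Euc 3 → Euc K →L[ℝ] Euc K} {ψ : ℕ → Euc 3 → Euc K →L[ℝ] Euc K}
    (hc : SmoothApprox Ω 4 c C ψ) : NormalComponentVanishes Ω (fun a x => c x (G a x)) := by
  obtain ⟨g, hg, hg0⟩ := hG
  obtain ⟨c₀, hc₀⟩ := hc.exists_lpTendsto_surface hΩ
  refine ⟨fun a x => c₀ x (g a x), fun a => ?_, ?_⟩
  · obtain ⟨H, φ, h1, h2⟩ := (hasTrace_iff hΩ).1 (hg a)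
    exact (hasTrace_iff hΩ).2 ⟨_, _,
      hc.bilin hΩ h1 (ContinuousLinearMap.id ℝ (Euc K →L[ℝ] Euc K)),
      hc₀.bilin (by norm_num) (ContinuousLinearMap.id ℝ (Euc K →L[ℝ] Euc K)) h2⟩
  · filter_upwards [hg0] with x hx
    simp only [← map_smul, ← map_sum, hx, map_zero]

theorem NormalComponentVanishes.mul_comp [FiniteDimensional ℝ X] (hΩ : IsBoundedSmoothDomain Ω)
    {G : Fin 3 → Euc 3 → Euc K} (hG : NormalComponentVanishes Ω G) {w : Euc 3 → X}
    (hw : Sob Ω 2 w) {Ψ : X → Euc K →L[ℝ] Euc K} (hΨ : ContDiff ℝ ∞ Ψ) :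
    NormalComponentVanishes Ω (fun a x => Ψ (w x) (G a x)) := by
  have := FiniteDimensional.complete ℝ X
  choose W hW _ using hw.2
  obtain ⟨φ, hφ⟩ := hw.exists_smoothApprox_four hΩ hW
  exact hG.mul hΩ (hφ.comp hΩ hΨ)

theorem normalComponentVanishes_zero (hΩ : IsBoundedSmoothDomain Ω) :
    NormalComponentVanishes Ω (fun _ _ => (0 : Euc K)) := by
  refine ⟨fun _ _ => 0, fun a => ?_, by simp⟩
  refine (hasTrace_iff hΩ).2 ⟨fun _ _ => 0, fun _ _ => 0, ⟨.zero, fun _ => .zero,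
    fun _ => contDiff_const, ?_, fun b => ?_⟩, ⟨.zero, fun _ => aestronglyMeasurable_const, ?_⟩⟩
  · simp
  · simp
  · simp

theorem NormalComponentVanishes.sum (hΩ : IsBoundedSmoothDomain Ω) {ι : Type} (s : Finset ι)
    {G : ι → Fin 3 → Euc 3 → Euc K} (hG : ∀ i, NormalComponentVanishes Ω (G i)) :
    NormalComponentVanishes Ω (fun a x => ∑ i ∈ s, G i a x) := by
  classical
  induction s using Finset.induction_on with
  | empty => simpa using normalComponentVanishes_zero hΩ
  | insert i s hi ih =>
    simp only [Finset.sum_insert hi]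
    exact (hG i).add hΩ ih

/-! ### Functions with values in a submanifold -/

variable {N : Set (Euc K)} {d : ℕ}

/-- The map χ(z)(z - r(z)) is smooth on ℝᴷ and vanishes on N, so its composition with u is zero
almost everywhere and so is its weak derivative. Where χ = 1 this reads ∂_a u = Dr(u)∂_a u, which is
tangent. -/
theorem ae_partial_mem_tangentSpace_of_retraction (hΩ : IsBoundedSmoothDomain Ω)
    {u : Euc 3 → Euc K} (hu : Sob Ω 2 u) (huN : ∀ᵐ x ∂(volume.restrict Ω), u x ∈ N)
    {y : Euc K} {r : Euc K → Euc K} (hr : IsRetractionNear N y r) :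
    ∃ O ∈ 𝓝 y, ∀ a, ∀ᵐ x ∂(volume.restrict Ω), u x ∈ O →
      weakPartial Ω a u x ∈ tangentSpace N (u x) := by
  obtain ⟨ε, hε, hεr⟩ := Metric.eventually_nhds_iff_ball.1 (hr.2.and hr.eventually)
  let χ : ContDiffBump y := ⟨ε / 4, ε / 2, by positivity, by linarith⟩
  set F : Euc K → Euc K := fun z => χ z • (z - r z) with hF_def
  have hF : ContDiff ℝ ∞ F := (χ.contDiff (n := (⊤ : ℕ∞))).smul (contDiff_id.sub hr.1)
  have hFN : ∀ z ∈ N, F z = 0 := fun z hz => by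
    by_cases hzε : z ∈ Metric.ball y ε
    · simp [hF_def, (hεr z hzε).1.2 hz]
    · have : χ z = 0 := χ.zero_of_le_dist (by
        rw [Metric.mem_ball, not_lt] at hzε
        exact le_trans (show ε / 2 ≤ ε by linarith) hzε)
      simp [hF_def, this]
  refine ⟨Metric.ball y (ε / 4), Metric.ball_mem_nhds _ (by positivity), fun a => ?_⟩
  have h1 := hu.hasWeakPartial_comp hΩ (fun a => hu.hasWeakPartial a) hF a
  have h2 : HasWeakPartial Ω a (fun _ => (0 : Euc K)) (fun _ => 0) :=
    ⟨locallyIntegrableOn_zero, locallyIntegrableOn_zero, by simp⟩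
  have h3 := (h1.congr (huN.mono fun x hx => hFN _ hx) .rfl).ae_eq hΩ.isOpen h2
  filter_upwards [huN, h3] with x hxN hx hxO
  have h4 : F =ᶠ[𝓝 (u x)] fun z => z - r z := by
    filter_upwards [Metric.isOpen_ball.mem_nhds hxO] with z hz
    rw [hF_def]
    simp [χ.one_of_mem_closedBall (Metric.ball_subset_closedBall hz)]
  have h5 : HasFDerivAt (fun z => z - r z)
      (ContinuousLinearMap.id ℝ (Euc K) - fderiv ℝ r (u x)) (u x) :=
    (hasFDerivAt_id _).sub (hr.1.differentiable (by simp) _).hasFDerivAt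
  rw [h4.fderiv_eq, h5.fderiv, sub_apply, ContinuousLinearMap.id_apply, sub_eq_zero] at hx
  rw [hx]
  exact (hεr _ (Metric.ball_subset_ball (by linarith) hxO)).2.fderiv_mem hxN _

theorem IsEmbeddedSubmanifold.ae_partial_mem_tangentSpace (hN : IsEmbeddedSubmanifold N d)
    (hΩ : IsBoundedSmoothDomain Ω) {u : Euc 3 → Euc K} (hu : Sob Ω 2 u)
    (huN : ∀ᵐ x ∂(volume.restrict Ω), u x ∈ N) (a : Fin 3) :
    ∀ᵐ x ∂(volume.restrict Ω), weakPartial Ω a u x ∈ tangentSpace N (u x) := by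
  have h : ∀ y ∈ N, ∃ O ∈ 𝓝 y, ∀ a, ∀ᵐ x ∂(volume.restrict Ω), u x ∈ O →
      weakPartial Ω a u x ∈ tangentSpace N (u x) := fun y hy =>
    let ⟨_, hr⟩ := hN.exists_retraction hy
    ae_partial_mem_tangentSpace_of_retraction hΩ hu huN hr
  choose! O hO hOa using h
  -- The exceptional null set depends on the centre y, so N is covered by countably many of the
  -- neighbourhoods.
  obtain ⟨t, htN, htc, hcov⟩ := TopologicalSpace.countable_cover_nhdsWithin
    fun y hy => mem_nhdsWithin_of_mem_nhds (hO y hy)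
  filter_upwards [huN, (ae_ball_iff htc).2 fun y hy => hOa y (htN hy) a] with x hxN hx
  obtain ⟨y, hy, hxy⟩ := Set.mem_iUnion₂.1 (hcov hxN)
  exact hx y hy hxy

end

/-! ### Equivalence of the compatibility conditions -/

section

variable {Ω : Set (Euc 3)} {K d : ℕ} {N : Set (Euc K)} {J : Euc K → Euc K →L[ℝ] Euc K}
  {u₀ : Euc 3 → Euc K}

theorem covTimeDeriv_zero : covTimeDeriv Ω N J u₀ 0 = u₀ := by
  funext x
  simp [covTimeDeriv, timeDeriv_zero]

theorem NormalComponentVanishes.sub (hΩ : IsBoundedSmoothDomain Ω) {F G : Fin 3 → Euc 3 → Euc K}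
    (hF : NormalComponentVanishes Ω F) (hG : NormalComponentVanishes Ω G) :
    NormalComponentVanishes Ω (fun a x => F a x - G a x) := by
  -- Negation is multiplication by the constant coefficient -1; the zero function only serves as a
  -- dummy argument.
  have h := hF.add hΩ (hG.mul_comp hΩ (sob_zero (X := ℝ) 2)
    (Ψ := fun _ => -ContinuousLinearMap.id ℝ (Euc K)) contDiff_const)
  simpa [sub_eq_add_neg] using h

theorem normalComponentVanishes_covPartial_zero_iff (hN : IsEmbeddedSubmanifold N d)
    (hΩ : IsBoundedSmoothDomain Ω) (hu : Sob Ω 2 u₀)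
    (huN : ∀ᵐ x ∂(volume.restrict Ω), u₀ x ∈ N) :
    NormalComponentVanishes Ω (fun a => weakPartial Ω a (timeDeriv Ω N J u₀ 0)) ↔
      NormalComponentVanishes Ω (fun a => covPartial Ω N u₀ a (covTimeDeriv Ω N J u₀ 0)) := by
  rw [timeDeriv_zero, covTimeDeriv_zero]
  have h : ∀ a, weakPartial Ω a u₀ =ᵐ[volume.restrict Ω] covPartial Ω N u₀ a u₀ := fun a => by
    filter_upwards [hN.ae_partial_mem_tangentSpace hΩ hu huN a] with x hx
    exact (tangentProj_apply_eq_self hx).symm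
  exact ⟨fun hc => hc.congr hΩ h, fun hc => hc.congr hΩ fun a => (h a).symm⟩

theorem ae_partial_sub_eq (hΩ : IsBoundedSmoothDomain Ω) {j : ℕ} {V : ℕ → Euc 3 → Euc K}
    {v : Euc 3 → Euc K} (hV : ∀ i ≤ j, Sob Ω 2 (V i)) (hv : Sob Ω 2 v)
    {R : (Fin j → Euc K) → Euc K} (hR : ContDiff ℝ ∞ R)
    (hvR : ∀ᵐ x ∂(volume.restrict Ω), v x = V j x - R fun i => V i x) (a : Fin 3) :
    ∀ᵐ x ∂(volume.restrict Ω), weakPartial Ω a v x = weakPartial Ω a (V j) x -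
      ∑ i : Fin j, fderiv ℝ R (fun i => V i x) (Pi.single i (weakPartial Ω a (V i) x)) := by
  have hW : Sob Ω 2 (fun x (i : Fin j) => V i x) := Sob.pi hΩ fun i => hV i i.2.le
  have hWp : ∀ a, HasWeakPartial Ω a (fun x (i : Fin j) => V i x)
      (fun x i => weakPartial Ω a (V i) x) := fun a =>
    Sob.hasWeakPartial_pi hΩ (f := fun i : Fin j => V i) (fun i => (hV i i.2.le).of_succ)
      fun i => (hV i i.2.le).hasWeakPartial a
  have h1 := (hW.prodMk hΩ (hV j le_rfl)).hasWeakPartial_comp hΩ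
    (fun a => hW.of_succ.hasWeakPartial_prodMk hΩ (hV j le_rfl).of_succ (hWp a)
      ((hV j le_rfl).hasWeakPartial a))
    (F := fun z : (Fin j → Euc K) × Euc K => z.2 - R z.1)
    (contDiff_snd.sub (hR.comp contDiff_fst)) a
  have h2 := (h1.congr (hvR.mono fun _ hx => hx.symm) .rfl).ae_eq hΩ.isOpen (hv.hasWeakPartial a)
  filter_upwards [h2] with x hx
  have h3 : ∀ z : (Fin j → Euc K) × Euc K, HasFDerivAt
      (fun z : (Fin j → Euc K) × Euc K => z.2 - R z.1)
      (ContinuousLinearMap.snd ℝ _ _ - (fderiv ℝ R z.1).comp (ContinuousLinearMap.fst ℝ _ _)) z :=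
    fun z => hasFDerivAt_snd.sub ((hR.differentiable (by simp) z.1).hasFDerivAt.comp z hasFDerivAt_fst)
  rw [← hx, (h3 _).fderiv, sub_apply, ContinuousLinearMap.comp_apply, ← map_sum,
    Finset.univ_sum_single]
  rfl

/-- Differentiate P(u)v = v: the full derivative of a tangent field is its covariant derivative plus
a term linear in ∂_a u. -/
theorem ae_partial_eq_of_tangent (hΩ : IsBoundedSmoothDomain Ω) {u v : Euc 3 → Euc K}
    (hu : Sob Ω 2 u) (hv : Sob Ω 2 v) {P : Euc K → Euc K →L[ℝ] Euc K} (hP : ContDiff ℝ ∞ P)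
    (hPv : ∀ᵐ x ∂(volume.restrict Ω), P (u x) (v x) = v x) (a : Fin 3) :
    ∀ᵐ x ∂(volume.restrict Ω), weakPartial Ω a v x = P (u x) (weakPartial Ω a v x) +
      fderiv ℝ P (u x) (weakPartial Ω a u x) (v x) := by
  have h1 := (hu.prodMk hΩ hv).hasWeakPartial_comp hΩ
    (fun a => hu.of_succ.hasWeakPartial_prodMk hΩ hv.of_succ (hu.hasWeakPartial a)
      (hv.hasWeakPartial a))
    (F := fun z : Euc K × Euc K => P z.1 z.2)
    ((hP.comp contDiff_fst).clm_apply contDiff_snd) a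
  have h2 := (h1.congr hPv .rfl).ae_eq hΩ.isOpen (hv.hasWeakPartial a)
  filter_upwards [h2] with x hx
  have hP1 : HasFDerivAt (fun z : Euc K × Euc K => P z.1)
      ((fderiv ℝ P (u x)).comp (ContinuousLinearMap.fst ℝ _ _)) (u x, v x) :=
    (hP.differentiable (by simp) (u x)).hasFDerivAt.comp (u x, v x) hasFDerivAt_fst
  have h3 := hP1.clm_apply (hasFDerivAt_snd (𝕜 := ℝ) (p := (u x, v x)))
  have h4 : fderiv ℝ (fun z : Euc K × Euc K => P z.1 z.2) (u x, v x) = _ := h3.fderiv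
  conv_lhs => rw [← hx, h4]
  simp

/-- Modulo terms linear in ∂_a V_i with i < j, whose normal components vanish by `hC`, the
derivatives of V_j and v_j(0) coincide. Passing from ∂_a v_j to P(u₀)∂_a v_j loses nothing: for j ≥
1 the normal part is linear in ∂_a u₀ and is covered by `hC` at i = 0. -/
theorem normalComponentVanishes_covPartial_iff (hN : IsEmbeddedSubmanifold N d) (hNc : IsClosed N)
    (hJ : IsKahlerStructure N J) (hΩ : IsBoundedSmoothDomain Ω) {j : ℕ}
    (hV : ∀ i ≤ j, Sob Ω 2 (timeDeriv Ω N J u₀ i)) (hv : Sob Ω 2 (covTimeDeriv Ω N J u₀ j))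
    (huN : ∀ᵐ x ∂(volume.restrict Ω), u₀ x ∈ N)
    (hC : ∀ i < j, NormalComponentVanishes Ω fun a => weakPartial Ω a (timeDeriv Ω N J u₀ i)) :
    NormalComponentVanishes Ω (fun a => weakPartial Ω a (timeDeriv Ω N J u₀ j)) ↔
      NormalComponentVanishes Ω (fun a => covPartial Ω N u₀ a (covTimeDeriv Ω N J u₀ j)) := by
  have hu : Sob Ω 2 u₀ := by simpa only [timeDeriv_zero] using hV 0 (Nat.zero_le j)
  rcases j with _ | j
  · exact normalComponentVanishes_covPartial_zero_iff hN hΩ hu huN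
  obtain ⟨P, hP, hPN⟩ := hN.exists_extension_tangentProj hNc
  obtain ⟨R, hR, h⟩ := exists_covTimeDeriv_eq hN hNc hJ (j + 1)
  set V := timeDeriv Ω N J u₀ with hV_def
  set v := covTimeDeriv Ω N J u₀ (j + 1)
  have e1 := ae_partial_sub_eq hΩ hV hv hR (huN.mono fun x hx => h Ω u₀ x hx)
  have e2 := ae_partial_eq_of_tangent hΩ hu hv hP (huN.mono fun x hx => by
    rw [hPN _ hx]
    exact tangentProj_covTimeDeriv hN hNc Ω hx j)
  have hW : Sob Ω 2 (fun x (i : Fin (j + 1)) => V i x) := Sob.pi hΩ fun i => hV i i.2.le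
  have hT : NormalComponentVanishes Ω fun a x => ∑ i : Fin (j + 1),
      fderiv ℝ R (fun i => V i x) (Pi.single i (weakPartial Ω a (V i) x)) :=
    NormalComponentVanishes.sum hΩ Finset.univ fun i => (hC i i.2).mul_comp hΩ hW
      (Ψ := fun z => (fderiv ℝ R z).comp (ContinuousLinearMap.single ℝ (fun _ => Euc K) i))
      ((contDiff_fderiv_infty hR).clm_comp contDiff_const)
  constructor
  · intro hc
    refine ((hc.sub hΩ hT).mul_comp hΩ hu hP).congr hΩ fun a => ?_
    filter_upwards [huN, e1 a] with x hx hx1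
    rw [← hx1, hPN _ hx, covPartial]
  · intro hc
    have h0 : NormalComponentVanishes Ω fun a => weakPartial Ω a u₀ := by
      simpa only [hV_def, timeDeriv_zero] using hC 0 (Nat.succ_pos j)
    -- The coefficient is X ↦ DP(u₀)(X)v_j; flipping the bilinear map exhibits it as an operator
    -- acting on ∂_a u₀.
    have hQ := h0.mul_comp hΩ (hu.prodMk hΩ hv)
      (Ψ := fun z : Euc K × Euc K => (fderiv ℝ P z.1).flip z.2)
      (((ContinuousLinearMap.flipₗᵢ ℝ (Euc K) (Euc K) (Euc K)).contDiff.comp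
        ((contDiff_fderiv_infty hP).comp contDiff_fst)).clm_apply contDiff_snd)
    refine ((hc.add hΩ hQ).add hΩ hT).congr hΩ fun a => ?_
    filter_upwards [huN, e1 a, e2 a] with x hx hx1 hx2
    rw [covPartial, ← hPN _ hx, ContinuousLinearMap.flip_apply, ← hx2, hx1, sub_add_cancel]

end

end SchrodingerFlow

end

theorem proposition5p2 {K d : ℕ} (N : Set (SchrodingerFlow.Euc K))
    (J : SchrodingerFlow.Euc K → SchrodingerFlow.Euc K →L[ℝ] SchrodingerFlow.Euc K)
    (Ω : Set (SchrodingerFlow.Euc 3))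
    (hN : SchrodingerFlow.IsEmbeddedSubmanifold N d) (hNc : IsClosed N)
    (hJ : SchrodingerFlow.IsKahlerStructure N J)
    (hΩ : SchrodingerFlow.IsBoundedSmoothDomain Ω)
    (k : ℕ) (u₀ : SchrodingerFlow.Euc 3 → SchrodingerFlow.Euc K)
    (hu₀ : SchrodingerFlow.MemSobolevInto Ω N (2 * k + 2) u₀) :
    (∀ j ≤ k,
      SchrodingerFlow.MemSobolev Ω (2 * (k - j) + 2)
        (SchrodingerFlow.timeDeriv Ω N J u₀ j) ∧
      SchrodingerFlow.MemSobolev Ω (2 * (k - j) + 2)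
        (SchrodingerFlow.covTimeDeriv Ω N J u₀ j)) ∧
    (SchrodingerFlow.CompatibilityCondition Ω N J u₀ k ↔
      SchrodingerFlow.IntrinsicCompatibilityCondition Ω N J u₀ k) := by
  obtain ⟨hu, huN⟩ := hu₀
  rw [SchrodingerFlow.memSobolev_iff_sob] at hu
  have hV := SchrodingerFlow.sob_timeDeriv hN hNc hJ hΩ hu huN
  have hv := SchrodingerFlow.sob_covTimeDeriv hN hNc hJ hΩ hu huN
  have hiff : ∀ j ≤ k, (∀ i < j, SchrodingerFlow.NormalComponentVanishes Ω fun a =>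
      SchrodingerFlow.weakPartial Ω a (SchrodingerFlow.timeDeriv Ω N J u₀ i)) → _ := fun j hj =>
    SchrodingerFlow.normalComponentVanishes_covPartial_iff hN hNc hJ hΩ
      (fun i hi => (hV i (hi.trans hj)).mono (by omega)) ((hv j hj).mono (by omega)) huN
  refine ⟨fun j hj => ⟨(SchrodingerFlow.memSobolev_iff_sob _ _).2 (hV j hj),
    (SchrodingerFlow.memSobolev_iff_sob _ _).2 (hv j hj)⟩, fun hC j hj => ?_, fun hI j hj => ?_⟩
  · exact (hiff j hj fun i hi => hC i (hi.le.trans hj)).1 (hC j hj)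
  -- The one-order equivalence assumes the extrinsic condition at lower orders, which in this
  -- direction has to be established along the way.
  · induction j using Nat.strong_induction_on with
    | _ j ih => exact (hiff j hj fun i hi => ih i hi (hi.le.trans hj)).2 (hI j hj)
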